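/- Let $\mathrm{PAR}(k)$ be the class of parity functions $a\mapsto\sum_i x_ia_i \pmod 2$ on $\{0,1\}^n$ with $x\in\{0,1\}^n$ of Hamming weight $k$. A learner receives labeled examples $(a,\ell)$ with $a$ uniform on $\{0,1\}^n$, drawn independently; without noise $\ell=\sum_i x_ia_i \pmod 2$ for a hidden $x\in\mathrm{PAR}(k)$, and in the $k$-LPN problem with noise rate $\eta$ each label is in addition flipped independently with probability $\eta$. The learner has *confidence parameter* $\delta$ if for every hidden $x$ of weight $k$ it outputs, with probability at least $1-\delta$, a vector whose parity function disagrees with that of $x$ on less than half of $\{0,1\}^n$ (equivalently, it outputs $x$). Algorithms are randomized unit-cost RAM programs (addition, subtraction, indirect addressing, random bits, requests for examples, random access to the bits of the last example, bitwise output) that are given $n$ and finitely many numerical parameters as input. Let $H(p)=p\log_2\frac1p+(1-p)\log_2\frac1{1-p}$. **Theorem.** For every $\rho>0$ there is a constant $C>0$ such that for every program $\mathcal A$ there are a program $\mathcal A'$ and a constant $K>0$ with the following property. Let $n,k\in\mathbb N$, and suppose that for every $\delta\in(0,1)$ the program $\mathcal A$, given $n$ and some list of parameters $\pi(\delta)$,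 learns $\mathrm{PAR}(k)$ on $n$ variables over the uniform distribution without noise, with confidence parameter $\delta$, using at most $s(\delta)\in\mathbb N$ examples and running time at most $t(\delta)\in\mathbb N$. Then for all $\delta\in(0,1-\rho]$ and $\eta\in(0,\frac13)$ such that $$\eta\, s(\delta/2)\log_2\tfrac1\delta\ \ge\ \rho\qquad\text{or}\qquad \eta\, s(\delta/2)\le \delta/2,$$ the program $\mathcal A'$, given $n,\ s(\delta/2),\ t(\delta/2),\ \lceil\log_2\frac1\delta\rceil,\ \lfloor\frac1\eta\rfloor$ and $\pi(\delta/2)$, solves the $k$-LPN problem on $n$ variables with noise rate $\eta$ and confidence parameter $\delta$, using at most $$C\, s(\delta/2)\log_2\tfrac1\delta$$ examples and running time at most $$K\cdot 2^{\,C\, H(3\eta/2)\, s(\delta/2)\,\log_2(1/\delta)}\cdot\bigl(t(\delta/2)+s(\delta/2)\log_2\tfrac1\delta\bigr).$$ -/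

import Mathlib

open MeasureTheory ProbabilityTheory

noncomputable section

namespace ParityLearning

/-! ### The machine model: a randomized unit-cost RAM with an example oracle -/

/-- Primitive instructions.  Registers and arrays are named by natural numbers; a program names
finitely many of them.  Arithmetic is addition and truncated subtraction only. -/
inductive Instr : Type
  /-- `const r c`: `r := c`. -/
  | const (r c : ℕ)
  /-- `add r p q`: `r := p + q`. -/
  | add (r p q : ℕ)
  /-- `sub r p q`: `r := max (p - q) 0`. -/
  | sub (r p q : ℕ)
  /-- `load r a p`: `r := a[p]`. -/
  | load (r a p : ℕ)
  /-- `store a p q`: `a[p] := q`. -/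
  | store (a p q : ℕ)
  /-- Request a new example from the example source. -/
  | draw
  /-- `bit r p`: `r :=` coordinate number `p` of the last example drawn. -/
  | bit (r p : ℕ)
  /-- `label r`: `r :=` the label of the last example drawn. -/
  | label (r : ℕ)
  /-- `flip r`: `r :=` a fresh random bit. -/
  | flip (r : ℕ)
  /-- `emit p`: append one bit to the output, `0` if register `p` is zero and `1` otherwise. -/
  | emit (p : ℕ)

/-- Programs: structured programs over the primitive instructions. -/
inductive Prog : Type
  | instr (i : Instr)
  | seq (P Q : Prog)
  /-- `ite r P Q`: if register `r` is nonzero run `P`, otherwise run `Q`. -/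
  | ite (r : ℕ) (P Q : Prog)
  /-- `loop r P`: while register `r` is nonzero run `P`. -/
  | loop (r : ℕ) (P : Prog)

/-- A configuration: registers, arrays, the number of examples drawn and of random bits used so
far, and the output written so far. -/
structure State : Type where
  reg : ℕ → ℕ
  mem : ℕ → ℕ → ℕ
  draws : ℕ
  flips : ℕ
  out : List (ZMod 2)

/-- The start configuration on a list of parameters: they stand in the first registers, everything
else is zero. -/
def State.init (par : List ℕ) : State where
  reg := fun r => par.getD r 0
  mem := fun _ _ => 0
  draws := 0
  flips := 0
  out := []

/-- Assignment to a register. -/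
def State.set (σ : State) (r v : ℕ) : State :=
  { σ with reg := Function.update σ.reg r v }

/-- The data a run on inputs of length `n` depends on: the labeled examples in the order in which
they are handed out, and the random bits. -/
structure Source (n : ℕ) : Type where
  point : ℕ → Fin n → ZMod 2
  lab : ℕ → ZMod 2
  coin : ℕ → ZMod 2

/-- Effect of a primitive instruction.  Reading an example before any was drawn, or a coordinate
that is out of range, gives `0`. -/
def Instr.step {n : ℕ} (ω : Source n) (σ : State) : Instr → State
  | .const r c => σ.set r c
  | .add r p q => σ.set r (σ.reg p + σ.reg q)
  | .sub r p q => σ.set r (σ.reg p - σ.reg q)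
  | .load r a p => σ.set r (σ.mem a (σ.reg p))
  | .store a p q =>
      { σ with mem := Function.update σ.mem a (Function.update (σ.mem a) (σ.reg p) (σ.reg q)) }
  | .draw => { σ with draws := σ.draws + 1 }
  | .bit r p =>
      σ.set r (if h : 0 < σ.draws ∧ σ.reg p < n then
        (ω.point (σ.draws - 1) ⟨σ.reg p, h.2⟩).val else 0)
  | .label r => σ.set r (if 0 < σ.draws then (ω.lab (σ.draws - 1)).val else 0)
  | .flip r => { σ.set r (ω.coin σ.flips).val with flips := σ.flips + 1 }
  | .emit p => { σ with out := σ.out ++ [if σ.reg p = 0 then 0 else 1] }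

/-- `Exec ω P σ c τ`: started in `σ`, the program `P` halts in `τ` after exactly `c` steps.  Each
primitive instruction and each evaluation of a test is one step. -/
inductive Exec {n : ℕ} (ω : Source n) : Prog → State → ℕ → State → Prop
  | instr (i : Instr) (σ : State) : Exec ω (.instr i) σ 1 (i.step ω σ)
  | seq {P Q : Prog} {σ τ υ : State} {c d : ℕ} :
      Exec ω P σ c τ → Exec ω Q τ d υ → Exec ω (.seq P Q) σ (c + d) υ
  | ite_true {r : ℕ} {P Q : Prog} {σ τ : State} {c : ℕ} :
      σ.reg r ≠ 0 → Exec ω P σ c τ → Exec ω (.ite r P Q) σ (c + 1) τ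
  | ite_false {r : ℕ} {P Q : Prog} {σ τ : State} {c : ℕ} :
      σ.reg r = 0 → Exec ω Q σ c τ → Exec ω (.ite r P Q) σ (c + 1) τ
  | loop_done {r : ℕ} {P : Prog} {σ : State} :
      σ.reg r = 0 → Exec ω (.loop r P) σ 1 σ
  | loop_step {r : ℕ} {P : Prog} {σ τ υ : State} {c d : ℕ} :
      σ.reg r ≠ 0 → Exec ω P σ c τ → Exec ω (.loop r P) τ d υ →
        Exec ω (.loop r P) σ (c + d + 1) υ

/-! ### Learning parities, with or without noise, over the uniform distribution -/

/-- The uniform distribution on `{0,1}ⁿ`. -/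
def uniformCube (n : ℕ) : Measure (Fin n → ZMod 2) :=
  (PMF.uniformOfFintype (Fin n → ZMod 2)).toMeasure

instance (n : ℕ) : IsProbabilityMeasure (uniformCube n) := by
  unfold uniformCube; infer_instance

/-- A fair random bit. -/
def fairCoin : Measure (ZMod 2) := (PMF.uniformOfFintype (ZMod 2)).toMeasure

instance : IsProbabilityMeasure fairCoin := by
  unfold fairCoin; infer_instance

/-- The sample space: the points of the examples, the noise bits (`1` means mislabeled), and the
random bits of the learner. -/
abbrev Sample (n : ℕ) : Type := (ℕ → Fin n → ZMod 2) × (ℕ → ZMod 2) × (ℕ → ZMod 2)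

/-- Uniform points, noise bits equal to `1` with probability `η`, and fair random bits of the
learner, all independent. -/
def sampleMeasure (n : ℕ) (η : unitInterval) : Measure (Sample n) :=
  (Measure.infinitePi fun _ : ℕ => uniformCube n).prod
    ((Measure.infinitePi fun _ : ℕ => bernoulliMeasure (1 : ZMod 2) 0 η).prod
      (Measure.infinitePi fun _ : ℕ => fairCoin))

/-- The parity function `a ↦ ∑ xᵢ aᵢ (mod 2)` of a vector `x`. -/
def parity {n : ℕ} (x a : Fin n → ZMod 2) : ZMod 2 := ∑ i, x i * a i

/-- What the learner sees when the hidden vector is `x`: the label of each example is the parity of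
its point, flipped where the noise bit is `1`. -/
def source {n : ℕ} (x : Fin n → ZMod 2) (ω : Sample n) : Source n where
  point := ω.1
  lab := fun i => parity x (ω.1 i) + ω.2.1 i
  coin := ω.2.2

/-- The probability of disagreement of two parity functions under the uniform distribution. -/
def disagreement {n : ℕ} (x y : Fin n → ZMod 2) : ℝ :=
  (uniformCube n).real {a | parity x a ≠ parity y a}

/-- The program `P`, run on the parameters `par`, PAC-learns `k`-parities on `n` variables over the
uniform distribution from examples that are mislabeled independently with probability `η`, with
approximation parameter `ε` and confidence parameter `δ`, drawing at most `S` examples and running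
for at most `T` steps (with probability one): for every hidden `x` of weight `k` the output is, with
probability at least `1 - δ`, a vector whose parity function disagrees with that of `x` on less than
an `ε` fraction of the points. -/
def Learns (P : Prog) (par : List ℕ) (n k : ℕ) (η : unitInterval) (ε δ S T : ℝ) : Prop :=
  ∀ x : Fin n → ZMod 2, hammingNorm x = k →
    (∀ᵐ ω ∂sampleMeasure n η, ∃ c τ, Exec (source x ω) P (State.init par) c τ ∧
      (c : ℝ) ≤ T ∧ (τ.draws : ℝ) ≤ S) ∧
    1 - δ ≤ (sampleMeasure n η).real {ω | ∃ c τ, Exec (source x ω) P (State.init par) c τ ∧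
      ∃ y : Fin n → ZMod 2, τ.out = List.ofFn y ∧ disagreement x y < ε}

/-- Learning `k`-parities (without noise) over the uniform distribution. -/
def LearnsPAR (P : Prog) (par : List ℕ) (n k : ℕ) (δ S T : ℝ) : Prop :=
  Learns P par n k 0 (1 / 2) δ S T

/-- Solving the problem of learning `k`-parities with noise of rate `η`. -/
def SolvesLPN (P : Prog) (par : List ℕ) (n k : ℕ) (η : unitInterval) (δ S T : ℝ) : Prop :=
  Learns P par n k η (1 / 2) δ S T

/-- The binary entropy function, in bits. -/
def entropy (p : ℝ) : ℝ := p * Real.logb 2 (1 / p) + (1 - p) * Real.logb 2 (1 / (1 - p))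

end ParityLearning

end

/-! The noisy problem is reduced to the noise-free one by guessing which labels are wrong. Put `q =
⌊1/η⌋`, `l = ⌈log₂(1/δ)⌉`, `m = s·l`.

A round takes `s` fresh examples and `t` fresh coins. By Markov's inequality at most `4s/q` labels
are wrong, except with probability `1/4`. The program tries every error pattern from a list
containing all patterns of that weight. With the right pattern the learner sees correct labels on
points and coins that are independent of the noise, so it outputs the hidden `x` except with
probability `δ/2 < 1/2`. Hence `x` is among the candidates of a round with probability at least
`1/4`, and `8l` independent rounds miss it with probability at most `(3/4)^(8l)`.

Candidates are tested on `500m` separate examples and pass when at most a fraction `2/5` of the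
labels disagree. This threshold lies between `η < 1/3`, the error rate of `x`, and `1/2`, that of
any other vector. The candidates are independent of the test examples, so the union bound runs over
the runs of the learner, at most `2^(9m)` of them, and not over all `2ⁿ` vectors
(`measure_exists_score_le`). `measure_search_fails_le` adds up the failures.

Patterns are coded by gaps between errors: a digit in base `q + 1` either places an error or skips
`q` positions, and `5s/q` digits suffice (`exists_wordPattern_eq`). This gives `(q+1)^(5s/q) =
2^(O(η s log(1/η)))` words, and `η log(1/η)` is at most `2·H(3η/2)` (`le_entropy`). Words are
enumerated by incrementing a counter, which needs no multiplication.

The search costs an additional factor `m²`. It is absorbed by the exponential when `ηm` is bounded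
below, that is when `q ≤ c·m` with `c = ⌈1/ρ⌉` (`words_mul_sq_le`). If `q > c·m`, the first
alternative of the hypothesis fails, so `ηs ≤ δ/2`; then one run of the learner on raw examples
suffices, since with probability at least `1 - δ/2` no label is wrong. The program decides by
comparing `q` with `c·m`.

On wrong labels nothing is known about the learner; it may not halt or may ask for too many
examples. It is therefore simulated under a clock, with either a cap on the examples or a finite
stored sample (`simProg_correct`). Time stamps on the simulated memory make resetting it a single
increment. -/

namespace ParityLearning

/-! ### Semantics of the machine and cost-bounded runs -/

/-! ### States -/

namespace State

/-- Assignment to an array element. -/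
def setMem (σ : State) (a p v : ℕ) : State :=
  { σ with mem := Function.update σ.mem a (Function.update (σ.mem a) p v) }

variable (σ : State) (r v i a p : ℕ)

@[simp] theorem set_reg : (σ.set r v).reg i = if i = r then v else σ.reg i := by
  simp [State.set, Function.update_apply]

@[simp] theorem set_mem : (σ.set r v).mem = σ.mem := rfl

@[simp] theorem set_draws : (σ.set r v).draws = σ.draws := rfl

@[simp] theorem set_flips : (σ.set r v).flips = σ.flips := rfl

@[simp] theorem set_out : (σ.set r v).out = σ.out := rfl

@[simp] theorem setMem_reg : (σ.setMem a p v).reg = σ.reg := rfl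

@[simp] theorem setMem_mem (a' : ℕ) : (σ.setMem a p v).mem a' =
    if a' = a then Function.update (σ.mem a) p v else σ.mem a' := by
  simp [State.setMem, Function.update_apply]

@[simp] theorem setMem_draws : (σ.setMem a p v).draws = σ.draws := rfl

@[simp] theorem setMem_flips : (σ.setMem a p v).flips = σ.flips := rfl

@[simp] theorem setMem_out : (σ.setMem a p v).out = σ.out := rfl

end State

namespace Instr

variable {n : ℕ} (ω : Source n) (σ : State) (r c p q a : ℕ)

@[simp] theorem step_const : step ω σ (.const r c) = σ.set r c := rfl

@[simp] theorem step_add : step ω σ (.add r p q) = σ.set r (σ.reg p + σ.reg q) := rfl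

@[simp] theorem step_sub : step ω σ (.sub r p q) = σ.set r (σ.reg p - σ.reg q) := rfl

@[simp] theorem step_load : step ω σ (.load r a p) = σ.set r (σ.mem a (σ.reg p)) := rfl

@[simp] theorem step_bit : step ω σ (.bit r p) = σ.set r (if h : 0 < σ.draws ∧ σ.reg p < n then
    (ω.point (σ.draws - 1) ⟨σ.reg p, h.2⟩).val else 0) := rfl

@[simp] theorem step_label :
    step ω σ (.label r) = σ.set r (if 0 < σ.draws then (ω.lab (σ.draws - 1)).val else 0) := rfl

@[simp] theorem step_draw_reg : (step ω σ .draw).reg = σ.reg := rfl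

@[simp] theorem step_draw_mem : (step ω σ .draw).mem = σ.mem := rfl

@[simp] theorem step_draw_draws : (step ω σ .draw).draws = σ.draws + 1 := rfl

@[simp] theorem step_draw_flips : (step ω σ .draw).flips = σ.flips := rfl

@[simp] theorem step_draw_out : (step ω σ .draw).out = σ.out := rfl

@[simp] theorem step_flip_reg :
    (step ω σ (.flip r)).reg = (σ.set r (ω.coin σ.flips).val).reg := rfl

@[simp] theorem step_flip_mem : (step ω σ (.flip r)).mem = σ.mem := rfl

@[simp] theorem step_flip_draws : (step ω σ (.flip r)).draws = σ.draws := rfl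

@[simp] theorem step_flip_flips : (step ω σ (.flip r)).flips = σ.flips + 1 := rfl

@[simp] theorem step_flip_out : (step ω σ (.flip r)).out = σ.out := rfl

@[simp] theorem step_emit_reg : (step ω σ (.emit p)).reg = σ.reg := rfl

@[simp] theorem step_emit_mem : (step ω σ (.emit p)).mem = σ.mem := rfl

@[simp] theorem step_emit_draws : (step ω σ (.emit p)).draws = σ.draws := rfl

@[simp] theorem step_emit_flips : (step ω σ (.emit p)).flips = σ.flips := rfl

@[simp] theorem step_emit_out :
    (step ω σ (.emit p)).out = σ.out ++ [if σ.reg p = 0 then 0 else 1] := rfl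

@[simp] theorem step_store : step ω σ (.store a p q) = σ.setMem a (σ.reg p) (σ.reg q) := rfl

end Instr

/-! ### Executions -/

/-- `Learns` bounds the resources and describes the output in separate clauses, each with its own
execution. Determinism identifies the two. -/
theorem Exec.deterministic {n : ℕ} {ω : Source n} {P : Prog} {σ τ : State} {c : ℕ}
    (h : Exec ω P σ c τ) : ∀ {c' : ℕ} {τ' : State}, Exec ω P σ c' τ' → c = c' ∧ τ = τ' := by
  induction h with
  | instr i σ => intro c' τ' h'; cases h'; exact ⟨rfl, rfl⟩
  | seq _ _ ih₁ ih₂ =>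
    intro c' τ' h'
    cases h' with
    | seq h₁ h₂ =>
      obtain ⟨rfl, rfl⟩ := ih₁ h₁
      obtain ⟨rfl, rfl⟩ := ih₂ h₂
      exact ⟨rfl, rfl⟩
  | ite_true hr _ ih =>
    intro c' τ' h'
    cases h' with
    | ite_true _ h₁ => obtain ⟨rfl, rfl⟩ := ih h₁; exact ⟨rfl, rfl⟩
    | ite_false h₀ _ => exact absurd h₀ hr
  | ite_false hr _ ih =>
    intro c' τ' h'
    cases h' with
    | ite_true h₀ _ => exact absurd hr h₀
    | ite_false _ h₁ => obtain ⟨rfl, rfl⟩ := ih h₁; exact ⟨rfl, rfl⟩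
  | loop_done hr =>
    intro c' τ' h'
    cases h' with
    | loop_done _ => exact ⟨rfl, rfl⟩
    | loop_step h₀ _ _ => exact absurd hr h₀
  | loop_step hr _ _ ih₁ ih₂ =>
    intro c' τ' h'
    cases h' with
    | loop_done h₀ => exact absurd h₀ hr
    | loop_step _ h₁ h₂ =>
      obtain ⟨rfl, rfl⟩ := ih₁ h₁
      obtain ⟨rfl, rfl⟩ := ih₂ h₂
      exact ⟨rfl, rfl⟩

theorem Exec.cost_pos {n : ℕ} {ω : Source n} {P : Prog} {σ τ : State} {c : ℕ}
    (h : Exec ω P σ c τ) : 1 ≤ c := by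
  induction h <;> omega

theorem Instr.draws_le_step {n : ℕ} (ω : Source n) (σ : State) (i : Instr) :
    σ.draws ≤ (i.step ω σ).draws := by
  cases i <;> simp [Instr.step, State.set]

theorem Exec.draws_le {n : ℕ} {ω : Source n} {P : Prog} {σ τ : State} {c : ℕ}
    (h : Exec ω P σ c τ) : σ.draws ≤ τ.draws := by
  induction h with
  | instr i σ => exact i.draws_le_step ω σ
  | _ => omega

theorem Exec.flips_le {n : ℕ} {ω : Source n} {P : Prog} {σ τ : State} {c : ℕ}
    (h : Exec ω P σ c τ) : τ.flips ≤ σ.flips + c := by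
  induction h with
  | instr i σ => cases i <;> simp [Instr.step, State.set]
  | _ => omega

/-- Writing a bit costs a step. This is what later gives `n ≤ t` for a learner that outputs a vector
of length `n`. -/
theorem Exec.out_length_le {n : ℕ} {ω : Source n} {P : Prog} {σ τ : State} {c : ℕ}
    (h : Exec ω P σ c τ) : τ.out.length ≤ σ.out.length + c := by
  induction h with
  | instr i σ => cases i <;> simp [Instr.step, State.set]
  | _ => omega

/-! ### Runs with a cost bound and a postcondition -/

/-- From `σ` the program `P` halts within `B` steps in a state satisfying `Q`. -/
def Runs {n : ℕ} (ω : Source n) (P : Prog) (σ : State) (B : ℕ) (Q : State → Prop) : Prop :=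
  ∃ c τ, Exec ω P σ c τ ∧ c ≤ B ∧ Q τ

theorem Runs.mono {n : ℕ} {ω : Source n} {P : Prog} {σ : State} {B B' : ℕ} {Q Q' : State → Prop}
    (h : Runs ω P σ B Q) (hB : B ≤ B') (hQ : ∀ τ, Q τ → Q' τ) : Runs ω P σ B' Q' := by
  obtain ⟨c, τ, he, hc, hq⟩ := h
  exact ⟨c, τ, he, hc.trans hB, hQ _ hq⟩

theorem Runs.seq {n : ℕ} {ω : Source n} {P P' : Prog} {σ : State} {B B' : ℕ}
    {Q Q' : State → Prop} (h : Runs ω P σ B Q) (h' : ∀ τ, Q τ → Runs ω P' τ B' Q') :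
    Runs ω (.seq P P') σ (B + B') Q' := by
  obtain ⟨c, τ, he, hc, hq⟩ := h
  obtain ⟨d, υ, he', hd, hq'⟩ := h' τ hq
  exact ⟨c + d, υ, .seq he he', by omega, hq'⟩

theorem Runs.ite {n : ℕ} {ω : Source n} {P P' : Prog} {σ : State} {r B B' : ℕ}
    {Q : State → Prop} (h : σ.reg r ≠ 0 → Runs ω P σ B Q) (h' : σ.reg r = 0 → Runs ω P' σ B' Q) :
    Runs ω (.ite r P P') σ (max B B' + 1) Q := by
  by_cases h0 : σ.reg r = 0
  · obtain ⟨c, τ, he, hc, hq⟩ := h' h0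
    exact ⟨c + 1, τ, .ite_false h0 he, by omega, hq⟩
  · obtain ⟨c, τ, he, hc, hq⟩ := h h0
    exact ⟨c + 1, τ, .ite_true h0 he, by omega, hq⟩

/-- The index of the invariant is the exact number of iterations still to come, so the invariant
gives termination and cost together. -/
theorem Runs.loop {n : ℕ} {ω : Source n} {P : Prog} {r B : ℕ} (Inv : ℕ → State → Prop)
    (h0 : ∀ σ, Inv 0 σ → σ.reg r = 0)
    (hs : ∀ k σ, Inv (k + 1) σ → σ.reg r ≠ 0 ∧ Runs ω P σ B (Inv k)) :
    ∀ (k : ℕ) (σ : State), Inv k σ → Runs ω (.loop r P) σ (k * (B + 1) + 1) (Inv 0) := by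
  intro k
  induction k with
  | zero => intro σ h; exact ⟨1, σ, .loop_done (h0 σ h), by omega, h⟩
  | succ k ih =>
    intro σ h
    obtain ⟨hr, c, τ, he, hc, hi⟩ := hs k σ h
    obtain ⟨d, υ, he', hd, hq⟩ := ih τ hi
    refine ⟨c + d + 1, υ, .loop_step hr he he', ?_, hq⟩
    have : (k + 1) * (B + 1) = k * (B + 1) + (B + 1) := by ring
    omega

/-- A nonempty list of instructions as a program. -/
def blk : Instr → List Instr → Prog
  | i, [] => .instr i
  | i, j :: l => .seq (.instr i) (blk j l)

/-- The effect of a list of instructions. -/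
def steps {n : ℕ} (ω : Source n) : List Instr → State → State
  | [], σ => σ
  | i :: l, σ => steps ω l (i.step ω σ)

theorem exec_blk {n : ℕ} (ω : Source n) (i : Instr) (l : List Instr) (σ : State) :
    Exec ω (blk i l) σ (l.length + 1) (steps ω (i :: l) σ) := by
  induction l generalizing i σ with
  | nil => exact .instr i σ
  | cons j l ih =>
    have := Exec.seq (Exec.instr (ω := ω) i σ) (ih j (i.step ω σ))
    rw [Nat.add_comm] at this
    exact this

theorem Runs.blk {n : ℕ} {ω : Source n} {i : Instr} {l : List Instr} {σ : State}
    {Q : State → Prop} (h : Q (steps ω (i :: l) σ)) :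
    Runs ω (blk i l) σ (l.length + 1) Q :=
  ⟨_, _, exec_blk ω i l σ, le_rfl, h⟩

/-! ### Clocked simulation of the learner -/

/-! ### Clocked execution -/

/-- Clocked iteration of a loop body. -/
def loopIter (r : ℕ) (body : ℕ → State → ℕ × State) : ℕ → ℕ → State → ℕ × State
  | 0, _, σ => (0, σ)
  | _ + 1, 0, σ => (0, σ)
  | g + 1, f + 1, σ =>
    if σ.reg r = 0 then (f, σ) else loopIter r body g (body f σ).1 (body f σ).2

/-- Clocked execution with `f` steps of fuel, for an arbitrary interpretation `st` of the
instructions: the remaining fuel and the state reached when the program or the fuel ends. -/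
def crun (st : Instr → State → State) : Prog → ℕ → State → ℕ × State
  | .instr _, 0, σ => (0, σ)
  | .instr i, f + 1, σ => (f, st i σ)
  | .seq P Q, f, σ => crun st Q (crun st P f σ).1 (crun st P f σ).2
  | .ite _ _ _, 0, σ => (0, σ)
  | .ite r P Q, f + 1, σ => if σ.reg r = 0 then crun st Q f σ else crun st P f σ
  | .loop r P, f, σ => loopIter r (crun st P) f f σ

theorem loopIter_fuel_le {r : ℕ} {body : ℕ → State → ℕ × State}
    (hb : ∀ f σ, (body f σ).1 ≤ f) : ∀ g f σ, (loopIter r body g f σ).1 ≤ f := by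
  intro g
  induction g with
  | zero => intro f σ; simp [loopIter]
  | succ g ih =>
    intro f σ
    cases f with
    | zero => simp [loopIter]
    | succ f =>
      rw [loopIter]
      split_ifs with h
      · simp
      · have h1 := ih (body f σ).1 (body f σ).2
        have h2 := hb f σ
        omega

theorem crun_fuel_le (st : Instr → State → State) (P : Prog) :
    ∀ f σ, (crun st P f σ).1 ≤ f := by
  induction P with
  | instr i => intro f σ; cases f <;> simp [crun]
  | seq P Q ihP ihQ => intro f σ; rw [crun]; exact (ihQ _ _).trans (ihP _ _)
  | ite r P Q ihP ihQ =>
    intro f σ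
    cases f with
    | zero => simp [crun]
    | succ f =>
      rw [crun]
      split_ifs
      · exact (ihQ _ _).trans (Nat.le_succ f)
      · exact (ihP _ _).trans (Nat.le_succ f)
  | loop r P ih => intro f σ; rw [crun]; exact loopIter_fuel_le ih f f σ

/-- The gas `g` only makes the recursion structural. Each iteration burns at least one unit of fuel,
so any gas that is at least the fuel gives the same result. -/
theorem loopIter_gas {r : ℕ} {body : ℕ → State → ℕ × State} (hb : ∀ f σ, (body f σ).1 ≤ f) :
    ∀ g g' f σ, f ≤ g → f ≤ g' → loopIter r body g f σ = loopIter r body g' f σ := by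
  intro g
  induction g with
  | zero =>
    intro g' f σ h h'
    obtain rfl : f = 0 := by omega
    cases g' <;> simp [loopIter]
  | succ g ih =>
    intro g' f σ h h'
    cases f with
    | zero => cases g' <;> simp [loopIter]
    | succ f =>
      cases g' with
      | zero => omega
      | succ g' =>
        rw [loopIter, loopIter]
        have := hb f σ
        rw [ih g' _ _ (by omega) (by omega)]

/-- An execution is reproduced by clocked execution under every interpretation that agrees with the
semantics on all states with at most `S` draws. -/
theorem Exec.crun_eq {n : ℕ} {ω : Source n} {st : Instr → State → State} {S : ℕ}
    (hst : ∀ i σ, (i.step ω σ).draws ≤ S → st i σ = i.step ω σ)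
    {P : Prog} {σ τ : State} {c : ℕ}
    (h : Exec ω P σ c τ) : ∀ g, τ.draws ≤ S → crun st P (c + g) σ = (g, τ) := by
  induction h with
  | instr i σ =>
    intro g hd
    rw [Nat.add_comm, crun, hst i σ hd]
  | seq h₁ h₂ ih₁ ih₂ =>
    intro g hd
    rw [crun, Nat.add_assoc, ih₁ _ (h₂.draws_le.trans hd)]
    exact ih₂ g hd
  | ite_true hr h ih =>
    intro g hd
    rw [Nat.add_right_comm, crun, if_neg hr]
    exact ih g hd
  | ite_false hr h ih =>
    intro g hd
    rw [Nat.add_right_comm, crun, if_pos hr]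
    exact ih g hd
  | loop_done hr =>
    intro g hd
    rw [Nat.add_comm, crun, loopIter, if_pos hr]
  | @loop_step r P σ τ υ c d hr h₁ h₂ ih₁ ih₂ =>
    intro g hd
    rw [Nat.add_right_comm, crun, loopIter, if_neg hr, Nat.add_assoc,
      ih₁ _ (h₂.draws_le.trans hd), loopIter_gas (crun_fuel_le st P) _ (d + g) _ _
        (by omega) le_rfl]
    exact ih₂ g hd

/-- An execution depends only on the examples drawn and the random bits used. -/
theorem Exec.congr_source {n : ℕ} {ω ω' : Source n} {S F : ℕ}
    (hp : ∀ i < S, ω'.point i = ω.point i) (hl : ∀ i < S, ω'.lab i = ω.lab i)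
    (hc : ∀ i < F, ω'.coin i = ω.coin i) {P : Prog} {σ τ : State} {c : ℕ} (h : Exec ω P σ c τ) :
    τ.draws ≤ S → σ.flips + c ≤ F → Exec ω' P σ c τ := by
  induction h with
  | instr i σ =>
    intro hd hf
    have e : i.step ω' σ = i.step ω σ := by
      cases i with
      | bit r p =>
        simp only [Instr.step_bit, State.set_draws] at hd ⊢
        congr 1
        split_ifs with h
        · rw [hp _ (by omega)]
        · rfl
      | label r =>
        simp only [Instr.step_label, State.set_draws] at hd ⊢
        congr 1
        split_ifs with h
        · rw [hl _ (by omega)]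
        · rfl
      | flip r =>
        simp only [Instr.step]
        rw [hc _ (by omega)]
      | _ => rfl
    exact e ▸ Exec.instr i σ
  | seq h₁ h₂ ih₁ ih₂ =>
    intro hd hf
    have e1 := h₁.flips_le
    exact .seq (ih₁ (h₂.draws_le.trans hd) (by omega)) (ih₂ hd (by omega))
  | ite_true hr h ih => exact fun hd hf => .ite_true hr (ih hd (by omega))
  | ite_false hr h ih => exact fun hd hf => .ite_false hr (ih hd (by omega))
  | loop_done hr => exact fun _ _ => .loop_done hr
  | loop_step hr h₁ h₂ ih₁ ih₂ =>
    intro hd hf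
    have e1 := h₁.flips_le
    exact .loop_step hr (ih₁ (h₂.draws_le.trans hd) (by omega)) (ih₂ hd (by omega))

/-! ### Clocked simulation of a program by a program -/

/-- A bound for the registers an instruction uses. -/
def Instr.bound : Instr → ℕ
  | .const r _ => r + 1
  | .add r p q => r + p + q + 1
  | .sub r p q => r + p + q + 1
  | .load r _ p => r + p + 1
  | .store _ p q => p + q + 1
  | .draw => 0
  | .bit r p => r + p + 1
  | .label r => r + 1
  | .flip r => r + 1
  | .emit p => p + 1

/-- A bound for the registers a program uses. -/
def Prog.bound : Prog → ℕ
  | .instr i => i.bound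
  | .seq P Q => max P.bound Q.bound
  | .ite r P Q => max (r + 1) (max P.bound Q.bound)
  | .loop r P => max (r + 1) P.bound

/-- Simulation of a program: registers are shifted by `b`, instructions are translated by `tr`, and
register `13` is a clock.  Register `5` holds `1`, register `6` holds `0`, registers `14` and `15`
are scratch. -/
def simProg (b : ℕ) (tr : Instr → Prog) : Prog → Prog
  | .instr i => .ite 13 (.seq (.instr (.sub 13 13 5)) (tr i)) (.instr (.const 15 0))
  | .seq P Q => .seq (simProg b tr P) (simProg b tr Q)
  | .ite r P Q => .ite 13 (.seq (.instr (.sub 13 13 5))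
      (.ite (b + r) (simProg b tr P) (simProg b tr Q))) (.instr (.const 15 0))
  | .loop r P => .seq (.instr (.add 14 13 6)) (.loop 14 (.seq (.instr (.sub 13 13 5))
      (.ite (b + r) (.seq (simProg b tr P) (.instr (.add 14 13 6))) (.instr (.const 14 0)))))

/-- The time constant of the simulation. -/
def simCost (K : ℕ) : Prog → ℕ
  | .instr _ => K + 3
  | .seq P Q => simCost K P + simCost K Q
  | .ite _ P Q => simCost K P + simCost K Q + 3
  | .loop _ P => simCost K P + 5

/-- `Rel` and `st` are abstract so that the direct simulation and the one on stored data share this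
induction. The cost bound is amortized: a unit of fuel pays for a constant number of steps, and what
is left of the fuel is credited on the left side, which makes the bound compose along `seq`. The `+
1` pays for walking through the rest of the program once the clock has run out. -/
theorem simProg_correct {n : ℕ} (ω : Source n) (st : Instr → State → State) (b R K : ℕ)
    (tr : Instr → Prog) (Rel : State → State → Prop)
    (h5 : ∀ σ' σ, Rel σ' σ → σ'.reg 5 = 1) (h6 : ∀ σ' σ, Rel σ' σ → σ'.reg 6 = 0)
    (hr : ∀ σ' σ, Rel σ' σ → ∀ r < R, σ'.reg (b + r) = σ.reg r)
    (hset : ∀ σ' σ, Rel σ' σ → ∀ r v, 13 ≤ r → r < 16 → Rel (σ'.set r v) σ)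
    (htr : ∀ i : Instr, i.bound ≤ R → ∀ σ' σ, Rel σ' σ →
      Runs ω (tr i) σ' K fun τ' => Rel τ' (st i σ) ∧ τ'.reg 13 = σ'.reg 13)
    (P : Prog) (hP : P.bound ≤ R) :
    ∀ (f : ℕ) (σ' σ : State), Rel σ' σ → σ'.reg 13 = f → ∃ c τ',
      Exec ω (simProg b tr P) σ' c τ' ∧ Rel τ' (crun st P f σ).2 ∧
        τ'.reg 13 = (crun st P f σ).1 ∧
        c + simCost K P * (crun st P f σ).1 ≤ simCost K P * (f + 1) := by
  induction P with
  | instr i =>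
    intro f σ' σ hrel hf
    cases f with
    | zero =>
      refine ⟨1 + 1, _, .ite_false hf (.instr _ _), hset _ _ hrel _ _ (by norm_num) (by norm_num),
        ?_, ?_⟩
      · simp [Instr.step, State.set, crun, hf]
      · simp [crun, simCost]
    | succ f =>
      have hrel' := hset _ _ hrel 13 f (by norm_num) (by norm_num)
      obtain ⟨c, τ', he, hc, hrel'', h13⟩ := htr i hP _ _ hrel'
      have e1 : Instr.step ω σ' (.sub 13 13 5) = σ'.set 13 f := by
        simp [Instr.step, hf, h5 _ _ hrel]
      refine ⟨1 + c + 1, τ', .ite_true (by omega) (.seq (.instr _ _) (e1 ▸ he)), hrel'', ?_, ?_⟩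
      · simp [h13, State.set, crun]
      · simp only [crun, simCost]
        have : (K + 3) * (f + 1 + 1) = (K + 3) * f + 2 * (K + 3) := by ring
        omega
  | seq P Q ihP ihQ =>
    intro f σ' σ hrel hf
    simp only [Prog.bound, max_le_iff] at hP
    obtain ⟨c, τ', he, hrel', h13, hc⟩ := ihP hP.1 f σ' σ hrel hf
    obtain ⟨d, υ', he', hrel'', h13', hd⟩ := ihQ hP.2 _ τ' _ hrel' h13
    refine ⟨c + d, υ', .seq he he', hrel'', h13', ?_⟩
    simp only [crun, simCost]
    have h1 := crun_fuel_le st P f σ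
    have h2 := crun_fuel_le st Q (crun st P f σ).1 (crun st P f σ).2
    generalize (crun st Q (crun st P f σ).1 (crun st P f σ).2).1 = f2 at *
    generalize (crun st P f σ).1 = f1 at *
    nlinarith [Nat.mul_le_mul_left (simCost K P) h2, Nat.mul_le_mul_left (simCost K Q) h1]
  | ite r P Q ihP ihQ =>
    intro f σ' σ hrel hf
    simp only [Prog.bound, max_le_iff] at hP
    cases f with
    | zero =>
      refine ⟨1 + 1, _, .ite_false hf (.instr _ _), hset _ _ hrel _ _ (by norm_num) (by norm_num),
        ?_, ?_⟩
      · simp [Instr.step, State.set, crun, hf]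
      · simp [crun, simCost]
    | succ f =>
      have hrel' := hset _ _ hrel 13 f (by norm_num) (by norm_num)
      have e1 : Instr.step ω σ' (.sub 13 13 5) = σ'.set 13 f := by
        simp [Instr.step, hf, h5 _ _ hrel]
      have e2 := hr _ _ hrel' r (by omega)
      have e3 : (σ'.set 13 f).reg 13 = f := by simp [State.set]
      by_cases h0 : σ.reg r = 0
      · obtain ⟨c, τ', he, hrel'', h13, hc⟩ := ihQ hP.2.2 f _ _ hrel' e3
        refine ⟨1 + (c + 1) + 1, τ', .ite_true (by omega)
          (.seq (.instr _ _) (e1 ▸ .ite_false (by rw [e2, h0]) he)), ?_, ?_, ?_⟩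
        · simpa [crun, h0] using hrel''
        · simpa [crun, h0] using h13
        · simp only [crun, h0, if_true, simCost]
          have := crun_fuel_le st Q f σ
          nlinarith [Nat.mul_le_mul_left (simCost K P) this]
      · obtain ⟨c, τ', he, hrel'', h13, hc⟩ := ihP hP.2.1 f _ _ hrel' e3
        refine ⟨1 + (c + 1) + 1, τ', .ite_true (by omega)
          (.seq (.instr _ _) (e1 ▸ .ite_true (by rwa [e2]) he)), ?_, ?_, ?_⟩
        · simpa [crun, h0] using hrel''
        · simpa [crun, h0] using h13
        · simp only [crun, h0, if_false, simCost]
          have := crun_fuel_le st P f σ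
          nlinarith [Nat.mul_le_mul_left (simCost K Q) this]
  | loop r P ih =>
    intro f σ' σ hrel hf
    simp only [Prog.bound, max_le_iff] at hP
    set body : Prog := .seq (.instr (.sub 13 13 5))
      (.ite (b + r) (.seq (simProg b tr P) (.instr (.add 14 13 6))) (.instr (.const 14 0)))
      with hbody
    -- The loop of the simulator tests register `14`, a copy of the clock; the simulated guard is
    -- tested inside the body. When that guard is zero, register `14` is cleared to leave the loop
    -- and the clock keeps its value.
    have key : ∀ g f σ' σ, f ≤ g → Rel σ' σ → σ'.reg 13 = f → σ'.reg 14 = f → ∃ c τ',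
        Exec ω (.loop 14 body) σ' c τ' ∧ Rel τ' (loopIter r (crun st P) g f σ).2 ∧
          τ'.reg 13 = (loopIter r (crun st P) g f σ).1 ∧
          c + (simCost K P + 5) * (loopIter r (crun st P) g f σ).1 ≤
            (simCost K P + 5) * f + 1 := by
      intro g
      induction g with
      | zero =>
        intro f σ' σ hg hrel h13 h14
        obtain rfl : f = 0 := by omega
        exact ⟨1, σ', .loop_done h14, hrel, h13, by simp [loopIter]⟩
      | succ g ihg =>
        intro f σ' σ hg hrel h13 h14
        cases f with
        | zero => exact ⟨1, σ', .loop_done h14, hrel, h13, by simp [loopIter]⟩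
        | succ f =>
          have hrel' := hset _ _ hrel 13 f (by norm_num) (by norm_num)
          have e1 : Instr.step ω σ' (.sub 13 13 5) = σ'.set 13 f := by
            simp [Instr.step, h13, h5 _ _ hrel]
          have e2 := hr _ _ hrel' r (by omega)
          have e3 : (σ'.set 13 f).reg 13 = f := by simp [State.set]
          by_cases h0 : σ.reg r = 0
          · have hx : Exec ω body σ' (1 + (1 + 1)) (Instr.step ω (σ'.set 13 f) (.const 14 0)) :=
              .seq (.instr _ _) (e1.symm ▸ Exec.ite_false (by rw [e2, h0]) (.instr _ _))
            refine ⟨_, _, .loop_step (by omega) hx (.loop_done ?_), ?_, ?_, ?_⟩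
            · simp [Instr.step, State.set]
            · simp only [loopIter, h0, if_true]
              exact hset _ _ hrel' _ _ (by norm_num) (by norm_num)
            · simp [loopIter, h0, Instr.step, State.set]
            · simp only [loopIter, h0, if_true]
              nlinarith
          · obtain ⟨c, τ', he, hrel'', h13', hc⟩ := ih hP.2 f _ _ hrel' e3
            have hle := crun_fuel_le st P f σ
            have e4 : Instr.step ω τ' (.add 14 13 6) = τ'.set 14 (crun st P f σ).1 := by
              simp [Instr.step, h6 _ _ hrel'', h13']
            obtain ⟨d, υ', he', hrel3, h13'', hd⟩ := ihg (crun st P f σ).1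
              (τ'.set 14 (crun st P f σ).1) (crun st P f σ).2 (by omega)
              (hset _ _ hrel'' _ _ (by norm_num) (by norm_num)) (by simp [State.set, h13'])
              (by simp [State.set])
            have hx : Exec ω body σ' (1 + (c + 1 + 1)) (Instr.step ω τ' (.add 14 13 6)) :=
              .seq (.instr _ _) (e1.symm ▸ Exec.ite_true (by rwa [e2]) (.seq he (.instr _ _)))
            refine ⟨_, υ', .loop_step (by omega) hx (e4 ▸ he'), ?_, ?_, ?_⟩
            · simpa only [loopIter, h0, if_false] using hrel3
            · simpa only [loopIter, h0, if_false] using h13''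
            · simp only [loopIter, h0, if_false]
              generalize (loopIter r (crun st P) g (crun st P f σ).1 (crun st P f σ).2).1 = f2 at *
              generalize (crun st P f σ).1 = f1 at *
              nlinarith
    have e1 : Instr.step ω σ' (.add 14 13 6) = σ'.set 14 f := by
      simp [Instr.step, hf, h6 _ _ hrel]
    obtain ⟨c, τ', he, h1, h2, h3⟩ := key f f (σ'.set 14 f) σ le_rfl
      (hset _ _ hrel _ _ (by norm_num) (by norm_num)) (by simp [State.set, hf]) (by simp [State.set])
    refine ⟨1 + c, τ', .seq (.instr _ _) (e1 ▸ he), h1, h2, ?_⟩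
    simp only [crun, simCost]
    nlinarith

theorem Runs.instr {n : ℕ} {ω : Source n} {i : Instr} {σ : State} {Q : State → Prop}
    (h : Q (i.step ω σ)) : Runs ω (.instr i) σ 1 Q :=
  ⟨1, _, .instr i σ, le_rfl, h⟩

/-! ### Direct simulation, with a cap on the number of examples -/

/-- The semantics in which requests for more than `s` examples are ignored. -/
def capStep {n : ℕ} (s : ℕ) (ω : Source n) : Instr → State → State
  | .draw, σ => if σ.draws < s then { σ with draws := σ.draws + 1 } else σ
  | i, σ => i.step ω σ

/-- Translation of instructions for the direct simulation: register `1` holds the cap on the number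
of examples, register `16` the number of examples drawn. -/
def trDirect (b : ℕ) : Instr → Prog
  | .const r c => .instr (.const (b + r) c)
  | .add r p q => .instr (.add (b + r) (b + p) (b + q))
  | .sub r p q => .instr (.sub (b + r) (b + p) (b + q))
  | .load r a p => .instr (.load (b + r) a (b + p))
  | .store a p q => .instr (.store a (b + p) (b + q))
  | .draw => .seq (.instr (.sub 15 1 16))
      (.ite 15 (blk .draw [.add 16 16 5]) (.instr (.const 15 0)))
  | .bit r p => .instr (.bit (b + r) (b + p))
  | .label r => .instr (.label (b + r))
  | .flip r => .instr (.flip (b + r))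
  | .emit p => .instr (.emit (b + p))

/-- `σ'` represents `σ` in the direct simulation. -/
structure DirectRel (b R s : ℕ) (σ' σ : State) : Prop where
  regs : ∀ r < R, σ'.reg (b + r) = σ.reg r
  cap : σ'.reg 1 = s
  one : σ'.reg 5 = 1
  zero : σ'.reg 6 = 0
  cnt : σ'.reg 16 = σ.draws
  le : σ.draws ≤ s
  mem : σ'.mem = σ.mem
  draws : σ'.draws = σ.draws
  flips : σ'.flips = σ.flips
  out : σ'.out = σ.out

theorem DirectRel.set_scratch {b R s : ℕ} (hb : 50 ≤ b) {σ' σ : State}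
    (h : DirectRel b R s σ' σ) (r v : ℕ) (h1 : 13 ≤ r) (h2 : r < 16) :
    DirectRel b R s (σ'.set r v) σ where
  regs i hi := by
    rw [State.set_reg, if_neg (by omega)]; exact h.regs i hi
  cap := by rw [State.set_reg, if_neg (by omega)]; exact h.cap
  one := by rw [State.set_reg, if_neg (by omega)]; exact h.one
  zero := by rw [State.set_reg, if_neg (by omega)]; exact h.zero
  cnt := by rw [State.set_reg, if_neg (by omega)]; exact h.cnt
  le := h.le
  mem := h.mem
  draws := h.draws
  flips := h.flips
  out := h.out

theorem DirectRel.set_reg {b R s : ℕ} (hb : 50 ≤ b) {σ' σ : State}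
    (h : DirectRel b R s σ' σ) (r v : ℕ) : DirectRel b R s (σ'.set (b + r) v) (σ.set r v) where
  regs i hi := by
    by_cases hir : i = r
    · subst hir; simp
    · rw [State.set_reg, State.set_reg, if_neg (by omega), if_neg hir]
      exact h.regs i hi
  cap := by rw [State.set_reg, if_neg (by omega)]; exact h.cap
  one := by rw [State.set_reg, if_neg (by omega)]; exact h.one
  zero := by rw [State.set_reg, if_neg (by omega)]; exact h.zero
  cnt := by rw [State.set_reg, if_neg (by omega)]; exact h.cnt
  le := h.le
  mem := h.mem
  draws := h.draws
  flips := h.flips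
  out := h.out

theorem trDirect_correct {n : ℕ} (ω : Source n) (b R s : ℕ) (hb : 50 ≤ b) (i : Instr)
    (hi : i.bound ≤ R) (σ' σ : State) (h : DirectRel b R s σ' σ) :
    Runs ω (trDirect b i) σ' 4 fun τ' =>
      DirectRel b R s τ' (capStep s ω i σ) ∧ τ'.reg 13 = σ'.reg 13 := by
  have h13 : ∀ r v, (σ'.set (b + r) v).reg 13 = σ'.reg 13 := fun r v => by
    rw [State.set_reg, if_neg (by omega)]
  have key : ∀ r v v', v = v' → DirectRel b R s (σ'.set (b + r) v) (σ.set r v') ∧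
      (σ'.set (b + r) v).reg 13 = σ'.reg 13 := by
    rintro r v _ rfl
    exact ⟨h.set_reg hb r v, h13 r v⟩
  cases i with
  | const r c => exact (Runs.instr (key _ _ _ rfl)).mono (by norm_num) fun _ h => h
  | add r p q =>
    simp only [Instr.bound] at hi
    exact (Runs.instr (key _ _ _ (by rw [h.regs _ (by omega), h.regs _ (by omega)]))).mono
      (by norm_num) fun _ h => h
  | sub r p q =>
    simp only [Instr.bound] at hi
    exact (Runs.instr (key _ _ _ (by rw [h.regs _ (by omega), h.regs _ (by omega)]))).mono
      (by norm_num) fun _ h => h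
  | load r a p =>
    simp only [Instr.bound] at hi
    exact (Runs.instr (key _ _ _ (by rw [h.mem, h.regs _ (by omega)]))).mono
      (by norm_num) fun _ h => h
  | store a p q =>
    simp only [Instr.bound] at hi
    refine (Runs.instr ?_).mono (by norm_num) fun _ h => h
    refine ⟨⟨h.regs, h.cap, h.one, h.zero, h.cnt, h.le, ?_, h.draws, h.flips, h.out⟩, rfl⟩
    simp only [Instr.step, capStep]
    rw [h.mem, h.regs _ (by omega), h.regs _ (by omega)]
  | draw =>
    have e := h.set_scratch hb 15 (s - σ.draws) (by norm_num) (by norm_num)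
    have e0 : Instr.step ω σ' (.sub 15 1 16) = σ'.set 15 (s - σ.draws) := by
      simp [Instr.step, h.cap, h.cnt]
    refine (Runs.seq (B := 1) (B' := 3) (Q := fun τ => τ = σ'.set 15 (s - σ.draws))
      (Runs.instr e0) ?_).mono (by norm_num) fun _ h => h
    rintro _ rfl
    refine (Runs.ite (B := 2) (B' := 1) (fun h0 => Runs.blk ?_) (fun h0 => Runs.instr ?_)).mono
      (by norm_num) fun _ h => h
    · have hlt : σ.draws < s := by simp [State.set] at h0; omega
      simp only [steps, Instr.step, capStep, if_pos hlt]
      refine ⟨⟨fun r hr => ?_, ?_, ?_, ?_, ?_, hlt, h.mem, ?_, h.flips, h.out⟩, ?_⟩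
      · simp only [State.set]
        rw [Function.update_of_ne (by omega), Function.update_of_ne (by omega)]
        exact h.regs r hr
      · simp [State.set, h.cap]
      · simp [State.set, h.one]
      · simp [State.set, h.zero]
      · simp [State.set, h.one, h.cnt]
      · simp [State.set, h.draws]
      · simp [State.set]
    · have hlt : ¬ σ.draws < s := by simp [State.set] at h0; omega
      simp only [Instr.step, capStep, if_neg hlt]
      exact ⟨e.set_scratch hb _ _ (by norm_num) (by norm_num), by simp [State.set]⟩
  | bit r p =>
    simp only [Instr.bound] at hi
    refine (Runs.instr (key _ _ _ ?_)).mono (by norm_num) fun _ h => h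
    have := h.regs p (by omega)
    simp only [this, h.draws]
  | label r =>
    exact (Runs.instr (key _ _ _ (by rw [h.draws]))).mono (by norm_num) fun _ h => h
  | flip r =>
    refine (Runs.instr ?_).mono (by norm_num) fun _ h => h
    have e := h.set_reg hb r (ω.coin σ.flips).val
    simp only [Instr.step, capStep]
    rw [h.flips]
    exact ⟨⟨e.regs, e.cap, e.one, e.zero, e.cnt, e.le, e.mem, e.draws, rfl, e.out⟩,
      h13 _ _⟩
  | emit p =>
    simp only [Instr.bound] at hi
    refine (Runs.instr ?_).mono (by norm_num) fun _ h => h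
    refine ⟨⟨h.regs, h.cap, h.one, h.zero, h.cnt, h.le, h.mem, h.draws, h.flips, ?_⟩, rfl⟩
    simp only [Instr.step, capStep]
    rw [h.out, h.regs _ (by omega)]

theorem capStep_eq {n : ℕ} (s : ℕ) (ω : Source n) (i : Instr) (σ : State)
    (h : (i.step ω σ).draws ≤ s) : capStep s ω i σ = i.step ω σ := by
  cases i with
  | draw =>
    simp only [Instr.step] at h
    simp only [capStep, Instr.step]
    rw [if_pos (by omega)]
  | _ => rfl

/-! ### Simulation on stored examples and stored random bits -/

/-- Translation of instructions for the simulation on stored data.  Array `2` holds the points (the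
coordinates of point `i` starting at `(i + 1) n`), array `4` the labels (that of point `i` at
`i + 1`), array `5` the random bits; the output is collected in array `7`.  Array `a` is represented
by the arrays `10 + 2 a` of values and `11 + 2 a` of time stamps; values with a stamp different from
the current one, which is in register `11`, count as zero.  Register `16` counts the examples drawn,
register `17` points to the current one; register `18` counts the random bits and register `19` the
output bits. -/
def trStored (b : ℕ) : Instr → Prog
  | .const r c => .instr (.const (b + r) c)
  | .add r p q => .instr (.add (b + r) (b + p) (b + q))
  | .sub r p q => .instr (.sub (b + r) (b + p) (b + q))
  | .load r a p => .seq (blk (.load 20 (11 + 2 * a) (b + p)) [.sub 20 11 20])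
      (.ite 20 (.instr (.const (b + r) 0)) (.instr (.load (b + r) (10 + 2 * a) (b + p))))
  | .store a p q => blk (.store (10 + 2 * a) (b + p) (b + q)) [.store (11 + 2 * a) (b + p) 11]
  | .draw => blk (.add 16 16 5) [.add 17 17 0]
  | .bit r p => .seq (.instr (.sub 20 0 (b + p)))
      (.ite 20 (blk (.add 20 17 (b + p)) [.load (b + r) 2 20]) (.instr (.const (b + r) 0)))
  | .label r => .instr (.load (b + r) 4 16)
  | .flip r => blk (.load (b + r) 5 18) [.add 18 18 5]
  | .emit p => .seq (.ite (b + p) (.instr (.const 20 1)) (.instr (.const 20 0)))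
      (blk (.store 7 19 20) [.add 19 19 5])

/-- The examples and random bits stored in `σ` are those of `src`. -/
structure StoredData {n : ℕ} (src : Source n) (σ : State) : Prop where
  dim : σ.reg 0 = n
  one : σ.reg 5 = 1
  zero : σ.reg 6 = 0
  point : ∀ (i : ℕ) (j : Fin n), σ.mem 2 ((i + 1) * n + j) = (src.point i j).val
  point_zero : ∀ p < n, σ.mem 2 p = 0
  lab : ∀ i, σ.mem 4 (i + 1) = (src.lab i).val
  lab_zero : σ.mem 4 0 = 0
  coin : ∀ i, σ.mem 5 i = (src.coin i).val

/-- `σ'` represents `σ` in the simulation on the data stored in `σ₀`. -/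
structure StoredRel (n b R : ℕ) (σ₀ σ' σ : State) : Prop where
  regs : ∀ r < R, σ'.reg (b + r) = σ.reg r
  keep : ∀ r < b, r < 13 ∨ 50 ≤ r → σ'.reg r = σ₀.reg r
  arr : ∀ a < 10, a ≠ 7 → σ'.mem a = σ₀.mem a
  stamp : ∀ a p, σ'.mem (11 + 2 * a) p ≤ σ₀.reg 11
  mem : ∀ a p, σ.mem a p = if σ'.mem (11 + 2 * a) p = σ₀.reg 11 then σ'.mem (10 + 2 * a) p else 0
  io : σ'.draws = σ₀.draws ∧ σ'.flips = σ₀.flips ∧ σ'.out = σ₀.out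
  cnt : σ'.reg 16 = σ.draws
  ptr : σ'.reg 17 = σ.draws * n
  fl : σ'.reg 18 = σ.flips
  len : σ'.reg 19 = σ.out.length
  out : ∀ i < σ.out.length, σ'.mem 7 i = (σ.out.getD i 0).val

theorem StoredRel.set_scratch {n b R : ℕ} (hb : 50 ≤ b) {σ₀ σ' σ : State}
    (h : StoredRel n b R σ₀ σ' σ) (r v : ℕ) (h1 : 13 ≤ r) (h2 : r < 16 ∨ r = 20) :
    StoredRel n b R σ₀ (σ'.set r v) σ := by
  have e : ∀ i, i ≠ r → (σ'.set r v).reg i = σ'.reg i := fun i hi => by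
    rw [State.set_reg, if_neg hi]
  exact ⟨fun i hi => (e _ (by omega)).trans (h.regs i hi),
    fun i hi hi' => (e _ (by omega)).trans (h.keep i hi hi'), h.arr, h.stamp, h.mem, h.io,
    (e _ (by omega)).trans h.cnt, (e _ (by omega)).trans h.ptr, (e _ (by omega)).trans h.fl,
    (e _ (by omega)).trans h.len, h.out⟩

theorem StoredRel.set_reg {n b R : ℕ} (hb : 50 ≤ b) {σ₀ σ' σ : State}
    (h : StoredRel n b R σ₀ σ' σ) (r v : ℕ) :
    StoredRel n b R σ₀ (σ'.set (b + r) v) (σ.set r v) := by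
  have e : ∀ i, i ≠ b + r → (σ'.set (b + r) v).reg i = σ'.reg i := fun i hi => by
    rw [State.set_reg, if_neg hi]
  refine ⟨fun i hi => ?_,
    fun i hi hi' => (e _ (by omega)).trans (h.keep i hi hi'), h.arr, h.stamp, h.mem, h.io,
    (e _ (by omega)).trans h.cnt, (e _ (by omega)).trans h.ptr, (e _ (by omega)).trans h.fl,
    (e _ (by omega)).trans h.len, h.out⟩
  by_cases hir : i = r
  · subst hir; simp
  · rw [e _ (by omega), State.set_reg, if_neg hir]
    exact h.regs i hi

theorem trStored_correct {n : ℕ} (ω : Source n) {src : Source n} {b R : ℕ} {σ₀ : State}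
    (hd : StoredData src σ₀) (hb : 50 ≤ b) (i : Instr)
    (hi : i.bound ≤ R) (σ' σ : State) (h : StoredRel n b R σ₀ σ' σ) :
    Runs ω (trStored b i) σ' 5 fun τ' =>
      StoredRel n b R σ₀ τ' (i.step src σ) ∧ τ'.reg 13 = σ'.reg 13 := by
  have h5 : σ'.reg 5 = 1 := (h.keep 5 (by omega) (by norm_num)).trans hd.one
  have h0 : σ'.reg 0 = n := (h.keep 0 (by omega) (by norm_num)).trans hd.dim
  have h11 : σ'.reg 11 = σ₀.reg 11 := h.keep 11 (by omega) (by norm_num)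
  have key : ∀ σ' : State, StoredRel n b R σ₀ σ' σ → ∀ r v v', v = v' →
      StoredRel n b R σ₀ (σ'.set (b + r) v) (σ.set r v') ∧
      (σ'.set (b + r) v).reg 13 = σ'.reg 13 := by
    rintro σ' h r v _ rfl
    exact ⟨h.set_reg hb r v, by rw [State.set_reg, if_neg (by omega)]⟩
  cases i with
  | const r c => exact (Runs.instr (key _ h _ _ _ rfl)).mono (by norm_num) fun _ h => h
  | add r p q =>
    simp only [Instr.bound] at hi
    exact (Runs.instr (key _ h _ _ _ (by rw [h.regs _ (by omega), h.regs _ (by omega)]))).mono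
      (by norm_num) fun _ h => h
  | sub r p q =>
    simp only [Instr.bound] at hi
    exact (Runs.instr (key _ h _ _ _ (by rw [h.regs _ (by omega), h.regs _ (by omega)]))).mono
      (by norm_num) fun _ h => h
  | load r a p =>
    simp only [Instr.bound] at hi
    have hp := h.regs p (by omega)
    have hm := h.mem a (σ.reg p)
    -- No stamp exceeds the current one, so the truncated difference of the two is nonzero exactly
    -- when the entry is stale.
    have hs := h.stamp a (σ.reg p)
    set v := σ'.mem (11 + 2 * a) (σ.reg p) with hv
    refine (Runs.seq (B := 2) (B' := 2)
      (Q := fun τ => τ = (σ'.set 20 v).set 20 (σ₀.reg 11 - v)) (Runs.blk ?_) ?_).mono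
      (by norm_num) fun _ h => h
    · simp [steps, Instr.step, State.set, hv, hp, h11]
    · rintro _ rfl
      have hrel := (h.set_scratch hb 20 v (by norm_num) (by norm_num)).set_scratch hb 20
        (σ₀.reg 11 - v) (by norm_num) (by norm_num)
      have k2 : ∀ v v', v = v' → _ := key _ hrel r
      refine (Runs.ite (B := 1) (B' := 1) (fun h0 => Runs.instr ?_) (fun h0 => Runs.instr ?_)).mono
        (by norm_num) fun _ h => h
      · refine k2 _ _ ?_
        simp only [State.set_reg, if_true] at h0
        rw [hm, if_neg (by omega)]
      · refine k2 _ _ ?_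
        simp only [State.set_reg, if_true] at h0
        have e := hrel.regs p (by omega)
        rw [e, hm, if_pos (by omega)]
        rfl
  | store a p q =>
    simp only [Instr.bound] at hi
    refine (Runs.blk ?_).mono (by norm_num) fun _ h => h
    have hp := h.regs p (by omega)
    have hq := h.regs q (by omega)
    have e : steps ω [.store (10 + 2 * a) (b + p) (b + q), .store (11 + 2 * a) (b + p) 11] σ' =
        (σ'.setMem (10 + 2 * a) (σ.reg p) (σ.reg q)).setMem (11 + 2 * a) (σ.reg p) (σ₀.reg 11) := by
      simp [steps, hp, hq, h11]
    rw [e]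
    refine ⟨⟨h.regs, h.keep, fun a' ha' ha7 => ?_, fun a' p' => ?_, fun a' p' => ?_, h.io, h.cnt,
      h.ptr, h.fl, h.len, fun i hi => ?_⟩, rfl⟩
    · rw [State.setMem_mem, if_neg (by omega), State.setMem_mem, if_neg (by omega)]
      exact h.arr a' ha' ha7
    · have := h.stamp a' p'
      by_cases ha : a' = a
      · subst ha
        rw [State.setMem_mem, if_pos rfl, State.setMem_mem, if_neg (by omega)]
        by_cases hpp : p' = σ.reg p
        · subst hpp; rw [Function.update_self]
        · rw [Function.update_of_ne hpp]; exact this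
      · rw [State.setMem_mem, if_neg (by omega), State.setMem_mem, if_neg (by omega)]
        exact this
    · have := h.mem a' p'
      have f1 : 11 + 2 * a' ≠ 10 + 2 * a := by omega
      have f2 : 10 + 2 * a' ≠ 11 + 2 * a := by omega
      have f3 : 11 + 2 * a' = 11 + 2 * a ↔ a' = a := by omega
      have f4 : 10 + 2 * a' = 10 + 2 * a ↔ a' = a := by omega
      have f5 : 11 + 2 * a ≠ 10 + 2 * a := by omega
      simp only [Instr.step_store, State.setMem_mem, f1, f2, f3, f4, f5, if_false]
      by_cases ha : a' = a
      · subst ha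
        simp only [if_true]
        by_cases hpp : p' = σ.reg p
        · subst hpp; simp
        · rw [Function.update_of_ne hpp, Function.update_of_ne hpp, Function.update_of_ne hpp]
          exact this
      · simp only [ha, if_false]
        exact this
    · simp only [Instr.step_store, State.setMem_out] at hi ⊢
      rw [State.setMem_mem, if_neg (by omega), State.setMem_mem, if_neg (by omega)]
      exact h.out i hi
  | draw =>
    refine (Runs.blk ?_).mono (by norm_num) fun _ h => h
    refine ⟨⟨fun r hr => ?_, fun r hr hr' => ?_, h.arr, h.stamp, h.mem, h.io, ?_, ?_, ?_, ?_,
      h.out⟩, ?_⟩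
    · simp only [steps, Instr.step_add, State.set_reg]
      rw [if_neg (by omega), if_neg (by omega)]
      exact h.regs r hr
    · simp only [steps, Instr.step_add, State.set_reg]
      rw [if_neg (by omega), if_neg (by omega)]
      exact h.keep r hr hr'
    · simp [steps, Instr.step, State.set, h.cnt, h5]
    · simp [steps, Instr.step, State.set, h.ptr, h0]; ring
    · simp [steps, Instr.step, State.set, h.fl]
    · simp [steps, Instr.step, State.set, h.len]
    · simp [steps, Instr.step, State.set]
  | bit r p =>
    simp only [Instr.bound] at hi
    have hp := h.regs p (by omega)
    refine (Runs.seq (B := 1) (B' := 3)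
      (Q := fun τ => τ = σ'.set 20 (n - σ.reg p)) (Runs.instr ?_) ?_).mono
      (by norm_num) fun _ h => h
    · simp [Instr.step, hp, h0]
    · rintro _ rfl
      have hrel := h.set_scratch hb 20 (n - σ.reg p) (by norm_num) (by norm_num)
      refine (Runs.ite (B := 2) (B' := 1) (fun h0 => Runs.blk ?_) (fun h0 => Runs.instr ?_)).mono
        (by norm_num) fun _ h => h
      · simp only [State.set_reg, if_true] at h0
        have hlt : σ.reg p < n := by omega
        have hrel2 := hrel.set_scratch hb 20 (σ.draws * n + σ.reg p) (by norm_num) (by norm_num)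
        have k2 : ∀ v v', v = v' → _ := key _ hrel2 r
        have e : Instr.step ω (σ'.set 20 (n - σ.reg p)) (.add 20 17 (b + p)) =
            (σ'.set 20 (n - σ.reg p)).set 20 (σ.draws * n + σ.reg p) := by
          have e1 := hrel.regs p (by omega)
          have e2 := hrel.ptr
          simp only [Instr.step, e1, e2]
        simp only [steps, e]
        refine k2 _ _ ?_
        have e3 : (((σ'.set 20 (n - σ.reg p)).set 20 (σ.draws * n + σ.reg p)).reg 20)
            = σ.draws * n + σ.reg p := by simp [State.set]
        rw [e3]
        rw [hrel2.arr 2 (by norm_num) (by norm_num)]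
        by_cases hdr : 0 < σ.draws
        · rw [dif_pos ⟨hdr, hlt⟩]
          have := hd.point (σ.draws - 1) ⟨σ.reg p, hlt⟩
          rw [← this, Nat.sub_add_cancel hdr]
        -- Before the first request the pointer is `0`, and the cells below `n` are kept at zero
        -- because point `i` starts at `(i + 1) n`. So the default value `0` needs no case
        -- distinction in the program.
        · rw [dif_neg (by tauto)]
          obtain h00 : σ.draws = 0 := by omega
          rw [h00, Nat.zero_mul, Nat.zero_add]
          exact hd.point_zero _ hlt
      · simp only [State.set_reg, if_true] at h0
        have k2 : ∀ v v', v = v' → _ := key _ hrel r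
        refine k2 _ _ ?_
        rw [dif_neg (by omega)]
  | label r =>
    refine (Runs.instr (key _ h _ _ _ ?_)).mono (by norm_num) fun _ h => h
    rw [h.arr 4 (by norm_num) (by norm_num), h.cnt]
    split_ifs with hdr
    · rw [← hd.lab, Nat.sub_add_cancel hdr]
    · rw [Nat.eq_zero_of_not_pos hdr, hd.lab_zero]
  | flip r =>
    refine (Runs.blk ?_).mono (by norm_num) fun _ h => h
    have e := h.set_reg hb r (src.coin σ.flips).val
    have e0 : Instr.step ω σ' (.load (b + r) 5 18) = σ'.set (b + r) (src.coin σ.flips).val := by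
      simp [Instr.step, h.arr 5 (by norm_num) (by norm_num), h.fl, hd.coin]
    have e1 : Instr.step src σ (.flip r) =
        { σ.set r (src.coin σ.flips).val with flips := σ.flips + 1 } := rfl
    have e2 : (σ'.set (b + r) (src.coin σ.flips).val).reg 13 = σ'.reg 13 := by
      rw [State.set_reg, if_neg (by omega)]
    have e3 : (σ.set r (src.coin σ.flips).val).flips = σ.flips := rfl
    rw [steps, steps, steps, e0, e1, ← e2]
    generalize σ'.set (b + r) (src.coin σ.flips).val = υ at *
    clear e1 e0 e2
    generalize σ.set r (src.coin σ.flips).val = υ' at *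
    rw [← e3]
    have e4 : Instr.step ω υ (.add 18 18 5) = υ.set 18 (υ'.flips + 1) := by
      simp [e.fl, e.keep 5 (by omega) (by norm_num), hd.one]
    rw [e4]
    have ne : ∀ i, i ≠ 18 → (υ.set 18 (υ'.flips + 1)).reg i = υ.reg i := fun i hi => by
      rw [State.set_reg, if_neg hi]
    exact ⟨⟨fun r' hr => (ne _ (by omega)).trans (e.regs r' hr),
      fun r' hr hr' => (ne _ (by omega)).trans (e.keep r' hr hr'), e.arr, e.stamp, e.mem, e.io,
      (ne _ (by omega)).trans e.cnt, (ne _ (by omega)).trans e.ptr, by simp,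
      (ne _ (by omega)).trans e.len, e.out⟩, ne _ (by omega)⟩
  | emit p =>
    simp only [Instr.bound] at hi
    have hp := h.regs p (by omega)
    set v : ℕ := if σ.reg p = 0 then 0 else 1 with hv
    refine (Runs.seq (B := 2) (B' := 2)
      (Q := fun τ => τ = σ'.set 20 v)
      ((Runs.ite (B := 1) (B' := 1) (fun h0 => Runs.instr ?_) (fun h0 => Runs.instr ?_)).mono
        (by norm_num) fun _ h => h) ?_).mono (by norm_num) fun _ h => h
    · rw [hv, if_neg (by rwa [← hp])]; rfl
    · rw [hv, if_pos (by rwa [← hp])]; rfl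
    · rintro _ rfl
      have e := h.set_scratch hb 20 v (by norm_num) (by norm_num)
      refine Runs.blk ?_
      have e13 : (σ'.set 20 v).reg 13 = σ'.reg 13 := by simp
      have e20 : (σ'.set 20 v).reg 20 = v := by simp
      rw [← e13]
      generalize σ'.set 20 v = υ at *
      have e19 := e.len
      have e1 : steps ω [.store 7 19 20, .add 19 19 5] υ =
          (υ.setMem 7 σ.out.length v).set 19 (σ.out.length + 1) := by
        simp [steps, e20, e19, e.keep 5 (by omega) (by norm_num), hd.one]
      have e2 : Instr.step src σ (.emit p) =
        { σ with out := σ.out ++ [if σ.reg p = 0 then 0 else 1] } := rfl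
      rw [e1, e2]
      have ne : ∀ i, i ≠ 19 → ((υ.setMem 7 σ.out.length v).set 19 (σ.out.length + 1)).reg i =
          υ.reg i := fun i hi => by
        rw [State.set_reg, if_neg hi, State.setMem_reg]
      have ne7 : ∀ a, a ≠ 7 → ((υ.setMem 7 σ.out.length v).set 19 (σ.out.length + 1)).mem a =
          υ.mem a := fun i hi => by
        rw [State.set_mem, State.setMem_mem, if_neg hi]
      refine ⟨⟨fun r' hr => (ne _ (by omega)).trans (e.regs r' hr),
        fun r' hr hr' => (ne _ (by omega)).trans (e.keep r' hr hr'),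
        fun a' ha' ha7 => (ne7 _ ha7).trans (e.arr a' ha' ha7),
        fun a' p' => ?_, fun a' p' => ?_, e.io,
        (ne _ (by omega)).trans e.cnt, (ne _ (by omega)).trans e.ptr,
        (ne _ (by omega)).trans e.fl, by simp, fun i hi => ?_⟩, ne _ (by omega)⟩
      · rw [ne7 _ (by omega)]; exact e.stamp a' p'
      · rw [ne7 _ (by omega), ne7 _ (by omega)]; exact e.mem a' p'
      · simp only [State.set_mem, State.setMem_mem, if_true]
        simp only [List.length_append, List.length_singleton] at hi ⊢
        by_cases hil : i = σ.out.length
        · subst hil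
          rw [Function.update_self, List.getD_append_right _ _ _ _ le_rfl, hv]
          split_ifs <;> simp [ZMod.val_one]
        · rw [Function.update_of_ne hil, List.getD_append _ _ _ _ (by omega)]
          exact e.out i (by omega)

/-- `τ` arises from `σ` by changing scratch registers and the arrays in the list `As` only. -/
structure Frame (As : List ℕ) (σ τ : State) : Prop where
  reg : ∀ r, r < 13 ∨ 50 ≤ r → τ.reg r = σ.reg r
  mem : ∀ a, a ∉ As → τ.mem a = σ.mem a

theorem Frame.trans {As : List ℕ} {σ τ υ : State} (h : Frame As σ τ) (h' : Frame As τ υ) :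
    Frame As σ υ :=
  ⟨fun r hr => (h'.reg r hr).trans (h.reg r hr), fun a ha => (h'.mem a ha).trans (h.mem a ha)⟩

theorem Frame.of_eq {As : List ℕ} {σ τ τ' : State} (h : Frame As σ τ)
    (hr : ∀ r, r < 13 ∨ 50 ≤ r → τ'.reg r = τ.reg r) (hm : ∀ a, a ∉ As → τ'.mem a = τ.mem a) :
    Frame As σ τ' :=
  h.trans ⟨hr, hm⟩

/-! ### Subroutines of the search -/

/-! ### Drawing and storing examples -/

/-- Store the current point in array `a`, from position `reg 22` on. -/
def storePoint (a : ℕ) : Prog :=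
  .seq (blk (.const 24 0) [.add 25 0 6]) (.loop 25
    (blk (.bit 26 24) [.store a 22 26, .add 22 22 5, .add 24 24 5, .sub 25 25 5]))

theorem storePoint_runs {n : ℕ} (ω : Source n) (a : ℕ) (σ : State) (h0 : σ.reg 0 = n)
    (h5 : σ.reg 5 = 1) (h6 : σ.reg 6 = 0) (hd : 0 < σ.draws) :
    Runs ω (storePoint a) σ (n * 6 + 3) fun τ => Frame [a] σ τ ∧ τ.reg 21 = σ.reg 21 ∧
      τ.reg 23 = σ.reg 23 ∧ τ.reg 22 = σ.reg 22 + n ∧ τ.draws = σ.draws ∧ τ.flips = σ.flips ∧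
      τ.out = σ.out ∧
      (∀ j : Fin n, τ.mem a (σ.reg 22 + j) = (ω.point (σ.draws - 1) j).val) ∧
      ∀ p, p < σ.reg 22 ∨ σ.reg 22 + n ≤ p → τ.mem a p = σ.mem a p := by
  let Inv : ℕ → State → Prop := fun k τ => ∃ j, j + k = n ∧ τ.reg 25 = k ∧ τ.reg 24 = j ∧
    Frame [a] σ τ ∧ τ.reg 21 = σ.reg 21 ∧
      τ.reg 23 = σ.reg 23 ∧ τ.reg 22 = σ.reg 22 + j ∧ τ.draws = σ.draws ∧ τ.flips = σ.flips ∧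
      τ.out = σ.out ∧
      (∀ i : Fin n, i < j → τ.mem a (σ.reg 22 + i) = (ω.point (σ.draws - 1) i).val) ∧
      ∀ p, p < σ.reg 22 ∨ σ.reg 22 + j ≤ p → τ.mem a p = σ.mem a p
  refine (Runs.seq (Q := Inv n) (Runs.blk ?_)
    (Runs.loop Inv (B := 5) ?_ ?_ n)).mono (by simp; omega) ?_
  · refine ⟨0, by simp, by simp [steps, h0, h6], by simp [steps], ⟨fun r hr => ?_, ?_⟩, ?_⟩
    · simp only [steps, Instr.step_const, Instr.step_add, State.set_reg]
      rw [if_neg (by omega), if_neg (by omega)]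
    · simp [steps]
    · simp [steps]
  · rintro τ ⟨j, _, h, _⟩
    exact h
  · rintro k τ ⟨j, hj, h25, h24, hf, h21, h23, h22, hdr, hfl, hout, hm, hm'⟩
    refine ⟨by omega, Runs.blk ⟨j + 1, by omega, ?_⟩⟩
    have h5' := hf.reg 5 (by norm_num)
    have hjn : j < n := by omega
    have hd' : 0 < τ.draws := by omega
    simp only [steps, Instr.step_bit, Instr.step_store, Instr.step_add, Instr.step_sub,
      State.set_reg, State.setMem_reg, State.set_mem, State.set_draws, State.setMem_draws,
      State.set_flips, State.setMem_flips, State.set_out, State.setMem_out, Nat.reduceEqDiff,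
      if_true, if_false, State.setMem_mem, h25, h24, h22, h5', h5, true_and, hjn,
      hdr, hfl, hout, h21, h23, Nat.add_sub_cancel, Nat.add_assoc]
    refine ⟨hf.of_eq (fun r hr => ?_) (fun b hb => ?_), fun i hi => ?_, fun p hp => ?_⟩
    · simp only [State.set_reg, State.setMem_reg]
      repeat rw [if_neg (by omega)]
    · simp only [State.set_mem, State.setMem_mem]
      rw [if_neg (by simpa using hb)]
    · by_cases hij : (i : ℕ) = j
      · simp [← hij, hd]
      · rw [Function.update_of_ne (by omega)]
        exact hm i (by omega)
    · rw [Function.update_of_ne (by omega)]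
      exact hm' p (by omega)
  · rintro τ ⟨j, hj, h25, h24, hf, h21, h23, h22, hdr, hfl, hout, hm, hm'⟩
    obtain rfl : j = n := by omega
    exact ⟨hf, h21, h23, h22, hdr, hfl, hout, fun i => hm i i.2, hm'⟩

/-- Draw `reg cnt` examples and store the points in array `a` and the labels in array `l`. -/
def storeExamples (a l cnt : ℕ) : Prog :=
  .seq (blk (.add 21 cnt 6) [.add 22 0 6, .const 23 1]) (.loop 21 (.seq (.instr .draw)
    (.seq (storePoint a) (blk (.label 26) [.store l 23 26, .add 23 23 5, .sub 21 21 5]))))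

/-- The arrays `mem a` and `mem l` of `τ` hold the `N` examples from number `d` on, and elsewhere
agree with those of `σ`. -/
structure HoldsExamples {n : ℕ} (ω : Source n) (a l d N : ℕ) (σ τ : State) : Prop where
  point : ∀ i < N, ∀ j : Fin n, τ.mem a ((i + 1) * n + j) = (ω.point (d + i) j).val
  point_else : ∀ p, p < n ∨ (N + 1) * n ≤ p → τ.mem a p = σ.mem a p
  lab : ∀ i < N, τ.mem l (i + 1) = (ω.lab (d + i)).val
  lab_else : ∀ p, p = 0 ∨ N + 1 ≤ p → τ.mem l p = σ.mem l p

theorem storeExamples_runs {n : ℕ} (ω : Source n) {a l cnt N : ℕ} (hal : a ≠ l)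
    (σ : State) (h0 : σ.reg 0 = n) (h5 : σ.reg 5 = 1) (h6 : σ.reg 6 = 0) (hN : σ.reg cnt = N) :
    Runs ω (storeExamples a l cnt) σ (N * (n * 6 + 8 + 1) + 4) fun τ => Frame [a, l] σ τ ∧
      τ.draws = σ.draws + N ∧ τ.flips = σ.flips ∧ τ.out = σ.out ∧
      HoldsExamples ω a l σ.draws N σ τ := by
  let Inv : ℕ → State → Prop := fun k τ => ∃ i, i + k = N ∧ τ.reg 21 = k ∧
    τ.reg 22 = (i + 1) * n ∧ τ.reg 23 = i + 1 ∧ Frame [a, l] σ τ ∧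
    τ.draws = σ.draws + i ∧ τ.flips = σ.flips ∧ τ.out = σ.out ∧
    HoldsExamples ω a l σ.draws i σ τ
  refine (Runs.seq (Q := Inv N) (Runs.blk ?_)
    (Runs.loop Inv (B := n * 6 + 8) ?_ ?_ N)).mono
      (by simp only [List.length_cons, List.length_nil]; omega) ?_
  · refine ⟨0, by simp, ?_, ?_, by simp [steps], ⟨fun r hr => ?_, ?_⟩, ?_, ?_, ?_, ⟨?_, ?_, ?_, ?_⟩⟩
    · simp [steps, h6, hN]
    · simp [steps, h0, h6]
    · simp only [steps, Instr.step_const, Instr.step_add, State.set_reg]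
      rw [if_neg (by omega), if_neg (by omega), if_neg (by omega)]
    all_goals simp [steps]
  · rintro τ ⟨j, _, h, _⟩
    exact h
  · rintro k τ ⟨i, hi, h21, h22, h23, hf, hdr, hfl, hout, hE⟩
    refine ⟨by omega, (Runs.seq (B := 1) (B' := n * 6 + 3 + 4)
      (Q := fun υ => υ = Instr.step ω τ .draw) (Runs.instr rfl) ?_).mono (by omega)
      fun _ h => h⟩
    rintro _ rfl
    refine Runs.seq (storePoint_runs ω a _ ((hf.reg 0 (by norm_num)).trans h0)
      ((hf.reg 5 (by norm_num)).trans h5) ((hf.reg 6 (by norm_num)).trans h6) (by simp)) ?_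
    simp only [Instr.step_draw_reg, Instr.step_draw_draws, Instr.step_draw_flips,
      Instr.step_draw_out, h21, h22, h23, hdr, hfl, hout, Nat.add_sub_cancel, Instr.step_draw_mem]
    rintro υ ⟨gf, g21, g23, g22, gdr, gfl, gout, gm, gm'⟩
    have gf' : Frame [a, l] σ υ := (hf.trans (⟨gf.reg, fun b hb => gf.mem b ?_⟩))
    · have g5 : υ.reg 5 = 1 := (gf'.reg 5 (by norm_num)).trans h5
      refine Runs.blk ⟨i + 1, by omega, ?_⟩
      have hpos : 0 < υ.draws := by omega
      simp only [steps, Instr.step_label, Instr.step_store, Instr.step_add, Instr.step_sub,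
        State.set_reg, State.setMem_reg, State.set_draws, State.setMem_draws,
        State.set_flips, State.setMem_flips, State.set_out, State.setMem_out, Nat.reduceEqDiff,
        if_true, if_false, g21, g22, g23, g5, gdr, gfl, gout, Nat.add_sub_cancel,
        Nat.zero_lt_succ, true_and]
      refine ⟨by ring, gf'.of_eq (fun r hr => ?_) (fun b hb => ?_), by omega, ⟨fun i' hi' j => ?_,
        fun p hp => ?_, fun i' hi' => ?_, fun p hp => ?_⟩⟩
      · simp only [State.set_reg, State.setMem_reg]
        repeat rw [if_neg (by omega)]
      · simp only [State.set_mem, State.setMem_mem]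
        rw [if_neg (by simp at hb; tauto)]
      · simp only [State.set_mem, State.setMem_mem, if_neg hal]
        by_cases hii : i' = i
        · subst hii
          rw [gm]
        · have hlt : (i' + 1) * n + j < (i + 1) * n := by
            have h1 : (i' + 1 + 1) * n ≤ (i + 1) * n := Nat.mul_le_mul_right n (by omega)
            have h2 : (i' + 1 + 1) * n = (i' + 1) * n + n := by ring
            have := j.2
            omega
          rw [gm' _ (Or.inl hlt)]
          exact hE.point i' (by omega) j
      · simp only [State.set_mem, State.setMem_mem, if_neg hal]
        have : (i + 1 + 1) * n = (i + 1) * n + n := by ring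
        have h1 : n ≤ (i + 1) * n := Nat.le_mul_of_pos_left n (by omega)
        rw [gm' _ (by omega)]
        exact hE.point_else p (by omega)
      · simp only [State.set_mem, State.setMem_mem, if_true]
        by_cases hii : i' = i
        · subst hii
          simp
        · rw [Function.update_of_ne (by omega), gf.mem l (by simpa using hal.symm)]
          exact hE.lab i' (by omega)
      · simp only [State.set_mem, State.setMem_mem, if_true]
        rw [Function.update_of_ne (by omega), gf.mem l (by simpa using hal.symm)]
        exact hE.lab_else p (by omega)
    · simp at hb ⊢
      tauto
  · rintro τ ⟨i, hi, h21, h22, h23, hf, hdr, hfl, hout, hE⟩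
    obtain rfl : i = N := by omega
    exact ⟨hf, hdr, hfl, hout, hE⟩

/-! ### Further subroutines -/

/-- Store `reg 2` random bits in array `5`. -/
def storeCoins : Prog :=
  .seq (blk (.add 21 2 6) [.const 23 0]) (.loop 21
    (blk (.flip 26) [.store 5 23 26, .add 23 23 5, .sub 21 21 5]))

theorem storeCoins_runs {n : ℕ} (ω : Source n) (σ : State) (h5 : σ.reg 5 = 1) (h6 : σ.reg 6 = 0) :
    Runs ω storeCoins σ (σ.reg 2 * 5 + 3) fun τ => Frame [5] σ τ ∧
      τ.draws = σ.draws ∧ τ.flips = σ.flips + σ.reg 2 ∧ τ.out = σ.out ∧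
      (∀ i < σ.reg 2, τ.mem 5 i = (ω.coin (σ.flips + i)).val) ∧
      ∀ i, σ.reg 2 ≤ i → τ.mem 5 i = σ.mem 5 i := by
  let Inv : ℕ → State → Prop := fun k τ => ∃ j, j + k = σ.reg 2 ∧ τ.reg 21 = k ∧ τ.reg 23 = j ∧
    Frame [5] σ τ ∧ τ.draws = σ.draws ∧ τ.flips = σ.flips + j ∧ τ.out = σ.out ∧
      (∀ i < j, τ.mem 5 i = (ω.coin (σ.flips + i)).val) ∧
      ∀ i, j ≤ i → τ.mem 5 i = σ.mem 5 i
  refine (Runs.seq (Q := Inv (σ.reg 2)) (Runs.blk ?_)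
    (Runs.loop Inv (B := 4) ?_ ?_ _)).mono (by simp; omega) ?_
  · refine ⟨0, by simp, by simp [steps, h6], by simp [steps], ⟨fun r hr => ?_, ?_⟩, ?_⟩
    · simp only [steps, Instr.step_const, Instr.step_add, State.set_reg]
      rw [if_neg (by omega), if_neg (by omega)]
    · simp [steps]
    · simp [steps]
  · rintro τ ⟨j, _, h, _⟩
    exact h
  · rintro k τ ⟨j, hj, h21, h23, hf, hdr, hfl, hout, hm, hm'⟩
    refine ⟨by omega, Runs.blk ⟨j + 1, by omega, ?_⟩⟩
    have h5' := hf.reg 5 (by norm_num)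
    simp only [steps, Instr.step_store, Instr.step_add, Instr.step_sub, Instr.step_flip_reg,
      Instr.step_flip_mem, Instr.step_flip_draws, Instr.step_flip_flips, Instr.step_flip_out,
      State.set_reg, State.setMem_reg, State.set_mem, State.set_draws, State.setMem_draws,
      State.set_flips, State.setMem_flips, State.set_out, State.setMem_out, Nat.reduceEqDiff,
      if_true, if_false, State.setMem_mem, h21, h23, h5', h5, true_and,
      hdr, hfl, hout, Nat.add_sub_cancel, Nat.add_assoc]
    refine ⟨hf.of_eq (fun r hr => ?_) (fun b hb => ?_), fun i hi => ?_, fun p hp => ?_⟩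
    · simp only [State.set_reg, State.setMem_reg, Instr.step_flip_reg]
      repeat rw [if_neg (by omega)]
    · simp only [State.set_mem, State.setMem_mem, Instr.step_flip_mem]
      rw [if_neg (by simpa using hb)]
    · by_cases hij : i = j
      · simp [← hij]
      · rw [Function.update_of_ne (by omega)]
        exact hm i (by omega)
    · rw [Function.update_of_ne (by omega)]
      exact hm' p (by omega)
  · rintro τ ⟨j, hj, h21, h23, hf, hdr, hfl, hout, hm, hm'⟩
    obtain rfl : j = σ.reg 2 := by omega
    exact ⟨hf, hdr, hfl, hout, hm, hm'⟩

/-- Copy the first `reg cnt` elements of array `a` to array `a'`. -/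
def copyArray (a a' cnt : ℕ) : Prog :=
  .seq (blk (.add 21 cnt 6) [.const 23 0]) (.loop 21
    (blk (.load 26 a 23) [.store a' 23 26, .add 23 23 5, .sub 21 21 5]))

theorem copyArray_runs {n : ℕ} (ω : Source n) {a a' cnt : ℕ} (haa : a ≠ a')
    (σ : State) (h5 : σ.reg 5 = 1) (h6 : σ.reg 6 = 0) :
    Runs ω (copyArray a a' cnt) σ (σ.reg cnt * 5 + 3) fun τ => Frame [a'] σ τ ∧
      τ.draws = σ.draws ∧ τ.flips = σ.flips ∧ τ.out = σ.out ∧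
      (∀ i < σ.reg cnt, τ.mem a' i = σ.mem a i) ∧
      ∀ i, σ.reg cnt ≤ i → τ.mem a' i = σ.mem a' i := by
  let Inv : ℕ → State → Prop := fun k τ => ∃ j, j + k = σ.reg cnt ∧ τ.reg 21 = k ∧ τ.reg 23 = j ∧
    Frame [a'] σ τ ∧ τ.draws = σ.draws ∧ τ.flips = σ.flips ∧ τ.out = σ.out ∧
      (∀ i < j, τ.mem a' i = σ.mem a i) ∧
      ∀ i, j ≤ i → τ.mem a' i = σ.mem a' i
  refine (Runs.seq (Q := Inv (σ.reg cnt)) (Runs.blk ?_)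
    (Runs.loop Inv (B := 4) ?_ ?_ _)).mono (by simp; omega) ?_
  · refine ⟨0, by simp, by simp [steps, h6], by simp [steps], ⟨fun r hr => ?_, ?_⟩, ?_⟩
    · simp only [steps, Instr.step_const, Instr.step_add, State.set_reg]
      rw [if_neg (by omega), if_neg (by omega)]
    · simp [steps]
    · simp [steps]
  · rintro τ ⟨j, _, h, _⟩
    exact h
  · rintro k τ ⟨j, hj, h21, h23, hf, hdr, hfl, hout, hm, hm'⟩
    refine ⟨by omega, Runs.blk ⟨j + 1, by omega, ?_⟩⟩
    have h5' := hf.reg 5 (by norm_num)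
    have ha := hf.mem a (by simpa using haa)
    simp only [steps, Instr.step_store, Instr.step_add, Instr.step_sub, Instr.step_load,
      State.set_reg, State.setMem_reg, State.set_mem, State.set_draws, State.setMem_draws,
      State.set_flips, State.setMem_flips, State.set_out, State.setMem_out, Nat.reduceEqDiff,
      if_true, if_false, State.setMem_mem, h21, h23, h5', h5, true_and, ha,
      hdr, hfl, hout, Nat.add_sub_cancel]
    refine ⟨hf.of_eq (fun r hr => ?_) (fun b hb => ?_), fun i hi => ?_, fun p hp => ?_⟩
    · simp only [State.set_reg, State.setMem_reg]
      repeat rw [if_neg (by omega)]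
    · simp only [State.set_mem, State.setMem_mem]
      rw [if_neg (by simpa using hb)]
    · by_cases hij : i = j
      · simp [← hij]
      · rw [Function.update_of_ne (by omega)]
        exact hm i (by omega)
    · rw [Function.update_of_ne (by omega)]
      exact hm' p (by omega)
  · rintro τ ⟨j, hj, h21, h23, hf, hdr, hfl, hout, hm, hm'⟩
    obtain rfl : j = σ.reg cnt := by omega
    exact ⟨hf, hdr, hfl, hout, hm, hm'⟩

/-- Set the first `reg 7` elements of array `6` to zero. -/
def clearDigits : Prog :=
  .seq (blk (.add 21 7 6) [.const 23 0]) (.loop 21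
    (blk (.store 6 23 6) [.add 23 23 5, .sub 21 21 5]))

theorem clearDigits_runs {n : ℕ} (ω : Source n) (σ : State) (h5 : σ.reg 5 = 1) (h6 : σ.reg 6 = 0) :
    Runs ω clearDigits σ (σ.reg 7 * 4 + 3) fun τ => Frame [6] σ τ ∧
      τ.draws = σ.draws ∧ τ.flips = σ.flips ∧ τ.out = σ.out ∧
      ∀ i < σ.reg 7, τ.mem 6 i = 0 := by
  let Inv : ℕ → State → Prop := fun k τ => ∃ j, j + k = σ.reg 7 ∧ τ.reg 21 = k ∧ τ.reg 23 = j ∧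
    Frame [6] σ τ ∧ τ.draws = σ.draws ∧ τ.flips = σ.flips ∧ τ.out = σ.out ∧
      ∀ i < j, τ.mem 6 i = 0
  refine (Runs.seq (Q := Inv (σ.reg 7)) (Runs.blk ?_)
    (Runs.loop Inv (B := 3) ?_ ?_ _)).mono (by simp; omega) ?_
  · refine ⟨0, by simp, by simp [steps, h6], by simp [steps], ⟨fun r hr => ?_, ?_⟩, ?_⟩
    · simp only [steps, Instr.step_const, Instr.step_add, State.set_reg]
      rw [if_neg (by omega), if_neg (by omega)]
    · simp [steps]
    · simp [steps]
  · rintro τ ⟨j, _, h, _⟩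
    exact h
  · rintro k τ ⟨j, hj, h21, h23, hf, hdr, hfl, hout, hm⟩
    refine ⟨by omega, Runs.blk ⟨j + 1, by omega, ?_⟩⟩
    have h5' := hf.reg 5 (by norm_num)
    have h6' := hf.reg 6 (by norm_num)
    simp only [steps, Instr.step_store, Instr.step_add, Instr.step_sub, 
      State.set_reg, State.setMem_reg, State.set_mem, State.set_draws, State.setMem_draws,
      State.set_flips, State.setMem_flips, State.set_out, State.setMem_out, Nat.reduceEqDiff,
      if_true, if_false, State.setMem_mem, h21, h23, h5', h5, h6', h6, true_and,
      hdr, hfl, hout, Nat.add_sub_cancel]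
    refine ⟨hf.of_eq (fun r hr => ?_) (fun b hb => ?_), fun i hi => ?_⟩
    · simp only [State.set_reg, State.setMem_reg]
      repeat rw [if_neg (by omega)]
    · simp only [State.set_mem, State.setMem_mem]
      rw [if_neg (by simpa using hb)]
    · by_cases hij : i = j
      · simp [← hij]
      · rw [Function.update_of_ne (by omega)]
        exact hm i (by omega)
  · rintro τ ⟨j, hj, h21, h23, hf, hdr, hfl, hout, hm⟩
    obtain rfl : j = σ.reg 7 := by omega
    exact ⟨hf, hdr, hfl, hout, hm⟩

/-- Output the first `reg 0` elements of array `8`. -/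
def emitBest : Prog :=
  .seq (blk (.add 21 0 6) [.const 23 0]) (.loop 21
    (blk (.load 26 8 23) [.emit 26, .add 23 23 5, .sub 21 21 5]))

theorem emitBest_runs {n : ℕ} (ω : Source n) (σ : State) (h0 : σ.reg 0 = n) (h5 : σ.reg 5 = 1)
    (h6 : σ.reg 6 = 0) (hout : σ.out = []) :
    Runs ω emitBest σ (n * 5 + 3) fun τ => τ.draws = σ.draws ∧ ∀ x : Fin n → ZMod 2,
      (∀ j : Fin n, σ.mem 8 j = (x j).val) → τ.out = List.ofFn x := by
  let Inv : ℕ → State → Prop := fun k τ => ∃ j, j + k = n ∧ τ.reg 21 = k ∧ τ.reg 23 = j ∧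
    Frame [] σ τ ∧ τ.draws = σ.draws ∧ 
      ∀ x : Fin n → ZMod 2, (∀ j : Fin n, σ.mem 8 j = (x j).val) → τ.out = (List.ofFn x).take j
  refine (Runs.seq (Q := Inv n) (Runs.blk ?_)
    (Runs.loop Inv (B := 4) ?_ ?_ _)).mono (by simp; omega) ?_
  · refine ⟨0, by simp, by simp [steps, h6, h0], by simp [steps], ⟨fun r hr => ?_, ?_⟩, ?_⟩
    · simp only [steps, Instr.step_const, Instr.step_add, State.set_reg]
      rw [if_neg (by omega), if_neg (by omega)]
    · simp [steps]
    · simp [steps, hout]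
  · rintro τ ⟨j, _, h, _⟩
    exact h
  · rintro k τ ⟨j, hj, h21, h23, hf, hdr, ho⟩
    refine ⟨by omega, Runs.blk ⟨j + 1, by omega, ?_⟩⟩
    have h5' := hf.reg 5 (by norm_num)
    have h8 := hf.mem 8 (by simp)
    simp only [steps, Instr.step_load, Instr.step_add, Instr.step_sub, Instr.step_emit_reg,
      Instr.step_emit_draws, Instr.step_emit_out,
      State.set_reg, State.set_draws,
      State.set_out, Nat.reduceEqDiff,
      if_true, if_false, h21, h23, h5', h5, h8, true_and,
      hdr, Nat.add_sub_cancel]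
    refine ⟨hf.of_eq (fun r hr => ?_) (fun b hb => ?_), fun x hx => ?_⟩
    · simp only [State.set_reg, Instr.step_emit_reg]
      repeat rw [if_neg (by omega)]
    · simp only [State.set_mem, Instr.step_emit_mem]
    · have hjn : j < n := by omega
      have e := hx ⟨j, hjn⟩
      simp only at e
      rw [ho x hx, List.take_add_one, e]
      congr 1
      rw [List.getElem?_eq_getElem (by simpa using hjn), List.getElem_ofFn, Option.toList_some]
      congr 1
      generalize x ⟨j, hjn⟩ = y
      revert y
      decide
  · rintro τ ⟨j, hj, h21, h23, hf, hdr, ho⟩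
    obtain rfl : j = n := by omega
    refine ⟨hdr, fun x hx => ?_⟩
    rw [ho x hx, List.take_of_length_le (by simp)]

/-! ### Error patterns coded by words -/

/-- The error pattern coded by the `D` lowest digits of `v` to base `q + 1`, read from position `pos`
on: the digit `q` means to advance by `q` positions, a digit `d < q` to advance by `d`
positions, to place an error there, and to advance by one more position. -/
def wordPattern (q : ℕ) : ℕ → ℕ → ℕ → ℕ → ZMod 2
  | 0, _, _, _ => 0
  | D + 1, v, pos, i =>
    if v % (q + 1) = q then wordPattern q D (v / (q + 1)) (pos + q) i
    else (if i = pos + v % (q + 1) then 1 else 0) +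
      wordPattern q D (v / (q + 1)) (pos + v % (q + 1) + 1) i

/-- Put into array `4` the labels from array `3`, corrected by the error pattern coded by the digits in
array `6`. -/
def correctLabels : Prog :=
  .seq (.instr (.add 20 1 5)) (.seq (copyArray 3 4 20)
    (.seq (blk (.const 30 0) [.const 24 0, .add 21 7 6]) (.loop 21
      (.seq (blk (.load 26 6 24) [.sub 27 4 26]) (.seq
        (.ite 27
          (.seq (blk (.add 30 30 26) [.sub 28 1 30, .add 30 30 5])
            (.ite 28 (blk (.load 29 4 30) [.sub 29 5 29, .store 4 30 29]) (.instr (.const 15 0))))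
          (.instr (.add 30 30 4)))
        (blk (.add 24 24 5) [.sub 21 21 5]))))))

theorem correctLabels_runs {n : ℕ} (ω : Source n) (σ : State) {s q D v : ℕ} (lab : ℕ → ZMod 2)
    (h1 : σ.reg 1 = s) (h4 : σ.reg 4 = q) (h5 : σ.reg 5 = 1) (h6 : σ.reg 6 = 0)
    (h7 : σ.reg 7 = D) (hdig : ∀ j < D, σ.mem 6 j = v / (q + 1) ^ j % (q + 1))
    (hlab : ∀ i < s, σ.mem 3 (i + 1) = (lab i).val) (hlab0 : σ.mem 3 0 = 0) :
    Runs ω correctLabels σ (s * 5 + D * 14 + 13) fun τ => Frame [4] σ τ ∧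
      τ.draws = σ.draws ∧ τ.flips = σ.flips ∧ τ.out = σ.out ∧ τ.mem 4 0 = 0 ∧
      (∀ i < s, τ.mem 4 (i + 1) = (lab i + wordPattern q D v 0 i).val) ∧
      ∀ i, s + 1 ≤ i → τ.mem 4 i = σ.mem 4 i := by
  -- The current label plus the pattern of the unread digits, read from the current position, is
  -- always the fully corrected label. No explicit description of the errors already placed is
  -- needed.
  let Inv : ℕ → State → Prop := fun k τ => ∃ j pos, j + k = D ∧ τ.reg 21 = k ∧ τ.reg 24 = j ∧
    τ.reg 30 = pos ∧ Frame [4] σ τ ∧ τ.draws = σ.draws ∧ τ.flips = σ.flips ∧ τ.out = σ.out ∧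
    τ.mem 4 0 = 0 ∧
    (∀ i < s, ∃ c : ZMod 2, τ.mem 4 (i + 1) = c.val ∧
      c + wordPattern q k (v / (q + 1) ^ j) pos i = lab i + wordPattern q D v 0 i) ∧
    ∀ i, s + 1 ≤ i → τ.mem 4 i = σ.mem 4 i
  refine (Runs.seq (B := 1) (Q := fun τ => τ = σ.set 20 (s + 1)) (Runs.instr (by simp [h1, h5]))
    (B' := (s + 1) * 5 + 3 + (3 + (D * 13 + 1))) ?_).mono (by omega) (fun _ h => h)
  rintro _ rfl
  refine Runs.seq (B := (s + 1) * 5 + 3) ((copyArray_runs ω (by norm_num) (σ.set 20 (s + 1))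
    (by simpa using h5) (by simpa using h6)).mono (by simp) fun _ h => h) ?_
  rintro υ ⟨gf, gdr, gfl, gout, gm, gm'⟩
  simp only [State.set_reg, if_true, State.set_mem, State.set_draws, State.set_flips,
    State.set_out] at gdr gfl gout gm gm'
  have gf' : Frame [4] σ υ := Frame.trans (τ := σ.set 20 (s + 1)) ⟨fun r hr => by
    rw [State.set_reg, if_neg (by omega)], fun _ _ => rfl⟩ gf
  refine (Runs.seq (Q := Inv D) (Runs.blk ?_) (Runs.loop Inv (B := 12) ?_ ?_ _)).mono le_rfl ?_
  · refine ⟨0, 0, by simp, ?_, by simp [steps], by simp [steps],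
      gf'.of_eq (fun r hr => ?_) fun _ _ => ?_, ?_, ?_, ?_, ?_, fun i hi => ⟨lab i, ?_, ?_⟩, ?_⟩
    · simp [steps, (gf'.reg 7 (by norm_num)).trans h7, (gf'.reg 6 (by norm_num)).trans h6]
    · simp only [steps, Instr.step_const, Instr.step_add, State.set_reg]
      rw [if_neg (by omega), if_neg (by omega), if_neg (by omega)]
    · simp [steps]
    · simp [steps, gdr]
    · simp [steps, gfl]
    · simp [steps, gout]
    · simp [steps, gm 0 (Nat.succ_pos s), hlab0]
    · simp [steps, gm (i + 1) (by omega), hlab i hi]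
    · simp
    · intro i hi
      simp [steps, gm' i hi]
  · rintro τ ⟨j, pos, _, h, _⟩
    exact h
  · clear gm gm' gf gf' gdr gfl gout υ
    rintro k τ ⟨j, pos, hj, h21, h24, h30, hf, hdr, hfl, hout, hm0, hm, hm'⟩
    have h1' := (hf.reg 1 (by norm_num)).trans h1
    have h5' := (hf.reg 5 (by norm_num)).trans h5
    have h4' := (hf.reg 4 (by norm_num)).trans h4
    have hd : τ.mem 6 j = v / (q + 1) ^ j % (q + 1) := by
      rw [hf.mem 6 (by simp)]; exact hdig j (by omega)
    have hlt := Nat.mod_lt (v / (q + 1) ^ j) (Nat.succ_pos q)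
    have hw : v / (q + 1) ^ (j + 1) = v / (q + 1) ^ j / (q + 1) := by
      rw [Nat.div_div_eq_div_mul, pow_succ]
    simp only [wordPattern, ← hw] at hm
    set d := v / (q + 1) ^ j % (q + 1) with hdd
    refine ⟨by omega, (Runs.seq (B := 2) (B' := 10)
      (Q := fun υ => υ = (τ.set 26 d).set 27 (q - d)) (Runs.blk ?_) ?_).mono le_rfl fun _ h => h⟩
    · simp [steps, h24, hd, h4']
    rintro _ rfl
    refine Runs.seq (B := 8) (B' := 2) (Q := fun υ => ∃ pos', υ.reg 21 = k + 1 ∧ υ.reg 24 = j ∧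
      υ.reg 30 = pos' ∧ Frame [4] σ υ ∧ υ.draws = σ.draws ∧ υ.flips = σ.flips ∧ υ.out = σ.out ∧
      υ.mem 4 0 = 0 ∧ (∀ i < s, ∃ c : ZMod 2, υ.mem 4 (i + 1) = c.val ∧
      c + wordPattern q k (v / (q + 1) ^ (j + 1)) pos' i = lab i + wordPattern q D v 0 i) ∧
      ∀ i, s + 1 ≤ i → υ.mem 4 i = σ.mem 4 i)
      ((Runs.ite (B := 7) (B' := 1) (fun h0 => ?_) (fun h0 => Runs.instr ?_)).mono
        le_rfl fun _ h => h) ?_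
    · simp only [State.set_reg, if_true] at h0
      have hdq : d ≠ q := by omega
      simp only [if_neg hdq] at hm
      -- Label `i` stands at address `i + 1`, so the advanced position `pos + d + 1` is also the
      -- address of the label to be flipped at position `pos + d`.
      refine (Runs.seq (B := 3) (B' := 4) (Q := fun υ => υ =
        ((((τ.set 26 d).set 27 (q - d)).set 30 (pos + d)).set 28 (s - (pos + d))).set 30
          (pos + d + 1)) (Runs.blk ?_) ?_)
      · simp [steps, h30, h1', h5']
      rintro _ rfl
      have hfr : ∀ r, r < 13 ∨ 50 ≤ r → (((((τ.set 26 d).set 27 (q - d)).set 30 (pos + d)).set 28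
          (s - (pos + d))).set 30 (pos + d + 1)).reg r = τ.reg r := fun r hr => by
        simp only [State.set_reg]
        repeat rw [if_neg (by omega)]
      refine (Runs.ite (B := 3) (B' := 1) (fun h0 => Runs.blk ?_)
        (fun h0 => Runs.instr ?_)).mono le_rfl fun _ h => h
      · refine ⟨pos + d + 1, ?_⟩
        simp only [State.set_reg, if_true, Nat.reduceEqDiff, if_false] at h0
        simp only [steps, Instr.step_load, Instr.step_sub, Instr.step_store,
          State.set_reg, State.setMem_reg, State.set_mem, State.set_draws, State.setMem_draws,
          State.set_flips, State.setMem_flips, State.set_out, State.setMem_out, Nat.reduceEqDiff,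
          if_true, if_false, State.setMem_mem, h21, h24, h5', true_and, hdr, hfl, hout]
        refine ⟨hf.of_eq (fun r hr => ?_) (fun b hb => ?_), ?_, fun i hi => ?_, fun i hi => ?_⟩
        · rw [← hfr r hr]
          simp only [State.set_reg, State.setMem_reg]
          repeat rw [if_neg (by omega)]
        · rw [State.setMem_mem, if_neg (by simpa using hb)]
          rfl
        · rw [Function.update_of_ne (by omega), hm0]
        · obtain ⟨c, hc, hc'⟩ := hm i hi
          by_cases hip : i = pos + d
          · refine ⟨c + 1, ?_, ?_⟩
            · rw [hip, Function.update_self, ← hip, hc]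
              clear hc hc'
              revert c
              decide
            · rw [← hc', if_pos hip]
              ring
          · refine ⟨c, ?_, ?_⟩
            · rw [Function.update_of_ne (by omega), hc]
            · rw [← hc', if_neg hip, zero_add]
        · rw [Function.update_of_ne (by omega)]
          exact hm' i hi
      -- An error position that is not below `s` changes no label, in the program as in the claim,
      -- which only concerns `i < s`.
      · refine ⟨pos + d + 1, ?_⟩
        simp only [State.set_reg, if_true, Nat.reduceEqDiff, if_false] at h0
        simp only [Instr.step_const,
          State.set_reg, State.set_mem, State.set_draws, 
          State.set_flips, State.set_out, Nat.reduceEqDiff,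
          if_true, if_false, h21, h24, true_and, hdr, hfl, hout, hm0]
        refine ⟨hf.of_eq (fun r hr => ?_) (fun b hb => rfl), fun i hi => ?_, hm'⟩
        · rw [State.set_reg, if_neg (by omega), hfr r hr]
        · obtain ⟨c, hc, hc'⟩ := hm i hi
          refine ⟨c, hc, ?_⟩
          rw [← hc', if_neg (by omega), zero_add]
    · simp only [State.set_reg, if_true] at h0
      have hdq : d = q := by omega
      simp only [if_pos hdq] at hm
      simp only [Instr.step_add,
          State.set_reg, State.set_mem, State.set_draws, 
          State.set_flips, State.set_out, Nat.reduceEqDiff,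
          if_true, if_false, h21, h24, h30, h4', true_and, hdr, hfl, hout, hm0]
      refine ⟨pos + q, rfl, hf.of_eq (fun r hr => ?_) (fun b hb => rfl), hm, hm'⟩
      simp only [State.set_reg]
      repeat rw [if_neg (by omega)]
    · rintro υ ⟨pos', g21, g24, g30, gf, gdr, gfl, gout, gm0, gm, gm'⟩
      have g5 := (gf.reg 5 (by norm_num)).trans h5
      refine Runs.blk ⟨j + 1, pos', by omega, ?_⟩
      simp only [steps, Instr.step_add, Instr.step_sub,
        State.set_reg, State.set_mem, State.set_draws, State.set_flips, State.set_out,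
        Nat.reduceEqDiff, if_true, if_false, g21, g24, g30, g5, true_and, gdr, gfl, gout, gm0,
        Nat.add_sub_cancel]
      refine ⟨gf.of_eq (fun r hr => ?_) (fun b hb => rfl), gm, gm'⟩
      simp only [State.set_reg]
      repeat rw [if_neg (by omega)]
  · rintro τ ⟨j, pos, hj, h21, h24, h30, hf, hdr, hfl, hout, hm0, hm, hm'⟩
    refine ⟨hf, hdr, hfl, hout, hm0, fun i hi => ?_, hm'⟩
    obtain ⟨c, hc, hc'⟩ := hm i hi
    rw [hc, ← hc', wordPattern, add_zero]

/-- Advance the word of digits in array `6`; register `27` receives the carry. -/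
def nextWord : Prog :=
  .seq (blk (.const 27 1) [.const 24 0, .add 21 7 6]) (.loop 21
    (.seq (blk (.load 26 6 24) [.add 26 26 27, .sub 28 26 4]) (.seq
      (.ite 28 (blk (.const 27 1) [.store 6 24 6]) (blk (.const 27 0) [.store 6 24 26]))
      (blk (.add 24 24 5) [.sub 21 21 5]))))

theorem pow_succ_dvd_iff {b m j : ℕ} (h : b ^ j ∣ m) : b ^ (j + 1) ∣ m ↔ m / b ^ j % b = 0 := by
  rw [pow_succ, ← Nat.dvd_div_iff_mul_dvd h, Nat.dvd_iff_mod_eq_zero]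

/-- The carry into digit `j` when `v` is incremented is `1` exactly when `(q + 1) ^ j` divides `v +
1`. The final carry therefore reports that the counter has overflowed, that is, that all words have
been used. -/
theorem nextWord_runs {n : ℕ} (ω : Source n) (σ : State) {q D v : ℕ}
    (h4 : σ.reg 4 = q) (h5 : σ.reg 5 = 1) (h6 : σ.reg 6 = 0) (h7 : σ.reg 7 = D)
    (hdig : ∀ j < D, σ.mem 6 j = v / (q + 1) ^ j % (q + 1)) :
    Runs ω nextWord σ (D * 9 + 4) fun τ => Frame [6] σ τ ∧
      τ.draws = σ.draws ∧ τ.flips = σ.flips ∧ τ.out = σ.out ∧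
      τ.reg 27 = (if (q + 1) ^ D ∣ v + 1 then 1 else 0) ∧
      ∀ j < D, τ.mem 6 j = (v + 1) / (q + 1) ^ j % (q + 1) := by
  let Inv : ℕ → State → Prop := fun k τ => ∃ j, j + k = D ∧ τ.reg 21 = k ∧ τ.reg 24 = j ∧
    Frame [6] σ τ ∧ τ.draws = σ.draws ∧ τ.flips = σ.flips ∧ τ.out = σ.out ∧
    τ.reg 27 = (if (q + 1) ^ j ∣ v + 1 then 1 else 0) ∧
    (∀ i < j, τ.mem 6 i = (v + 1) / (q + 1) ^ i % (q + 1)) ∧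
    ∀ i, j ≤ i → i < D → τ.mem 6 i = v / (q + 1) ^ i % (q + 1)
  refine (Runs.seq (Q := Inv D) (Runs.blk ?_)
    (Runs.loop Inv (B := 8) ?_ ?_ _)).mono (by simp; omega) ?_
  · refine ⟨0, by simp, by simp [steps, h6, h7], by simp [steps], ⟨fun r hr => ?_, ?_⟩, ?_⟩
    · simp only [steps, Instr.step_const, Instr.step_add, State.set_reg]
      rw [if_neg (by omega), if_neg (by omega), if_neg (by omega)]
    · simp [steps]
    · simpa [steps] using hdig
  · rintro τ ⟨j, _, h, _⟩
    exact h
  · rintro k τ ⟨j, hj, h21, h24, hf, hdr, hfl, hout, h27, hm, hm'⟩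
    have h5' := (hf.reg 5 (by norm_num)).trans h5
    have h6' := (hf.reg 6 (by norm_num)).trans h6
    have h4' := (hf.reg 4 (by norm_num)).trans h4
    have hd := hm' j le_rfl (by omega)
    have hlt := Nat.mod_lt (v / (q + 1) ^ j) (Nat.succ_pos q)
    set d := v / (q + 1) ^ j % (q + 1) with hdd
    set c := if (q + 1) ^ j ∣ v + 1 then 1 else 0 with hc
    have hdiv : (v + 1) / (q + 1) ^ j % (q + 1) = if d + c = q + 1 then 0 else d + c := by
      rw [Nat.succ_div, ← hc, Nat.add_mod, ← hdd]
      have hc1 : c ≤ 1 := by rw [hc]; split_ifs <;> simp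
      -- In base `1` the carry is not smaller than the base, so reducing it modulo the base would
      -- change it.
      by_cases hq : q = 0
      · subst hq
        simp only [Nat.zero_add, Nat.mod_one]
        split_ifs <;> omega
      · rw [Nat.mod_eq_of_lt (a := c) (by omega)]
        split_ifs with hdc
        · rw [hdc, Nat.mod_self]
        · exact Nat.mod_eq_of_lt (by omega)
    have hcarry : (if (q + 1) ^ (j + 1) ∣ v + 1 then 1 else 0) =
        if d + c = q + 1 then 1 else 0 := by
      by_cases hdv : (q + 1) ^ j ∣ v + 1
      · have hc1 : c = 1 := by rw [hc, if_pos hdv]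
        simp only [pow_succ_dvd_iff hdv, hdiv]
        split_ifs <;> omega
      · have hc0 : c = 0 := by rw [hc, if_neg hdv]
        rw [if_neg fun h => hdv ((pow_dvd_pow _ (Nat.le_succ j)).trans h), if_neg (by omega)]
    have hnew : ∀ w : ℕ, w = (v + 1) / (q + 1) ^ j % (q + 1) →
        (∀ i < j + 1, Function.update (τ.mem 6) j w i = (v + 1) / (q + 1) ^ i % (q + 1)) ∧
        ∀ i, j + 1 ≤ i → i < D → Function.update (τ.mem 6) j w i =
          v / (q + 1) ^ i % (q + 1) := by
      rintro w rfl
      refine ⟨fun i hi => ?_, fun i hi hi' => ?_⟩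
      · by_cases hij : i = j
        · subst hij; rw [Function.update_self]
        · rw [Function.update_of_ne hij]; exact hm i (by omega)
      · rw [Function.update_of_ne (by omega)]; exact hm' i (by omega) hi'
    refine ⟨by omega, ?_⟩
    refine (Runs.seq (B := 3) (B' := 5)
      (Q := fun υ => υ = ((τ.set 26 d).set 26 (d + c)).set 28 (d + c - q)) (Runs.blk ?_) ?_).mono
      le_rfl fun _ h => h
    · simp [steps, h24, hd, h27, h4']
    rintro _ rfl
    refine (Runs.seq (B := 3) (B' := 2)
      (Q := fun υ => ∃ w, υ = ((((τ.set 26 d).set 26 (d + c)).set 28 (d + c - q)).set 27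
        (if d + c = q + 1 then 1 else 0)).setMem 6 j w ∧ w = (v + 1) / (q + 1) ^ j % (q + 1))
      ((Runs.ite (B := 2) (B' := 2) (fun h0 => Runs.blk ?_) (fun h0 => Runs.blk ?_)).mono
        le_rfl fun _ h => h) ?_)
    · simp only [State.set_reg, Nat.reduceEqDiff, if_true] at h0
      have hdc : d + c = q + 1 := by
        have hc1 : c ≤ 1 := by rw [hc]; split_ifs <;> simp
        omega
      refine ⟨0, ?_, by rw [hdiv, if_pos hdc]⟩
      simp [steps, h24, h6', hdc]
    · simp only [State.set_reg, Nat.reduceEqDiff, if_true] at h0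
      have hdc : d + c ≠ q + 1 := by omega
      refine ⟨d + c, ?_, by rw [hdiv, if_neg hdc]⟩
      simp [steps, h24, hdc]
    · rintro _ ⟨w, rfl, hw⟩
      refine Runs.blk ⟨j + 1, by omega, ?_⟩
      simp only [steps, Instr.step_add, Instr.step_sub,
        State.set_reg, State.setMem_reg, State.set_mem, State.set_draws, State.setMem_draws,
        State.set_flips, State.setMem_flips, State.set_out, State.setMem_out, Nat.reduceEqDiff,
        if_true, if_false, State.setMem_mem, h21, h24, h5', true_and, hdr, hfl, hout, hcarry,
        Nat.add_sub_cancel]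
      refine ⟨hf.of_eq (fun r hr => ?_) (fun b hb => ?_), hnew w hw⟩
      · simp only [State.set_reg, State.setMem_reg]
        repeat rw [if_neg (by omega)]
      · simp only [State.set_mem, State.setMem_mem]
        rw [if_neg (by simpa using hb)]
  · rintro τ ⟨j, hj, h21, h24, hf, hdr, hfl, hout, h27, hm, hm'⟩
    obtain rfl : j = D := by omega
    exact ⟨hf, hdr, hfl, hout, h27, hm⟩

/-! ### Testing a candidate -/

/-- The number of the first `M` examples with points `a` and labels `l` that disagree with `y`. -/
def score {n : ℕ} (a : ℕ → Fin n → ZMod 2) (l : ℕ → ZMod 2) (M : ℕ) (y : Fin n → ZMod 2) : ℕ :=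
  ((Finset.range M).filter fun i => parity y (a i) ≠ l i).card

/-- Put into register `29` the number of the `reg 8` examples stored in arrays `0` and `1` that
disagree with the vector in array `7`. -/
def testCandidate : Prog :=
  .seq (blk (.const 29 0) [.add 22 0 6, .const 23 1, .add 21 8 6]) (.loop 21
    (.seq (blk (.load 28 1 23) [.const 24 0, .add 25 0 6]) (.seq
      (.loop 25 (.seq (blk (.load 26 0 22) [.load 27 7 24]) (.seq
        (.ite 26 (.ite 27 (.instr (.sub 28 5 28)) (.instr (.const 15 0))) (.instr (.const 15 0)))
        (blk (.add 22 22 5) [.add 24 24 5, .sub 25 25 5]))))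
      (blk (.add 29 29 28) [.add 23 23 5, .sub 21 21 5]))))

theorem testCandidate_runs {n : ℕ} (ω : Source n) (σ : State) {M : ℕ} (a : ℕ → Fin n → ZMod 2)
    (l : ℕ → ZMod 2) (h0 : σ.reg 0 = n) (h5 : σ.reg 5 = 1) (h6 : σ.reg 6 = 0) (h8 : σ.reg 8 = M)
    (ha : ∀ i < M, ∀ j : Fin n, σ.mem 0 ((i + 1) * n + j) = (a i j).val)
    (hl : ∀ i < M, σ.mem 1 (i + 1) = (l i).val) :
    Runs ω testCandidate σ (M * (n * 9 + 7 + 1) + 5) fun τ => Frame [] σ τ ∧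
      τ.draws = σ.draws ∧ τ.flips = σ.flips ∧ τ.out = σ.out ∧ τ.reg 19 = σ.reg 19 ∧
      ∀ y : Fin n → ZMod 2, (∀ j : Fin n, σ.mem 7 j = (y j).val) → τ.reg 29 = score a l M y := by
  let Inv : ℕ → State → Prop := fun k τ => ∃ i, i + k = M ∧ τ.reg 21 = k ∧
    τ.reg 22 = (i + 1) * n ∧ τ.reg 23 = i + 1 ∧ Frame [] σ τ ∧
    τ.draws = σ.draws ∧ τ.flips = σ.flips ∧ τ.out = σ.out ∧ τ.reg 19 = σ.reg 19 ∧
    ∀ y : Fin n → ZMod 2, (∀ j : Fin n, σ.mem 7 j = (y j).val) → τ.reg 29 = score a l i y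
  refine (Runs.seq (Q := Inv M) (Runs.blk ?_)
    (Runs.loop Inv (B := n * 9 + 7) ?_ ?_ M)).mono
      (by simp only [List.length_cons, List.length_nil]; omega) ?_
  · refine ⟨0, by simp, ?_, ?_, by simp [steps], ⟨fun r hr => ?_, ?_⟩, ?_⟩
    · simp [steps, h6, h8]
    · simp [steps, h0, h6]
    · simp only [steps, Instr.step_const, Instr.step_add, State.set_reg]
      repeat rw [if_neg (by omega)]
    all_goals simp [steps, score]
  · rintro τ ⟨j, _, h, _⟩
    exact h
  · rintro k τ ⟨i, hi, h21, h22, h23, hf, hdr, hfl, hout, h19, hs⟩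
    have hiM : i < M := by omega
    let g : (Fin n → ZMod 2) → ℕ → ZMod 2 := fun y j => if h : j < n then y ⟨j, h⟩ * a i ⟨j, h⟩ else 0
    have hg : ∀ y, ∑ j ∈ Finset.range n, g y j = parity y (a i) := by
      intro y
      rw [parity, ← Fin.sum_univ_eq_sum_range]
      refine Finset.sum_congr rfl fun j _ => ?_
      simp [g]
    -- Register `28` starts with the label and is flipped for every coordinate in which point and
    -- candidate both have a `1`. It ends as label plus parity, which is `1` exactly for a
    -- disagreement.
    let Jnv : ℕ → State → Prop := fun k' υ => ∃ j, j + k' = n ∧ υ.reg 25 = k' ∧ υ.reg 24 = j ∧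
      υ.reg 21 = k + 1 ∧ υ.reg 22 = (i + 1) * n + j ∧ υ.reg 23 = i + 1 ∧ υ.reg 29 = τ.reg 29 ∧
      Frame [] σ υ ∧ υ.draws = σ.draws ∧ υ.flips = σ.flips ∧ υ.out = σ.out ∧
      υ.reg 19 = σ.reg 19 ∧
      ∀ y : Fin n → ZMod 2, (∀ j : Fin n, σ.mem 7 j = (y j).val) →
        υ.reg 28 = (l i + ∑ j ∈ Finset.range j, g y j).val
    refine ⟨by omega, (Runs.seq (Q := Jnv n) (B := 3) (B' := n * (8 + 1) + 1 + 3) (Runs.blk ?_)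
      fun υ hυ => Runs.seq (Runs.loop Jnv (B := 8) ?_ ?_ n υ hυ) ?_).mono (by omega) fun _ h => h⟩
    · refine ⟨0, by simp, ?_, by simp [steps], by simp [steps, h21], by simp [steps, h22],
        by simp [steps, h23], by simp [steps],
        hf.of_eq (fun r hr => ?_) fun _ _ => rfl, hdr, hfl, hout, by simp [steps, h19],
        fun y _ => ?_⟩
      · simp [steps, hf.reg 0, h0, hf.reg 6, h6]
      · simp only [steps, Instr.step_const, Instr.step_add, Instr.step_load, State.set_reg]
        repeat rw [if_neg (by omega)]
      · simp [steps, h23, hf.mem 1, hl i hiM]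
    · rintro τ ⟨j, _, h, _⟩
      exact h
    · rintro k' υ ⟨j, hj, g25, g24, g21, g22, g23, g29, gf, gdr, gfl, gout, g19, gs⟩
      have hjn : j < n := by omega
      have g5 := (gf.reg 5 (by norm_num)).trans h5
      refine ⟨by omega, ?_⟩
      have e0 : υ.mem 0 ((i + 1) * n + j) = (a i ⟨j, hjn⟩).val := by
        rw [gf.mem 0 (by simp)]; exact ha i hiM ⟨j, hjn⟩
      have e7 : υ.mem 7 j = σ.mem 7 j := by
        rw [gf.mem 7 (by simp)]
      refine (Runs.seq (B := 2) (B' := 6)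
        (Q := fun υ' => υ' = (υ.set 26 (a i ⟨j, hjn⟩).val).set 27 (σ.mem 7 j)) (Runs.blk ?_)
        ?_).mono le_rfl fun _ h => h
      · simp [steps, g22, g24, e0, e7]
      rintro _ rfl
      refine Runs.seq (B := 3) (B' := 3)
        (Q := fun υ' => (∀ r, r ≠ 15 → r ≠ 26 → r ≠ 27 → r ≠ 28 → υ'.reg r = υ.reg r) ∧
          υ'.mem = υ.mem ∧ υ'.draws = υ.draws ∧ υ'.flips = υ.flips ∧ υ'.out = υ.out ∧
          ∀ y : Fin n → ZMod 2, (∀ j : Fin n, σ.mem 7 j = (y j).val) →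
            υ'.reg 28 = (l i + ∑ j ∈ Finset.range (j + 1), g y j).val)
        ((Runs.ite (B := 2) (B' := 1) (fun h0 => (Runs.ite (B := 1) (B' := 1)
          (fun h1 => Runs.instr ?_) (fun h1 => Runs.instr ?_)).mono le_rfl fun _ h => h)
          (fun h0 => Runs.instr ?_)).mono le_rfl fun _ h => h) ?_
      · refine ⟨fun r _ _ _ _ => by simp [*], rfl, rfl, rfl, rfl, fun y hy => ?_⟩
        simp only [State.set_reg, Nat.reduceEqDiff, if_true, if_false, hy ⟨j, hjn⟩,
          Instr.step_sub, g5, gs y hy, Finset.sum_range_succ, g, dif_pos hjn] at h0 h1 ⊢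
        generalize a i ⟨j, hjn⟩ = u at *
        generalize y ⟨j, hjn⟩ = w at *
        rw [← add_assoc]
        generalize l i + _ = z
        clear * - h0 h1
        revert u w z
        decide
      · refine ⟨fun r _ _ _ _ => by simp [*], rfl, rfl, rfl, rfl, fun y hy => ?_⟩
        have hyj := hy ⟨j, hjn⟩
        simp only [State.set_reg, Nat.reduceEqDiff, if_true, if_false, hyj,
          Instr.step_const, gs y hy, Finset.sum_range_succ, g, dif_pos hjn] at h1 ⊢
        have : y ⟨j, hjn⟩ = 0 := (ZMod.val_eq_zero _).1 h1
        rw [this, zero_mul, add_zero]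
      · refine ⟨fun r _ _ _ _ => by simp [*], rfl, rfl, rfl, rfl, fun y hy => ?_⟩
        simp only [State.set_reg, Nat.reduceEqDiff, if_true, if_false,
          Instr.step_const, gs y hy, Finset.sum_range_succ, g, dif_pos hjn] at h0 ⊢
        have : a i ⟨j, hjn⟩ = 0 := (ZMod.val_eq_zero _).1 h0
        rw [this, mul_zero, add_zero]
      · rintro υ' ⟨hr, hm, hd, hfp, ho, h28⟩
        refine Runs.blk ⟨j + 1, by omega, ?_⟩
        simp only [steps, Instr.step_add, Instr.step_sub,
          State.set_reg, State.set_draws, State.set_flips, State.set_out,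
          Nat.reduceEqDiff, if_true, if_false, hd, hfp, ho,
          hr 5 (by norm_num) (by norm_num) (by norm_num) (by norm_num),
          hr 19 (by norm_num) (by norm_num) (by norm_num) (by norm_num),
          hr 21 (by norm_num) (by norm_num) (by norm_num) (by norm_num),
          hr 22 (by norm_num) (by norm_num) (by norm_num) (by norm_num),
          hr 23 (by norm_num) (by norm_num) (by norm_num) (by norm_num),
          hr 24 (by norm_num) (by norm_num) (by norm_num) (by norm_num),
          hr 25 (by norm_num) (by norm_num) (by norm_num) (by norm_num),
          hr 29 (by norm_num) (by norm_num) (by norm_num) (by norm_num),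
          g25, g24, g21, g22, g23, g29, g5, gdr, gfl, gout, g19, Nat.add_sub_cancel, true_and,
          Nat.add_assoc]
        refine ⟨gf.of_eq (fun r hr' => ?_) (fun b hb => by rw [State.set_mem, State.set_mem,
          State.set_mem, hm]), h28⟩
        simp only [State.set_reg]
        repeat rw [if_neg (by omega)]
        exact hr r (by omega) (by omega) (by omega) (by omega)
    · rintro υ ⟨j, hj, g25, g24, g21, g22, g23, g29, gf, gdr, gfl, gout, g19, gs⟩
      obtain rfl : j = n := by omega
      have g5 := (gf.reg 5 (by norm_num)).trans h5
      refine Runs.blk ⟨i + 1, by omega, ?_⟩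
      simp only [steps, Instr.step_add, Instr.step_sub,
        State.set_reg, State.set_draws, State.set_flips, State.set_out,
        Nat.reduceEqDiff, if_true, if_false,
        g21, g22, g23, g29, g5, gdr, gfl, gout, g19, Nat.add_sub_cancel, true_and]
      refine ⟨by ring, gf.of_eq (fun r hr' => ?_) (fun b hb => rfl), fun y hy => ?_⟩
      · simp only [State.set_reg]
        repeat rw [if_neg (by omega)]
      · rw [hs y hy, gs y hy, hg, score, score, Finset.range_add_one, Finset.filter_insert]
        split_ifs with hp
        · rw [Finset.card_insert_of_notMem (by simp)]
          congr 1
          generalize parity y (a i) = u at *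
          generalize l i = w at *
          clear * - hp
          revert u w
          decide
        · rw [not_not] at hp
          rw [hp]
          rw [CharTwo.add_self_eq_zero, ZMod.val_zero, add_zero]
  · rintro τ ⟨i, hi, h21, h22, h23, hf, hdr, hfl, hout, h19, hs⟩
    obtain rfl : i = M := by omega
    exact ⟨hf, hdr, hfl, hout, h19, hs⟩

/-! ### Copying registers -/

theorem steps_append {n : ℕ} (ω : Source n) (l l' : List Instr) (σ : State) :
    steps ω (l ++ l') σ = steps ω l' (steps ω l σ) := by
  induction l generalizing σ with
  | nil => rfl
  | cons i l ih => exact ih _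

/-- Instructions for copying the registers `src r`, `r < R`, to the registers `dst + r`; register `z`
is supposed to hold `0`. -/
def copyRegs (dst : ℕ) (src : ℕ → ℕ) (z R : ℕ) : List Instr :=
  (List.range R).map fun r => .add (dst + r) (src r) z

theorem steps_copyRegs {n : ℕ} (ω : Source n) (dst : ℕ) (src : ℕ → ℕ) (z R : ℕ) (σ : State)
    (hz : σ.reg z = 0) (hzd : z < dst ∨ dst + R ≤ z)
    (hsrc : ∀ r < R, src r < dst ∨ dst + R ≤ src r) :
    (∀ r < R, (steps ω (copyRegs dst src z R) σ).reg (dst + r) = σ.reg (src r)) ∧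
    (∀ i, i < dst ∨ dst + R ≤ i → (steps ω (copyRegs dst src z R) σ).reg i = σ.reg i) ∧
    (steps ω (copyRegs dst src z R) σ).mem = σ.mem ∧
    (steps ω (copyRegs dst src z R) σ).draws = σ.draws ∧
    (steps ω (copyRegs dst src z R) σ).flips = σ.flips ∧
    (steps ω (copyRegs dst src z R) σ).out = σ.out := by
  -- The disjointness conditions refer to the whole block `R`, so the induction runs over shorter
  -- blocks with these conditions kept fixed.
  suffices h : ∀ R' ≤ R,
      (∀ r < R', (steps ω (copyRegs dst src z R') σ).reg (dst + r) = σ.reg (src r)) ∧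
      (∀ i, i < dst ∨ dst + R' ≤ i → (steps ω (copyRegs dst src z R') σ).reg i = σ.reg i) ∧
      (steps ω (copyRegs dst src z R') σ).mem = σ.mem ∧
      (steps ω (copyRegs dst src z R') σ).draws = σ.draws ∧
      (steps ω (copyRegs dst src z R') σ).flips = σ.flips ∧
      (steps ω (copyRegs dst src z R') σ).out = σ.out from h R le_rfl
  intro R' hR
  induction R' with
  | zero => simp [copyRegs, steps]
  | succ R' ih =>
    obtain ⟨h1, h2, h3, h4, h5, h6⟩ := ih (by omega)
    have e : steps ω (copyRegs dst src z (R' + 1)) σ =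
        (steps ω (copyRegs dst src z R') σ).set (dst + R') (σ.reg (src R')) := by
      rw [copyRegs, List.range_succ, List.map_append, steps_append]
      simp only [List.map_cons, List.map_nil, steps, Instr.step_add]
      rw [← copyRegs, h2 z (by omega), h2 (src R') (by have := hsrc R' (by omega); omega), hz,
        add_zero]
    rw [e]
    refine ⟨fun r hr => ?_, fun i hi => ?_, h3, h4, h5, h6⟩
    · rw [State.set_reg]
      by_cases hrr : r = R'
      · rw [if_pos (by omega), hrr]
      · rw [if_neg (by omega), h1 r (by omega)]
    · rw [State.set_reg, if_neg (by omega), h2 i (by omega)]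

theorem length_copyRegs (dst : ℕ) (src : ℕ → ℕ) (z R : ℕ) : (copyRegs dst src z R).length = R := by
  simp [copyRegs]

/-! ### The search program and the error patterns it covers -/

/-! ### Running the learner on stored examples -/

/-- The examples from number `d` on with labels corrected by the error pattern coded by `v`, and the
random bits from number `e` on; everything after the first `s` examples and the first `t` random bits
is zero. -/
def roundSource {n : ℕ} (ω : Source n) (s t q D d e v : ℕ) : Source n where
  point i := if i < s then ω.point (d + i) else 0
  lab i := if i < s then ω.lab (d + i) + wordPattern q D v 0 i else 0
  coin i := if i < t then ω.coin (e + i) else 0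

/-- The output of `A` within `t` steps on `roundSource`. -/
def candidate {n : ℕ} (A : Prog) (par : List ℕ) (ω : Source n) (s t q D d e v : ℕ) :
    List (ZMod 2) :=
  (crun (fun i σ => i.step (roundSource ω s t q D d e v) σ) A t (State.init (n :: par))).2.out

/-- The parameters are in place. -/
structure Setup (n s t q D M Θ R : ℕ) (par : List ℕ) (σ : State) : Prop where
  r0 : σ.reg 0 = n
  r1 : σ.reg 1 = s
  r2 : σ.reg 2 = t
  r4 : σ.reg 4 = q
  r5 : σ.reg 5 = 1
  r6 : σ.reg 6 = 0
  r7 : σ.reg 7 = D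
  r8 : σ.reg 8 = M
  r9 : σ.reg 9 = Θ
  save : ∀ r < R, σ.reg (R + 100 + r) = (n :: par).getD r 0
  out : σ.out = []

theorem Setup.congr {n s t q D M Θ R : ℕ} {par : List ℕ} {σ τ : State}
    (h : Setup n s t q D M Θ R par σ)
    (hr : ∀ r < 2 * R + 100, r < 10 ∨ 50 ≤ r → τ.reg r = σ.reg r) (ho : τ.out = σ.out) :
    Setup n s t q D M Θ R par τ where
  r0 := (hr 0 (by omega) (by norm_num)).trans h.r0
  r1 := (hr 1 (by omega) (by norm_num)).trans h.r1
  r2 := (hr 2 (by omega) (by norm_num)).trans h.r2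
  r4 := (hr 4 (by omega) (by norm_num)).trans h.r4
  r5 := (hr 5 (by omega) (by norm_num)).trans h.r5
  r6 := (hr 6 (by omega) (by norm_num)).trans h.r6
  r7 := (hr 7 (by omega) (by norm_num)).trans h.r7
  r8 := (hr 8 (by omega) (by norm_num)).trans h.r8
  r9 := (hr 9 (by omega) (by norm_num)).trans h.r9
  save r hr' := (hr _ (by omega) (by omega)).trans (h.save r hr')
  out := ho.trans h.out

theorem Setup.of_frame {n s t q D M Θ R : ℕ} {par : List ℕ} {σ τ : State} {As : List ℕ}
    (h : Setup n s t q D M Θ R par σ) (hf : Frame As σ τ) (ho : τ.out = σ.out) :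
    Setup n s t q D M Θ R par τ :=
  h.congr (fun r _ hr' => hf.reg r (by omega)) ho

/-- The arrays hold the examples for the tests (the first `M` ones), those of the current round (from
number `d` on), and the random bits of the current round (from number `e` on). -/
structure RoundData {n : ℕ} (ω : Source n) (s t M d e : ℕ) (σ : State) : Prop where
  testPoint : ∀ i < M, ∀ j : Fin n, σ.mem 0 ((i + 1) * n + j) = (ω.point i j).val
  testLab : ∀ i < M, σ.mem 1 (i + 1) = (ω.lab i).val
  point : ∀ i < s, ∀ j : Fin n, σ.mem 2 ((i + 1) * n + j) = (ω.point (d + i) j).val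
  point_zero : ∀ p, p < n ∨ (s + 1) * n ≤ p → σ.mem 2 p = 0
  lab : ∀ i < s, σ.mem 3 (i + 1) = (ω.lab (d + i)).val
  lab_zero : σ.mem 3 0 = 0
  corr_zero : ∀ p, s + 1 ≤ p → σ.mem 4 p = 0
  coin : ∀ i < t, σ.mem 5 i = (ω.coin (e + i)).val
  coin_zero : ∀ i, t ≤ i → σ.mem 5 i = 0

/-- Start the learner on the parameters saved. -/
def resetLearner (R : ℕ) : Prog :=
  blk (.add 13 2 6) ([.const 16 0, .const 17 0, .const 18 0, .const 19 0] ++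
    copyRegs (2 * R + 100) (fun r => R + 100 + r) 6 R)

theorem resetLearner_runs {n s t q D M Θ R : ℕ} {par : List ℕ} (ω : Source n) (σ : State)
    (hs : Setup n s t q D M Θ R par σ) :
    Runs ω (resetLearner R) σ (R + 5) fun τ =>
      (∀ r < R, τ.reg (2 * R + 100 + r) = (n :: par).getD r 0) ∧ τ.reg 13 = t ∧
      τ.reg 16 = 0 ∧ τ.reg 17 = 0 ∧ τ.reg 18 = 0 ∧ τ.reg 19 = 0 ∧
      (∀ r < 2 * R + 100, r < 13 ∨ 50 ≤ r → τ.reg r = σ.reg r) ∧ τ.mem = σ.mem ∧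
      τ.draws = σ.draws ∧ τ.flips = σ.flips ∧ τ.out = σ.out := by
  refine (Runs.blk ?_).mono (by simp [length_copyRegs]) fun _ h => h
  rw [steps, steps_append]
  set σ₁ := steps ω [.const 16 0, .const 17 0, .const 18 0, .const 19 0]
    (Instr.step ω σ (.add 13 2 6)) with hσ
  have e : ∀ r, r < 13 ∨ 50 ≤ r → σ₁.reg r = σ.reg r := fun r hr => by
    simp only [hσ, steps, Instr.step_const, Instr.step_add, State.set_reg]
    repeat rw [if_neg (by omega)]
  obtain ⟨h1, h2, h3, h4, h5, h6⟩ := steps_copyRegs ω (2 * R + 100) (fun r => R + 100 + r) 6 R σ₁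
    ((e 6 (by norm_num)).trans hs.r6) (by omega) (fun r hr => by omega)
  refine ⟨fun r hr => ?_, ?_, ?_, ?_, ?_, ?_, fun r hr hr' => ?_, h3, h4, h5, h6⟩
  · rw [h1 r hr, e _ (by omega)]; exact hs.save r hr
  · rw [h2 _ (by omega)]; simp [hσ, steps, hs.r2, hs.r6]
  · rw [h2 _ (by omega)]; simp [hσ, steps]
  · rw [h2 _ (by omega)]; simp [hσ, steps]
  · rw [h2 _ (by omega)]; simp [hσ, steps]
  · rw [h2 _ (by omega)]; simp [hσ, steps]
  · rw [h2 _ (by omega), e r hr']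

/-- All stamps are strictly older than the current one, so whatever earlier runs left in the arrays
represents an empty memory, and the run starts from the initial state of the learner without any
cleaning. -/
theorem simStored_runs {n : ℕ} (ω : Source n) {src : Source n} (A : Prog) (par : List ℕ) (t b : ℕ)
    (hb : 50 ≤ b) (σ : State) (hd : StoredData src σ)
    (hr : ∀ r < A.bound, σ.reg (b + r) = (n :: par).getD r 0) (h13 : σ.reg 13 = t)
    (h16 : σ.reg 16 = 0) (h17 : σ.reg 17 = 0) (h18 : σ.reg 18 = 0) (h19 : σ.reg 19 = 0)
    (hst : ∀ a p, σ.mem (11 + 2 * a) p < σ.reg 11) :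
    Runs ω (simProg b (trStored b) A) σ (simCost 5 A * (t + 1)) fun τ =>
      StoredRel n b A.bound σ τ (crun (fun i σ => i.step src σ) A t (State.init (n :: par))).2 := by
  have hrel : StoredRel n b A.bound σ σ (State.init (n :: par)) :=
    ⟨hr, fun _ _ _ => rfl, fun _ _ _ => rfl, fun a p => (hst a p).le,
      fun a p => by rw [if_neg (hst a p).ne]; rfl, ⟨rfl, rfl, rfl⟩, h16, by simpa [State.init] using h17,
      h18, h19, fun i hi => absurd hi (by simp [State.init])⟩
  obtain ⟨c, τ, he, hτ, _, hc⟩ := simProg_correct ω (fun i σ => i.step src σ) b A.bound 5 (trStored b)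
    (StoredRel n b A.bound σ)
    (fun _ _ h => (h.keep 5 (by omega) (by norm_num)).trans hd.one)
    (fun _ _ h => (h.keep 6 (by omega) (by norm_num)).trans hd.zero)
    (fun _ _ h => h.regs) (fun _ _ h r v h1 h2 => h.set_scratch hb r v h1 (Or.inl h2))
    (fun i hi σ' σ h => trStored_correct ω hd hb i hi σ' σ h) A le_rfl t σ _ hrel h13
  exact ⟨c, τ, he, (Nat.le_add_right _ _).trans hc, hτ⟩

/-- Store the vector in array `7` in array `8` if it has length `reg 0` and its score, in register `29`, is
at most `reg 9`. -/
def recordCandidate : Prog :=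
  .seq (blk (.sub 26 19 0) [.sub 27 0 19, .add 26 26 27, .sub 27 29 9, .add 26 26 27])
    (.ite 26 (.instr (.const 15 0)) (copyArray 7 8 0))

theorem recordCandidate_runs {n : ℕ} (ω : Source n) (σ : State) (h5 : σ.reg 5 = 1)
    (h6 : σ.reg 6 = 0) :
    Runs ω recordCandidate σ (σ.reg 0 * 5 + 9) fun τ => Frame [8] σ τ ∧
      τ.draws = σ.draws ∧ τ.flips = σ.flips ∧ τ.out = σ.out ∧
      (σ.reg 19 = σ.reg 0 → σ.reg 29 ≤ σ.reg 9 → ∀ i < σ.reg 0, τ.mem 8 i = σ.mem 7 i) ∧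
      (¬ (σ.reg 19 = σ.reg 0 ∧ σ.reg 29 ≤ σ.reg 9) → τ.mem 8 = σ.mem 8) := by
  refine (Runs.seq (B := 5) (B' := σ.reg 0 * 5 + 4) (Q := fun υ => Frame [8] σ υ ∧
    υ.draws = σ.draws ∧ υ.flips = σ.flips ∧ υ.out = σ.out ∧ υ.mem = σ.mem ∧
    υ.reg 26 = σ.reg 19 - σ.reg 0 + (σ.reg 0 - σ.reg 19) + (σ.reg 29 - σ.reg 9))
    (Runs.blk ?_) ?_).mono (by omega) fun _ h => h
  · refine ⟨⟨fun r hr => ?_, fun a ha => ?_⟩, rfl, rfl, rfl, rfl, ?_⟩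
    · simp only [steps, Instr.step_sub, Instr.step_add, State.set_reg]
      repeat rw [if_neg (by omega)]
    · simp [steps]
    · simp [steps]
  · rintro υ ⟨hf, hdr, hfl, hout, hm, h26⟩
    have h0 := hf.reg 0 (by norm_num)
    refine (Runs.ite (B := 1) (B' := σ.reg 0 * 5 + 3) (fun hne => Runs.instr ?_)
      (fun he => (copyArray_runs ω (by norm_num) υ ((hf.reg 5 (by norm_num)).trans h5)
        ((hf.reg 6 (by norm_num)).trans h6)).mono (by rw [h0]) ?_)).mono (by omega) fun _ h => h
    · refine ⟨hf.of_eq (fun r hr => ?_) fun _ _ => rfl, hdr, hfl, hout, fun h1 h2 => ?_, fun _ => ?_⟩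
      · rw [Instr.step_const, State.set_reg, if_neg (by omega)]
      · omega
      · rw [Instr.step_const, State.set_mem, hm]
    · rintro τ ⟨gf, gdr, gfl, gout, gm, gm'⟩
      refine ⟨hf.trans gf, gdr.trans hdr, gfl.trans hfl, gout.trans hout, fun _ _ i hi => ?_,
        fun h => absurd ?_ h⟩
      · rw [gm i (by omega), hm]
      · omega

/-- Process one word. -/
def wordBody (A : Prog) : Prog :=
  .seq (.instr (.add 11 11 5)) (.seq correctLabels (.seq (resetLearner A.bound)
    (.seq (simProg (2 * A.bound + 100) (trStored (2 * A.bound + 100)) A) (.seq testCandidate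
      (.seq recordCandidate (.seq nextWord (.instr (.sub 12 5 27))))))))

/-- The time for one word. -/
def wordCost (A : Prog) (n s t D M : ℕ) : ℕ :=
  1 + (s * 5 + D * 14 + 13 + (A.bound + 5 + (simCost 5 A * (t + 1) + (M * (n * 9 + 7 + 1) + 5 +
    (n * 5 + 9 + (D * 9 + 4 + 1))))))

/-- The last two clauses say that array `8` is overwritten by a candidate that passes the test and
is left alone otherwise. Array `8` may hold a wrong vector here; that this does no harm is argued
for the loop as a whole. -/
theorem wordBody_runs {n s t q D M Θ d e v : ℕ} {par : List ℕ} (A : Prog) (ω : Source n) (σ : State)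
    (hs : Setup n s t q D M Θ A.bound par σ) (hd : RoundData ω s t M d e σ)
    (hst : ∀ a p, σ.mem (11 + 2 * a) p ≤ σ.reg 11)
    (hdig : ∀ j < D, σ.mem 6 j = v / (q + 1) ^ j % (q + 1)) :
    Runs ω (wordBody A) σ (wordCost A n s t D M) fun τ =>
      Setup n s t q D M Θ A.bound par τ ∧ RoundData ω s t M d e τ ∧
      (∀ a p, τ.mem (11 + 2 * a) p ≤ τ.reg 11) ∧
      (∀ j < D, τ.mem 6 j = (v + 1) / (q + 1) ^ j % (q + 1)) ∧ τ.reg 10 = σ.reg 10 ∧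
      τ.reg 12 = (if (q + 1) ^ D ∣ v + 1 then 0 else 1) ∧
      τ.draws = σ.draws ∧ τ.flips = σ.flips ∧
      (∀ y : Fin n → ZMod 2, candidate A par ω s t q D d e v = List.ofFn y →
        score ω.point ω.lab M y ≤ Θ → ∀ j : Fin n, τ.mem 8 j = (y j).val) ∧
      ((¬ ∃ y : Fin n → ZMod 2, candidate A par ω s t q D d e v = List.ofFn y ∧
        score ω.point ω.lab M y ≤ Θ) → ∀ j < n, τ.mem 8 j = σ.mem 8 j) := by
  refine Runs.seq (B := 1) (Q := fun υ => υ = σ.set 11 (σ.reg 11 + 1))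
    (Runs.instr (by simp [hs.r5])) ?_
  rintro _ rfl
  have s1 : Setup n s t q D M Θ A.bound par (σ.set 11 (σ.reg 11 + 1)) :=
    hs.congr (fun r _ hr => by rw [State.set_reg, if_neg (by omega)]) rfl
  refine Runs.seq (correctLabels_runs ω (σ.set 11 (σ.reg 11 + 1)) (fun i => ω.lab (d + i)) s1.r1
    s1.r4 s1.r5 s1.r6 s1.r7 hdig hd.lab hd.lab_zero) ?_
  rintro σ₂ ⟨f2, dr2, fl2, o2, m20, m2, m2'⟩
  have s2 := s1.of_frame f2 o2
  have e11 : σ₂.reg 11 = σ.reg 11 + 1 := by rw [f2.reg 11 (by norm_num)]; simp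
  have m2a : ∀ a, a ≠ 4 → σ₂.mem a = σ.mem a := fun a ha => f2.mem a (by simpa using ha)
  refine Runs.seq (resetLearner_runs ω σ₂ s2) ?_
  rintro σ₃ ⟨r3, r13, r16, r17, r18, r19, k3, m3, dr3, fl3, o3⟩
  have s3 : Setup n s t q D M Θ A.bound par σ₃ :=
    s2.congr (fun r hr hr' => k3 r hr (by omega)) o3
  have e11' : σ₃.reg 11 = σ.reg 11 + 1 := (k3 11 (by omega) (by norm_num)).trans e11
  -- The learner may request more than `s` examples or flip more than `t` coins when its labels are
  -- wrong. It then reads cells that were never written, whence the zeros in `roundSource`.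
  have sd : StoredData (roundSource ω s t q D d e v) σ₃ := by
    refine ⟨s3.r0, s3.r5, s3.r6, fun i j => ?_, fun p hp => ?_, fun i => ?_, ?_, fun i => ?_⟩
    · rw [m3, m2a 2 (by norm_num)]
      by_cases hi : i < s
      · simp only [roundSource, if_pos hi]
        exact hd.point i hi j
      · simp only [roundSource, if_neg hi]
        rw [hd.point_zero _ (Or.inr ?_), Pi.zero_apply, ZMod.val_zero]
        exact (Nat.mul_le_mul_right n (by omega)).trans (Nat.le_add_right _ _)
    · rw [m3, m2a 2 (by norm_num)]
      exact hd.point_zero p (Or.inl hp)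
    · rw [m3]
      by_cases hi : i < s
      · simp only [roundSource, if_pos hi]
        exact m2 i hi
      · simp only [roundSource, if_neg hi]
        rw [m2' _ (by omega), ZMod.val_zero]
        exact hd.corr_zero _ (by omega)
    · rw [m3, m20]
    · rw [m3, m2a 5 (by norm_num)]
      by_cases hi : i < t
      · simp only [roundSource, if_pos hi]
        exact hd.coin i hi
      · simp only [roundSource, if_neg hi]
        rw [hd.coin_zero i (by omega), ZMod.val_zero]
  refine Runs.seq (simStored_runs ω A par t (2 * A.bound + 100) (by omega) σ₃ sd r3 r13 r16 r17 r18
    r19 fun a p => ?_) ?_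
  -- The stamp was increased at the beginning of the body, so all old stamps are now strictly
  -- smaller.
  · rw [e11', m3, m2a _ (by omega)]
    exact Nat.lt_succ_of_le (hst a p)
  intro σ₄ h4
  have s4 : Setup n s t q D M Θ A.bound par σ₄ :=
    s3.congr (fun r hr hr' => h4.keep r hr (by omega)) h4.io.2.2
  have m4a : ∀ a < 10, a ≠ 4 → a ≠ 7 → σ₄.mem a = σ.mem a := fun a ha h1 h2 => by
    rw [h4.arr a ha h2, m3, m2a a h1]
  refine Runs.seq (testCandidate_runs ω σ₄ ω.point ω.lab s4.r0 s4.r5 s4.r6 s4.r8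
    (by rw [m4a 0 (by norm_num) (by norm_num) (by norm_num)]; exact hd.testPoint)
    (by rw [m4a 1 (by norm_num) (by norm_num) (by norm_num)]; exact hd.testLab)) ?_
  rintro σ₅ ⟨f5, dr5, fl5, o5, e19, e29⟩
  have s5 := s4.of_frame f5 o5
  refine Runs.seq ((recordCandidate_runs ω σ₅ s5.r5 s5.r6).mono (by rw [s5.r0]) fun _ h => h) ?_
  rintro σ₆ ⟨f6, dr6, fl6, o6, m6, m6'⟩
  have s6 := s5.of_frame f6 o6
  have m6a : ∀ a < 10, a ≠ 4 → a ≠ 7 → a ≠ 8 → σ₆.mem a = σ.mem a := fun a ha h1 h2 h3 => by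
    rw [f6.mem a (by simpa using h3), f5.mem a (by simp), m4a a ha h1 h2]
  refine Runs.seq (nextWord_runs (v := v) ω σ₆ s6.r4 s6.r5 s6.r6 s6.r7
    (by rw [m6a 6 (by norm_num) (by norm_num) (by norm_num) (by norm_num)]; exact hdig)) ?_
  rintro σ₇ ⟨f7, dr7, fl7, o7, e27, m7⟩
  have s7 := s6.of_frame f7 o7
  refine Runs.instr ?_
  rw [Instr.step_sub, s7.r5, e27]
  have m7a : ∀ a < 10, a ≠ 4 → a ≠ 6 → a ≠ 7 → a ≠ 8 → σ₇.mem a = σ.mem a :=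
    fun a ha h1 h2 h3 h4 => by rw [f7.mem a (by simpa using h2), m6a a ha h1 h3 h4]
  have e7r : ∀ r < 13, σ₇.reg r = σ₄.reg r := fun r hr => by
    rw [f7.reg r (by omega), f6.reg r (by omega), f5.reg r (by omega)]
  have e4r : ∀ r < 13, σ₄.reg r = (σ.set 11 (σ.reg 11 + 1)).reg r := fun r hr => by
    rw [h4.keep r (by omega) (by omega), k3 r (by omega) (by omega), f2.reg r (by omega)]
  have e78 : σ₇.mem 8 = σ₆.mem 8 := f7.mem 8 (by simp)
  have e58 : σ₅.mem 8 = σ.mem 8 := by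
    rw [f5.mem 8 (by simp), m4a 8 (by norm_num) (by norm_num) (by norm_num)]
  have e57 : σ₅.mem 7 = σ₄.mem 7 := f5.mem 7 (by simp)
  refine ⟨s7.congr (fun r _ hr => by rw [State.set_reg, if_neg (by omega)]) rfl, ⟨?_, ?_, ?_, ?_, ?_,
    ?_, ?_, ?_, ?_⟩, fun a p => ?_, m7, ?_, ?_, ?_, ?_, fun y hy hsc j => ?_, fun hno j hj => ?_⟩
  · rw [State.set_mem, m7a 0 (by norm_num) (by norm_num) (by norm_num) (by norm_num) (by norm_num)]
    exact hd.testPoint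
  · rw [State.set_mem, m7a 1 (by norm_num) (by norm_num) (by norm_num) (by norm_num) (by norm_num)]
    exact hd.testLab
  · rw [State.set_mem, m7a 2 (by norm_num) (by norm_num) (by norm_num) (by norm_num) (by norm_num)]
    exact hd.point
  · rw [State.set_mem, m7a 2 (by norm_num) (by norm_num) (by norm_num) (by norm_num) (by norm_num)]
    exact hd.point_zero
  · rw [State.set_mem, m7a 3 (by norm_num) (by norm_num) (by norm_num) (by norm_num) (by norm_num)]
    exact hd.lab
  · rw [State.set_mem, m7a 3 (by norm_num) (by norm_num) (by norm_num) (by norm_num) (by norm_num)]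
    exact hd.lab_zero
  · intro p hp
    rw [State.set_mem, f7.mem 4 (by simp), f6.mem 4 (by simp), f5.mem 4 (by simp),
      h4.arr 4 (by norm_num) (by norm_num), m3, m2' p hp]
    exact hd.corr_zero p hp
  · rw [State.set_mem, m7a 5 (by norm_num) (by norm_num) (by norm_num) (by norm_num) (by norm_num)]
    exact hd.coin
  · rw [State.set_mem, m7a 5 (by norm_num) (by norm_num) (by norm_num) (by norm_num) (by norm_num)]
    exact hd.coin_zero
  · rw [State.set_mem, f7.mem _ (by simp; omega), f6.mem _ (by simp; omega),
      f5.mem _ (by simp), State.set_reg, if_neg (by norm_num), e7r 11 (by norm_num),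
      e4r 11 (by norm_num)]
    have := h4.stamp a p
    rw [e11'] at this
    simpa using this
  · rw [State.set_reg, if_neg (by norm_num), e7r 10 (by norm_num), e4r 10 (by norm_num)]
    simp
  · rw [State.set_reg, if_pos rfl]
    split_ifs <;> rfl
  · rw [State.set_draws, dr7, dr6, dr5, h4.io.1, dr3, dr2, State.set_draws]
  · rw [State.set_flips, fl7, fl6, fl5, h4.io.2.1, fl3, fl2, State.set_flips]
  · have hlen := h4.len
    have hval := h4.out
    rw [show (crun _ A t (State.init (n :: par))).2.out = List.ofFn y from hy] at hlen hval
    rw [List.length_ofFn] at hlen hval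
    have hy7 : ∀ j : Fin n, σ₄.mem 7 j = (y j).val := fun j => by
      rw [hval j j.2, List.getD_eq_getElem _ _ (by simp), List.getElem_ofFn]
    rw [State.set_mem, e78, m6 (by rw [e19, hlen, s5.r0]) (by rw [e29 y hy7, s5.r9]; exact hsc) j
      (by rw [s5.r0]; exact j.2), e57, hy7]
  · rw [State.set_mem, e78, m6' ?_, e58]
    rintro ⟨hl, hsc⟩
    rw [e19, s5.r0, h4.len] at hl
    -- A list of length `n` is the list of a vector, so a recorded output would contradict the
    -- assumption that no candidate passes.
    refine hno ⟨fun j => (candidate A par ω s t q D d e v).getD j 0, ?_, ?_⟩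
    · refine List.ext_getElem (by rw [List.length_ofFn]; exact hl) fun i h1 h2 => ?_
      rw [List.getElem_ofFn, List.getD_eq_getElem _ _ h1]
    · rw [← e29 _ fun j => ?_]
      · rwa [s5.r9] at hsc
      · exact h4.out j (by rw [hl]; exact j.2)

/-! ### The loop over the words, and a round -/

/-- The vector `x` is output by the learner for some word in one of the first `r` rounds. -/
def Found {n : ℕ} (A : Prog) (par : List ℕ) (ω : Source n) (s t q D M r : ℕ)
    (x : Fin n → ZMod 2) : Prop :=
  ∃ r' < r, ∃ v < (q + 1) ^ D, candidate A par ω s t q D (M + r' * s) (r' * t) v = List.ofFn x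

/-- The vector `x` passes the test, and no other vector that the learner outputs in one of the first `r`
rounds does. -/
def OnlyPasses {n : ℕ} (A : Prog) (par : List ℕ) (ω : Source n) (s t q D M Θ r : ℕ)
    (x : Fin n → ZMod 2) : Prop :=
  score ω.point ω.lab M x ≤ Θ ∧ ∀ y : Fin n → ZMod 2, Found A par ω s t q D M r y →
    score ω.point ω.lab M y ≤ Θ → y = x

/-- `OnlyPasses` is stated for all `N` rounds and stays fixed, while `Found` grows with the words
processed. Under the former, whatever passes is `x` itself, so array `8` holds `x` from the first
time it is found. -/
theorem wordLoop_runs {n s t q D M Θ N r : ℕ} {par : List ℕ} (A : Prog) (ω : Source n)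
    (σ : State) (hrN : r < N)
    (hs : Setup n s t q D M Θ A.bound par σ) (hd : RoundData ω s t M (M + r * s) (r * t) σ)
    (hst : ∀ a p, σ.mem (11 + 2 * a) p ≤ σ.reg 11) (hdig : ∀ j < D, σ.mem 6 j = 0)
    (h12 : σ.reg 12 = 1)
    (hbest : ∀ x : Fin n → ZMod 2, OnlyPasses A par ω s t q D M Θ N x →
      Found A par ω s t q D M r x → ∀ j : Fin n, σ.mem 8 j = (x j).val) :
    Runs ω (.loop 12 (wordBody A)) σ ((q + 1) ^ D * (wordCost A n s t D M + 1) + 1) fun τ =>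
      Setup n s t q D M Θ A.bound par τ ∧ RoundData ω s t M (M + r * s) (r * t) τ ∧
      (∀ a p, τ.mem (11 + 2 * a) p ≤ τ.reg 11) ∧ τ.reg 10 = σ.reg 10 ∧
      τ.draws = σ.draws ∧ τ.flips = σ.flips ∧
      ∀ x : Fin n → ZMod 2, OnlyPasses A par ω s t q D M Θ N x →
        Found A par ω s t q D M (r + 1) x → ∀ j : Fin n, τ.mem 8 j = (x j).val := by
  let Inv : ℕ → State → Prop := fun k τ => ∃ v, v + k = (q + 1) ^ D ∧
    τ.reg 12 = (if k = 0 then 0 else 1) ∧ (∀ j < D, τ.mem 6 j = v / (q + 1) ^ j % (q + 1)) ∧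
    Setup n s t q D M Θ A.bound par τ ∧ RoundData ω s t M (M + r * s) (r * t) τ ∧
      (∀ a p, τ.mem (11 + 2 * a) p ≤ τ.reg 11) ∧ τ.reg 10 = σ.reg 10 ∧
      τ.draws = σ.draws ∧ τ.flips = σ.flips ∧
      ∀ x : Fin n → ZMod 2, OnlyPasses A par ω s t q D M Θ N x →
        (Found A par ω s t q D M r x ∨ ∃ v' < v,
          candidate A par ω s t q D (M + r * s) (r * t) v' = List.ofFn x) →
        ∀ j : Fin n, τ.mem 8 j = (x j).val
  have hpos : 0 < (q + 1) ^ D := Nat.pow_pos (Nat.succ_pos q)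
  refine (Runs.loop Inv (B := wordCost A n s t D M) ?_ ?_ ((q + 1) ^ D) σ ?_).mono le_rfl ?_
  · rintro τ ⟨v, _, h, _⟩
    simpa using h
  · rintro k τ ⟨v, hv, g12, gdig, gs, gd, gst, g10, gdr, gfl, gb⟩
    rw [if_neg (Nat.succ_ne_zero k)] at g12
    refine ⟨by omega, (wordBody_runs A ω τ gs gd gst gdig).mono le_rfl ?_⟩
    rintro υ ⟨us, ud, ust, udig, u10, u12, udr, ufl, ub, ub'⟩
    refine ⟨v + 1, by omega, ?_, udig, us, ud, ust, u10.trans g10, udr.trans gdr, ufl.trans gfl,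
      fun x hx hf j => ?_⟩
    · rw [u12]
      -- For `v < (q + 1) ^ D` the carry means `v + 1 = (q + 1) ^ D`, so the loop ends exactly after
      -- the last word.
      by_cases hk : k = 0
      · rw [if_pos hk, if_pos]
        rw [← hv, hk]
      · rw [if_neg hk, if_neg]
        intro hdvd
        have := Nat.le_of_dvd (Nat.succ_pos v) hdvd
        omega
    · by_cases hp : ∃ y : Fin n → ZMod 2,
        candidate A par ω s t q D (M + r * s) (r * t) v = List.ofFn y ∧
          score ω.point ω.lab M y ≤ Θ
      · obtain ⟨y, hy, hy'⟩ := hp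
        -- A passing candidate can only overwrite array `8` with `x`.
        have := hx.2 y ⟨r, hrN, v, by omega, hy⟩ hy'
        rw [ub y hy hy' j, this]
      · rw [ub' hp j j.2]
        refine gb x hx ?_ j
        rcases hf with hf | ⟨v', hv', hc⟩
        · exact Or.inl hf
        · refine Or.inr ⟨v', ?_, hc⟩
          by_contra hlt
          obtain rfl : v' = v := by omega
          exact hp ⟨x, hc, hx.1⟩
  · refine ⟨0, by simp, by rw [h12, if_neg hpos.ne'], fun j hj => by simp [hdig j hj], hs, hd, hst,
      rfl, rfl, rfl, fun x hx hf => hbest x hx ?_⟩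
    rcases hf with hf | ⟨v', hv', _⟩
    · exact hf
    · omega
  · rintro τ ⟨v, hv, g12, gdig, gs, gd, gst, g10, gdr, gfl, gb⟩
    refine ⟨gs, gd, gst, g10, gdr, gfl, fun x hx hf => gb x hx ?_⟩
    obtain ⟨r', hr', v', hv', hc⟩ := hf
    by_cases hrr : r' = r
    · exact Or.inr ⟨v', by omega, hrr ▸ hc⟩
    · exact Or.inl ⟨r', by omega, v', hv', hc⟩

/-- The state of the arrays between two rounds. -/
structure BetweenRounds {n : ℕ} (ω : Source n) (s t M : ℕ) (σ : State) : Prop where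
  testPoint : ∀ i < M, ∀ j : Fin n, σ.mem 0 ((i + 1) * n + j) = (ω.point i j).val
  testLab : ∀ i < M, σ.mem 1 (i + 1) = (ω.lab i).val
  point_zero : ∀ p, p < n ∨ (s + 1) * n ≤ p → σ.mem 2 p = 0
  lab_zero : σ.mem 3 0 = 0
  corr_zero : ∀ p, s + 1 ≤ p → σ.mem 4 p = 0
  coin_zero : ∀ i, t ≤ i → σ.mem 5 i = 0
  stamp : ∀ a p, σ.mem (11 + 2 * a) p ≤ σ.reg 11

/-- One round. -/
def roundBody (A : Prog) : Prog :=
  .seq (storeExamples 2 3 1) (.seq storeCoins (.seq clearDigits (.seq (.instr (.const 12 1))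
    (.seq (.loop 12 (wordBody A)) (.instr (.sub 10 10 5))))))

/-- The time for one round. -/
def roundCost (A : Prog) (n s t q D M : ℕ) : ℕ :=
  s * (n * 6 + 8 + 1) + 4 + (t * 5 + 3 + (D * 4 + 3 + (1 +
    ((q + 1) ^ D * (wordCost A n s t D M + 1) + 1 + 1))))

theorem roundBody_runs {n s t q D M Θ N r : ℕ} {par : List ℕ} (A : Prog) (ω : Source n)
    (σ : State) (hrN : r < N)
    (hs : Setup n s t q D M Θ A.bound par σ) (hd : BetweenRounds ω s t M σ)
    (hdr : σ.draws = M + r * s) (hfl : σ.flips = r * t)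
    (hbest : ∀ x : Fin n → ZMod 2, OnlyPasses A par ω s t q D M Θ N x →
      Found A par ω s t q D M r x → ∀ j : Fin n, σ.mem 8 j = (x j).val) :
    Runs ω (roundBody A) σ (roundCost A n s t q D M) fun τ =>
      Setup n s t q D M Θ A.bound par τ ∧ BetweenRounds ω s t M τ ∧ τ.reg 10 = σ.reg 10 - 1 ∧
      τ.draws = M + (r + 1) * s ∧ τ.flips = (r + 1) * t ∧
      ∀ x : Fin n → ZMod 2, OnlyPasses A par ω s t q D M Θ N x →
        Found A par ω s t q D M (r + 1) x → ∀ j : Fin n, τ.mem 8 j = (x j).val := by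
  refine Runs.seq (storeExamples_runs ω (by norm_num) σ hs.r0 hs.r5 hs.r6 hs.r1) ?_
  rintro σ₁ ⟨f1, dr1, fl1, o1, h1⟩
  rw [hdr] at h1
  have s1 := hs.of_frame f1 o1
  refine Runs.seq ((storeCoins_runs ω σ₁ s1.r5 s1.r6).mono (by rw [s1.r2]) fun _ h => h) ?_
  rintro σ₂ ⟨f2, dr2, fl2, o2, m2, m2'⟩
  rw [s1.r2, fl1, hfl] at m2
  rw [s1.r2] at m2' fl2
  have s2 := s1.of_frame f2 o2
  refine Runs.seq ((clearDigits_runs ω σ₂ s2.r5 s2.r6).mono (by rw [s2.r7]) fun _ h => h) ?_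
  rintro σ₃ ⟨f3, dr3, fl3, o3, m3⟩
  have s3 := s2.of_frame f3 o3
  rw [s2.r7] at m3
  refine Runs.seq (B := 1) (Q := fun υ => υ = σ₃.set 12 1) (Runs.instr rfl) ?_
  rintro _ rfl
  have s4 : Setup n s t q D M Θ A.bound par (σ₃.set 12 1) :=
    s3.congr (fun r _ hr => by rw [State.set_reg, if_neg (by omega)]) rfl
  have ma : ∀ a, a ≠ 2 → a ≠ 3 → a ≠ 5 → a ≠ 6 → σ₃.mem a = σ.mem a := fun a h1 h2 h3 h4 => by
    rw [f3.mem a (by simpa using h4), f2.mem a (by simpa using h3),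
      f1.mem a (by simp; exact ⟨h1, h2⟩)]
  have m3a : ∀ a, a ≠ 5 → a ≠ 6 → σ₃.mem a = σ₁.mem a := fun a h3 h4 => by
    rw [f3.mem a (by simpa using h4), f2.mem a (by simpa using h3)]
  have m35 : σ₃.mem 5 = σ₂.mem 5 := f3.mem 5 (by simp)
  have er : ∀ r < 13, σ₃.reg r = σ.reg r := fun r hr => by
    rw [f3.reg r (by omega), f2.reg r (by omega), f1.reg r (by omega)]
  refine Runs.seq (wordLoop_runs A ω (σ₃.set 12 1) hrN s4 ⟨?_, ?_, ?_, ?_, ?_, ?_, ?_, ?_, ?_⟩ ?_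
    m3 (by simp) ?_) ?_
  · rw [State.set_mem, ma 0 (by norm_num) (by norm_num) (by norm_num) (by norm_num)]
    exact hd.testPoint
  · rw [State.set_mem, ma 1 (by norm_num) (by norm_num) (by norm_num) (by norm_num)]
    exact hd.testLab
  · rw [State.set_mem, m3a 2 (by norm_num) (by norm_num)]
    exact h1.point
  · intro p hp
    rw [State.set_mem, m3a 2 (by norm_num) (by norm_num), h1.point_else p hp]
    exact hd.point_zero p hp
  · rw [State.set_mem, m3a 3 (by norm_num) (by norm_num)]
    exact h1.lab
  · rw [State.set_mem, m3a 3 (by norm_num) (by norm_num), h1.lab_else 0 (Or.inl rfl)]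
    exact hd.lab_zero
  · rw [State.set_mem, ma 4 (by norm_num) (by norm_num) (by norm_num) (by norm_num)]
    exact hd.corr_zero
  · rw [State.set_mem, m35]
    exact m2
  · intro i hi
    rw [State.set_mem, m35, m2' i hi, f1.mem 5 (by simp)]
    exact hd.coin_zero i hi
  · intro a p
    rw [State.set_mem, ma _ (by omega) (by omega) (by omega) (by omega), State.set_reg,
      if_neg (by norm_num), er 11 (by norm_num)]
    exact hd.stamp a p
  · rw [State.set_mem, ma 8 (by norm_num) (by norm_num) (by norm_num) (by norm_num)]
    exact hbest
  · rintro τ ⟨gs, gd, gst, g10, gdr, gfl, gb⟩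
    refine Runs.instr ?_
    rw [Instr.step_sub, gs.r5, g10]
    refine ⟨gs.congr (fun r _ hr => by rw [State.set_reg, if_neg (by omega)]) rfl,
      ⟨gd.testPoint, gd.testLab, gd.point_zero, gd.lab_zero, gd.corr_zero, gd.coin_zero, ?_⟩, ?_,
      ?_, ?_, gb⟩
    · intro a p
      rw [State.set_reg, if_neg (by norm_num)]
      exact gst a p
    · simp [er 10 (by norm_num)]
    · rw [State.set_draws, gdr, State.set_draws, dr3, dr2, dr1, hdr]; ring
    · rw [State.set_flips, gfl, State.set_flips, fl3, fl2, fl1, hfl]; ring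

theorem roundLoop_runs {n s t q D M Θ N : ℕ} {par : List ℕ} (A : Prog) (ω : Source n)
    (σ : State) (hs : Setup n s t q D M Θ A.bound par σ) (hd : BetweenRounds ω s t M σ)
    (h10 : σ.reg 10 = N) (hdr : σ.draws = M) (hfl : σ.flips = 0) :
    Runs ω (.loop 10 (roundBody A)) σ (N * (roundCost A n s t q D M + 1) + 1) fun τ =>
      Setup n s t q D M Θ A.bound par τ ∧ τ.draws = M + N * s ∧
      ∀ x : Fin n → ZMod 2, OnlyPasses A par ω s t q D M Θ N x →
        Found A par ω s t q D M N x → ∀ j : Fin n, τ.mem 8 j = (x j).val := by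
  let Inv : ℕ → State → Prop := fun k τ => ∃ r, r + k = N ∧ τ.reg 10 = k ∧
    Setup n s t q D M Θ A.bound par τ ∧ BetweenRounds ω s t M τ ∧
      τ.draws = M + r * s ∧ τ.flips = r * t ∧
      ∀ x : Fin n → ZMod 2, OnlyPasses A par ω s t q D M Θ N x →
        Found A par ω s t q D M r x → ∀ j : Fin n, τ.mem 8 j = (x j).val
  refine (Runs.loop Inv (B := roundCost A n s t q D M) ?_ ?_ N σ ?_).mono le_rfl ?_
  · rintro τ ⟨v, _, h, _⟩
    exact h
  · rintro k τ ⟨r, hr, g10, gs, gd, gdr, gfl, gb⟩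
    refine ⟨by omega, (roundBody_runs A ω τ (by omega) gs gd gdr gfl gb).mono le_rfl ?_⟩
    rintro υ ⟨us, ud, u10, udr, ufl, ub⟩
    exact ⟨r + 1, by omega, by omega, us, ud, udr, ufl, ub⟩
  · exact ⟨0, by simp, h10, hs, hd, by simp [hdr], by simp [hfl],
      fun x _ ⟨r', hr', _⟩ => absurd hr' (Nat.not_lt_zero r')⟩
  · rintro τ ⟨r, hr, g10, gs, gd, gdr, gfl, gb⟩
    obtain rfl : r = N := by omega
    exact ⟨gs, gdr, gb⟩

/-! ### Arithmetic subroutines -/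

/-- Register `22` receives the product of registers `1` and `3`. -/
def product : Prog :=
  .seq (blk (.add 21 1 6) [.const 22 0]) (.loop 21 (blk (.add 22 22 3) [.sub 21 21 5]))

theorem product_runs {n : ℕ} (ω : Source n) (σ : State) (h5 : σ.reg 5 = 1) (h6 : σ.reg 6 = 0) :
    Runs ω product σ (σ.reg 1 * 3 + 3) fun τ => Frame [] σ τ ∧ τ.mem = σ.mem ∧
      τ.draws = σ.draws ∧ τ.flips = σ.flips ∧ τ.out = σ.out ∧ τ.reg 22 = σ.reg 1 * σ.reg 3 := by
  let Inv : ℕ → State → Prop := fun k τ => ∃ j, j + k = σ.reg 1 ∧ τ.reg 21 = k ∧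
    Frame [] σ τ ∧ τ.mem = σ.mem ∧
      τ.draws = σ.draws ∧ τ.flips = σ.flips ∧ τ.out = σ.out ∧ τ.reg 22 = j * σ.reg 3
  refine (Runs.seq (Q := Inv (σ.reg 1)) (Runs.blk ?_)
    (Runs.loop Inv (B := 2) ?_ ?_ _)).mono (by simp; omega) ?_
  · refine ⟨0, by simp, by simp [steps, h6], ⟨fun r hr => ?_, ?_⟩, ?_⟩
    · simp only [steps, Instr.step_const, Instr.step_add, State.set_reg]
      repeat rw [if_neg (by omega)]
    · simp [steps]
    · simp [steps]
  · rintro τ ⟨j, _, h, _⟩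
    exact h
  · rintro k τ ⟨j, hj, h21, hf, hm, hdr, hfl, hout, h22⟩
    have e5 := (hf.reg 5 (by norm_num)).trans h5
    have e3 := hf.reg 3 (by norm_num)
    refine ⟨by omega, Runs.blk ⟨j + 1, by omega, ?_, hf.of_eq (fun r hr => ?_) fun _ _ => rfl,
      hm, hdr, hfl, hout, ?_⟩⟩
    · simp [steps, h21, e5]
    · simp only [steps, Instr.step_sub, Instr.step_add, State.set_reg]
      repeat rw [if_neg (by omega)]
    · simp [steps, h22, e3]; ring
  · rintro τ ⟨j, hj, h21, hf, hm, hdr, hfl, hout, h22⟩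
    obtain rfl : j = σ.reg 1 := by omega
    exact ⟨hf, hm, hdr, hfl, hout, h22⟩

/-- Register `7` receives the quotient of five times register `1` by register `4`. -/
def quotient : Prog :=
  .seq (blk (.const 7 0) [.add 20 1 1, .add 20 20 20, .add 20 20 1, .add 21 20 5,
    .sub 21 21 4])
    (.loop 21 (blk (.sub 20 20 4) [.add 7 7 5, .add 21 20 5, .sub 21 21 4]))

theorem quotient_runs {n : ℕ} (ω : Source n) (σ : State) (h4 : 0 < σ.reg 4) (h5 : σ.reg 5 = 1) :
    Runs ω quotient σ (5 * σ.reg 1 / σ.reg 4 * 5 + 7) fun τ =>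
      (∀ r, r ≠ 7 → r ≠ 20 → r ≠ 21 → τ.reg r = σ.reg r) ∧ τ.mem = σ.mem ∧
      τ.draws = σ.draws ∧ τ.flips = σ.flips ∧ τ.out = σ.out ∧
      τ.reg 7 = 5 * σ.reg 1 / σ.reg 4 := by
  -- Register `20` is the remainder in a division by repeated subtraction. With truncated
  -- subtraction, remainder plus one minus divisor is nonzero exactly when the divisor still fits.
  let Inv : ℕ → State → Prop := fun k τ => ∃ j, j + k = 5 * σ.reg 1 / σ.reg 4 ∧
    τ.reg 20 + j * σ.reg 4 = 5 * σ.reg 1 ∧ τ.reg 21 = τ.reg 20 + 1 - σ.reg 4 ∧ τ.reg 7 = j ∧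
    (∀ r, r ≠ 7 → r ≠ 20 → r ≠ 21 → τ.reg r = σ.reg r) ∧ τ.mem = σ.mem ∧
      τ.draws = σ.draws ∧ τ.flips = σ.flips ∧ τ.out = σ.out
  have hdm := Nat.div_add_mod (5 * σ.reg 1) (σ.reg 4)
  have hlt := Nat.mod_lt (5 * σ.reg 1) h4
  refine (Runs.seq (Q := Inv (5 * σ.reg 1 / σ.reg 4)) (Runs.blk ?_)
    (Runs.loop Inv (B := 4) ?_ ?_ _)).mono (by simp; omega) ?_
  · refine ⟨0, by simp, by simp [steps]; ring, by simp [steps, h5], by simp [steps],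
      fun r h1 h2 h3 => ?_, ?_⟩
    · simp [steps, h1, h2, h3]
    · simp [steps]
  · rintro τ ⟨j, hj, h20, h21, h7, _⟩
    have : j * σ.reg 4 = σ.reg 4 * (5 * σ.reg 1 / σ.reg 4) := by
      rw [Nat.mul_comm]; congr 1
    omega
  · rintro k τ ⟨j, hj, h20, h21, h7, hr, hm, hdr, hfl, hout⟩
    have e5 := (hr 5 (by norm_num) (by norm_num) (by norm_num)).trans h5
    have e4 := hr 4 (by norm_num) (by norm_num) (by norm_num)
    have hle : σ.reg 4 * (j + 1) ≤ σ.reg 4 * (5 * σ.reg 1 / σ.reg 4) :=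
      Nat.mul_le_mul_left _ (by omega)
    have e1 : σ.reg 4 * (j + 1) = j * σ.reg 4 + σ.reg 4 := by ring
    have e2 : (j + 1) * σ.reg 4 = j * σ.reg 4 + σ.reg 4 := by ring
    refine ⟨by omega, Runs.blk ⟨j + 1, by omega, ?_, ?_, ?_, fun r h1 h2 h3 => ?_, hm, hdr, hfl,
      hout⟩⟩
    · simp [steps, e4, e2]; omega
    · simp [steps, e4, e5]
    · simp [steps, h7, e5]
    · simp [steps, h1, h2, h3, hr r h1 h2 h3]
  · rintro τ ⟨j, hj, h20, h21, h7, hr, hm, hdr, hfl, hout⟩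
    obtain rfl : j = 5 * σ.reg 1 / σ.reg 4 := by omega
    exact ⟨hr, hm, hdr, hfl, hout, h7⟩

/-- Register `r` receives `c` times register `p`. -/
def multiple (r p c : ℕ) : Prog :=
  blk (.const r 0) (List.replicate c (.add r r p))

theorem multiple_runs {n : ℕ} (ω : Source n) (σ : State) {r p : ℕ} (hrp : p ≠ r) (c : ℕ) :
    Runs ω (multiple r p c) σ (c + 1) fun τ => τ = σ.set r (c * σ.reg p) := by
  refine (Runs.blk ?_).mono (by simp) fun _ h => h
  rw [steps, Instr.step_const]
  have : ∀ c v, steps ω (List.replicate c (.add r r p)) (σ.set r v) =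
      σ.set r (v + c * σ.reg p) := by
    intro c
    induction c with
    | zero => simp [steps]
    | succ c ih =>
      intro v
      rw [List.replicate_succ, steps]
      have : Instr.step ω (σ.set r v) (.add r r p) = σ.set r (v + σ.reg p) := by
        simp [State.set, hrp]
      rw [this, ih]
      congr 1
      ring
  rw [this, zero_add]

/-! ### The program for the noisy problem -/

/-- Save the parameters and set up the constants. -/
def prepare (R : ℕ) : Prog :=
  blk (.const (3 * R + 100) 0)
    (copyRegs (R + 100) (fun r => if r = 0 then 0 else r + 4) (3 * R + 100) R ++
      [.const 5 1, .const 6 0, .const 11 0])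

/-- Run the learner once, for at most `reg 2` steps and with at most `reg 1` examples. -/
def runOnce (A : Prog) : Prog :=
  .seq (resetLearner A.bound)
    (simProg (2 * A.bound + 100) (trDirect (2 * A.bound + 100)) A)

/-- Run the learner on corrected examples for all error patterns coded by words in several rounds, and
output a candidate that passes the test. -/
def searchErrors (A : Prog) : Prog :=
  .seq quotient (.seq (multiple 8 22 500) (.seq (multiple 9 22 200) (.seq (multiple 10 3 8)
    (.seq (storeExamples 0 1 8) (.seq (.loop 10 (roundBody A)) emitBest)))))

/-- The program for the noisy problem: depending on whether `reg 4` exceeds `c * reg 1 * reg 3`, run the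
learner just once or search for the errors. -/
def noisyProg (c : ℕ) (A : Prog) : Prog :=
  .seq (prepare A.bound) (.seq product (.seq (multiple 23 22 c) (.seq (.instr (.sub 24 4 23))
    (.ite 24 (runOnce A) (searchErrors A)))))

/-- The state after the preparation. -/
structure Prepared (n s t l q R : ℕ) (par : List ℕ) (σ : State) : Prop where
  setup : Setup n s t q (σ.reg 7) (σ.reg 8) (σ.reg 9) R par σ
  r3 : σ.reg 3 = l
  r11 : σ.reg 11 = 0
  mem : σ.mem = fun _ _ => 0
  draws : σ.draws = 0
  flips : σ.flips = 0

theorem Prepared.congr {n s t l q R : ℕ} {par : List ℕ} {σ τ : State}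
    (h : Prepared n s t l q R par σ) (hr : ∀ r, r < 7 ∨ r = 11 ∨ 50 ≤ r → τ.reg r = σ.reg r)
    (hm : τ.mem = σ.mem) (hd : τ.draws = σ.draws) (hf : τ.flips = σ.flips) (ho : τ.out = σ.out) :
    Prepared n s t l q R par τ where
  setup := ⟨(hr 0 (by norm_num)).trans h.setup.r0, (hr 1 (by norm_num)).trans h.setup.r1,
    (hr 2 (by norm_num)).trans h.setup.r2, (hr 4 (by norm_num)).trans h.setup.r4,
    (hr 5 (by norm_num)).trans h.setup.r5, (hr 6 (by norm_num)).trans h.setup.r6, rfl, rfl, rfl,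
    fun r hr' => (hr _ (by omega)).trans (h.setup.save r hr'), ho.trans h.setup.out⟩
  r3 := (hr 3 (by norm_num)).trans h.r3
  r11 := (hr 11 (by norm_num)).trans h.r11
  mem := hm.trans h.mem
  draws := hd.trans h.draws
  flips := hf.trans h.flips

theorem prepare_runs {n : ℕ} (ω : Source n) (s t l q R : ℕ) (par : List ℕ) :
    Runs ω (prepare R) (State.init (n :: s :: t :: l :: q :: par)) (R + 4)
      (Prepared n s t l q R par) := by
  set σ := State.init (n :: s :: t :: l :: q :: par) with hσ
  refine (Runs.blk ?_).mono (by simp [length_copyRegs]) fun _ h => h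
  rw [steps, steps_append, Instr.step_const]
  -- The learner expects `n :: par`, while four more parameters stand after `n`; hence the shift by
  -- `4` for `r ≠ 0`. Registers `5`, `6` and `11` may still hold parameters, so everything is saved
  -- before they become constants, and a register beyond the saved block serves as zero.
  obtain ⟨h1, h2, h3, h4, h5, h6⟩ := steps_copyRegs ω (R + 100)
    (fun r => if r = 0 then 0 else r + 4) (3 * R + 100) R (σ.set (3 * R + 100) 0) (by simp)
    (by omega) (fun r hr => by split_ifs <;> omega)
  set σ₁ := steps ω (copyRegs (R + 100) (fun r => if r = 0 then 0 else r + 4) (3 * R + 100) R)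
    (σ.set (3 * R + 100) 0)
  have h2' : ∀ i < 100, σ₁.reg i = σ.reg i := fun i hi => by
    rw [h2 i (by omega), State.set_reg, if_neg (by omega)]
  refine ⟨⟨?_, ?_, ?_, ?_, ?_, ?_, rfl, rfl, rfl, fun r hr => ?_, ?_⟩, ?_, ?_, ?_, ?_, ?_⟩
  · simp [steps, h2' 0]; simp [hσ, State.init]
  · simp [steps, h2' 1]; simp [hσ, State.init]
  · simp [steps, h2' 2]; simp [hσ, State.init]
  · simp [steps, h2' 4]; simp [hσ, State.init]
  · simp [steps]
  · simp [steps]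
  · have hne : (if r = 0 then 0 else r + 4) ≠ 3 * R + 100 := by split_ifs <;> omega
    simp only [steps, Instr.step_const, State.set_reg]
    rw [if_neg (by omega), if_neg (by omega), if_neg (by omega), h1 r hr]
    simp only [State.set_reg, if_neg hne]
    cases r with
    | zero => rfl
    | succ r => simp [hσ, State.init]
  · simp [steps, h6, hσ, State.init]
  · simp [steps, h2' 3]; simp [hσ, State.init]
  · simp [steps]
  · simp [steps, h3, hσ, State.init]
  · simp [steps, h4, hσ, State.init]
  · simp [steps, h5, hσ, State.init]

/-- The bound on the examples holds unconditionally because of the cap. The output agrees with that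
of the learner only if a run within both bounds exists, since only then do cap and clock never
interfere. -/
theorem runOnce_runs {n s t l q : ℕ} {par : List ℕ} (A : Prog) (ω : Source n) (σ : State)
    (hs : Prepared n s t l q A.bound par σ) :
    Runs ω (runOnce A) σ (A.bound + 5 + simCost 4 A * (t + 1)) fun τ => τ.draws ≤ s ∧
      ∀ c τ', Exec ω A (State.init (n :: par)) c τ' → c ≤ t → τ'.draws ≤ s → τ.out = τ'.out := by
  refine Runs.seq (resetLearner_runs ω σ hs.setup) ?_
  rintro σ₁ ⟨hr, h13, h16, -, -, -, hk, hm, hd, hf, ho⟩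
  have hb : 50 ≤ 2 * A.bound + 100 := by omega
  have hrel : DirectRel (2 * A.bound + 100) A.bound s σ₁ (State.init (n :: par)) :=
    ⟨hr, (hk 1 (by omega) (by norm_num)).trans hs.setup.r1,
      (hk 5 (by omega) (by norm_num)).trans hs.setup.r5,
      (hk 6 (by omega) (by norm_num)).trans hs.setup.r6, h16, Nat.zero_le _,
      hm.trans hs.mem, hd.trans hs.draws, hf.trans hs.flips, ho.trans hs.setup.out⟩
  obtain ⟨c, τ, he, hτ, _, hc⟩ := simProg_correct ω (capStep s ω) (2 * A.bound + 100) A.bound 4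
    (trDirect (2 * A.bound + 100)) (DirectRel (2 * A.bound + 100) A.bound s)
    (fun _ _ h => h.one) (fun _ _ h => h.zero) (fun _ _ h => h.regs)
    (fun _ _ h r v h1 h2 => h.set_scratch hb r v h1 h2)
    (fun i hi σ' σ h => trDirect_correct ω _ _ s hb i hi σ' σ h) A le_rfl t σ₁ _ hrel h13
  refine ⟨c, τ, he, (Nat.le_add_right _ _).trans hc, hτ.draws ▸ hτ.le, fun c' τ' he' hc' hd' => ?_⟩
  have := he'.crun_eq (st := capStep s ω) (S := s)
    (fun i σ h => capStep_eq s ω i σ h) (t - c') hd'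
  rw [Nat.add_sub_cancel' hc'] at this
  rw [hτ.out, this]

/-- The number of examples for the tests. -/
def testSize (s l : ℕ) : ℕ := 500 * (s * l)

/-- The time for the search for the errors. -/
def searchCost (A : Prog) (n s t l q : ℕ) : ℕ :=
  5 * s / q * 5 + 7 + (501 + (201 + (9 + (testSize s l * (n * 6 + 8 + 1) + 4 +
    (8 * l * (roundCost A n s t q (5 * s / q) (testSize s l) + 1) + 1 + (n * 5 + 3))))))

theorem searchErrors_runs {n s t l q : ℕ} {par : List ℕ} (A : Prog) (ω : Source n) (σ : State)
    (hs : Prepared n s t l q A.bound par σ) (h22 : σ.reg 22 = s * l) (hq : 0 < q) :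
    Runs ω (searchErrors A) σ (searchCost A n s t l q) fun τ =>
      τ.draws = testSize s l + 8 * l * s ∧
      ∀ x : Fin n → ZMod 2,
        OnlyPasses A par ω s t q (5 * s / q) (testSize s l) (200 * (s * l)) (8 * l) x →
        Found A par ω s t q (5 * s / q) (testSize s l) (8 * l) x → τ.out = List.ofFn x := by
  refine Runs.seq ((quotient_runs ω σ (hs.setup.r4.symm ▸ hq) hs.setup.r5).mono
    (by rw [hs.setup.r1, hs.setup.r4]) fun _ h => h) ?_
  rintro σ₁ ⟨k1, m1, d1, f1, o1, h7⟩
  rw [hs.setup.r1, hs.setup.r4] at h7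
  have e22 : σ₁.reg 22 = s * l := by
    rw [k1 22 (by norm_num) (by norm_num) (by norm_num), h22]
  have p1 : Prepared n s t l q A.bound par σ₁ :=
    hs.congr (fun r hr => k1 r (by omega) (by omega) (by omega)) m1 d1 f1 o1
  refine Runs.seq (multiple_runs ω σ₁ (by norm_num) 500) ?_
  rintro _ rfl
  refine Runs.seq (multiple_runs ω _ (by norm_num) 200) ?_
  rintro _ rfl
  refine Runs.seq (multiple_runs ω _ (by norm_num) 8) ?_
  rintro _ rfl
  simp only [State.set_reg, Nat.reduceEqDiff, if_false, e22, p1.r3]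
  have s2 : Setup n s t q (5 * s / q) (testSize s l) (200 * (s * l)) A.bound par
      (((σ₁.set 8 (500 * (s * l))).set 9 (200 * (s * l))).set 10 (8 * l)) := by
    refine ⟨?_, ?_, ?_, ?_, ?_, ?_, ?_, ?_, ?_, fun r hr => ?_, p1.setup.out⟩
    · simp [p1.setup.r0]
    · simp [p1.setup.r1]
    · simp [p1.setup.r2]
    · simp [p1.setup.r4]
    · simp [p1.setup.r5]
    · simp [p1.setup.r6]
    · simp [h7]
    · simp [testSize]
    · simp
    · simp only [State.set_reg]
      rw [if_neg (by omega), if_neg (by omega), if_neg (by omega)]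
      exact p1.setup.save r hr
  refine Runs.seq (storeExamples_runs ω (by norm_num) _ s2.r0 s2.r5 s2.r6 s2.r8) ?_
  rintro σ₃ ⟨f3, d3, fl3, o3, h3⟩
  have s3 := s2.of_frame f3 o3
  simp only [State.set_draws, State.set_flips, p1.draws, p1.flips, Nat.zero_add] at d3 fl3 h3
  have hz : ∀ a, a ≠ 0 → a ≠ 1 → σ₃.mem a = fun _ => 0 := fun a h0 h1 => by
    rw [f3.mem a (by simp; exact ⟨h0, h1⟩)]
    simp [p1.mem]
  refine Runs.seq (roundLoop_runs A ω σ₃ s3 ⟨?_, ?_, ?_, ?_, ?_, ?_, ?_⟩ (N := 8 * l) ?_ d3 fl3) ?_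
  · simpa using h3.point
  · simpa using h3.lab
  · simp [hz 2]
  · simp [hz 3]
  · simp [hz 4]
  · simp [hz 5]
  · intro a p
    rw [hz _ (by omega) (by omega)]
    exact Nat.zero_le _
  · rw [f3.reg 10 (by norm_num)]
    simp
  rintro σ₄ ⟨s4, d4, hb⟩
  refine (emitBest_runs ω σ₄ s4.r0 s4.r5 s4.r6 s4.out).mono le_rfl ?_
  rintro τ ⟨d5, hout⟩
  exact ⟨d5.trans d4, fun x hx hf => hout x (hb x hx hf)⟩

/-- The time before the case distinction. -/
def startCost (c : ℕ) (A : Prog) (s : ℕ) : ℕ := A.bound + s * 3 + c + 10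

theorem noisyProg_runs_aux {n : ℕ} (c : ℕ) (A : Prog) (ω : Source n) (s t l q : ℕ) (par : List ℕ)
    {B : ℕ} {Q : State → Prop}
    (h : ∀ σ, Prepared n s t l q A.bound par σ → σ.reg 22 = s * l →
      σ.reg 24 = q - c * (s * l) → Runs ω (.ite 24 (runOnce A) (searchErrors A)) σ B Q) :
    Runs ω (noisyProg c A) (State.init (n :: s :: t :: l :: q :: par)) (startCost c A s + B) Q := by
  refine (Runs.seq (prepare_runs ω s t l q A.bound par) (B' := s * 3 + 3 + (c + 1 + (1 + B)))
    fun σ₁ p1 => ?_).mono (by rw [startCost]; omega) fun _ h => h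
  refine Runs.seq ((product_runs ω σ₁ p1.setup.r5 p1.setup.r6).mono (by rw [p1.setup.r1])
    fun _ h => h) ?_
  rintro σ₂ ⟨f2, m2, d2, fl2, o2, h22⟩
  rw [p1.setup.r1, p1.r3] at h22
  have p2 := p1.congr (fun r hr => f2.reg r (by omega)) m2 d2 fl2 o2
  refine Runs.seq (multiple_runs ω σ₂ (by norm_num) c) ?_
  rintro _ rfl
  refine Runs.seq (B := 1) (Q := fun υ => υ = (σ₂.set 23 (c * (s * l))).set 24 (q - c * (s * l)))
    (Runs.instr (by simp [h22, p2.setup.r4])) ?_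
  rintro _ rfl
  refine h _ (p2.congr (fun r hr => ?_) rfl rfl rfl rfl) (by simp [h22]) (by simp)
  simp only [State.set_reg]
  repeat rw [if_neg (by omega)]

theorem noisyProg_runs_once {n : ℕ} (c : ℕ) (A : Prog) (ω : Source n) (s t l q : ℕ) (par : List ℕ)
    (hq : c * (s * l) < q) :
    Runs ω (noisyProg c A) (State.init (n :: s :: t :: l :: q :: par))
      (startCost c A s + (A.bound + 5 + simCost 4 A * (t + 1) + 1)) fun τ => τ.draws ≤ s ∧
      ∀ c τ', Exec ω A (State.init (n :: par)) c τ' → c ≤ t → τ'.draws ≤ s → τ.out = τ'.out :=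
  noisyProg_runs_aux c A ω s t l q par fun σ hσ _ h24 =>
    (Runs.ite (B' := 0) (fun _ => runOnce_runs A ω σ hσ) (fun h => by omega)).mono
      (by simp) fun _ h => h

theorem noisyProg_runs_search {n : ℕ} (c : ℕ) (A : Prog) (ω : Source n) (s t l q : ℕ)
    (par : List ℕ) (hq : q ≤ c * (s * l)) (hq0 : 0 < q) :
    Runs ω (noisyProg c A) (State.init (n :: s :: t :: l :: q :: par))
      (startCost c A s + (searchCost A n s t l q + 1)) fun τ =>
      τ.draws = testSize s l + 8 * l * s ∧
      ∀ x : Fin n → ZMod 2,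
        OnlyPasses A par ω s t q (5 * s / q) (testSize s l) (200 * (s * l)) (8 * l) x →
        Found A par ω s t q (5 * s / q) (testSize s l) (8 * l) x → τ.out = List.ofFn x :=
  noisyProg_runs_aux c A ω s t l q par fun σ hσ h22 h24 =>
    (Runs.ite (B := 0) (fun h => by omega) (fun _ => searchErrors_runs A ω σ hσ h22 hq0)).mono
      (by simp) fun _ h => h

/-! ### Every sparse pattern is coded by a word -/

theorem add_mul_lt_pow_succ {b D d v : ℕ} (hd : d < b) (hv : v < b ^ D) :
    d + b * v < b ^ (D + 1) := by
  calc d + b * v < b + b * v := by omega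
    _ = b * (v + 1) := by ring
    _ ≤ b * b ^ D := Nat.mul_le_mul_left _ hv
    _ = b ^ (D + 1) := (pow_succ' b D).symm

/-- Induction along the greedy coding, with potential `E.card + (s - pos) / q`. If no error lies
within the next `q` positions, the digit `q` skips them and lowers the quotient by one; otherwise a
smaller digit leads to the first error and removes it. When `E` is exhausted, the remaining digits
are skips. -/
theorem exists_wordPattern_eq {q s : ℕ} (hq : 0 < q) : ∀ (D pos : ℕ) (E : Finset ℕ),
    (∀ i ∈ E, pos ≤ i ∧ i < s) → E.card + (s - pos) / q ≤ D →
    ∃ v < (q + 1) ^ D, ∀ i, wordPattern q D v pos i = if i ∈ E then 1 else 0 := by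
  intro D
  induction D with
  | zero =>
    intro pos E _ hD
    have : E = ∅ := Finset.card_eq_zero.1 (Nat.add_eq_zero_iff.1 (Nat.le_zero.1 hD)).1
    subst this
    exact ⟨0, by simp, fun i => by simp [wordPattern]⟩
  | succ D ih =>
    intro pos E hE hD
    have hmod (d v : ℕ) (hd : d < q + 1) : (d + (q + 1) * v) % (q + 1) = d := by
      rw [Nat.add_mul_mod_self_left, Nat.mod_eq_of_lt hd]
    have hdiv (d v : ℕ) (hd : d < q + 1) : (d + (q + 1) * v) / (q + 1) = v := by
      rw [Nat.add_mul_div_left _ _ (Nat.succ_pos q), Nat.div_eq_of_lt hd, zero_add]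
    by_cases hfar : ∀ i ∈ E, pos + q ≤ i
    · have hcard : E.card + (s - (pos + q)) / q ≤ D := by
        by_cases hs : q ≤ s - pos
        · rw [Nat.div_eq_sub_div hq hs] at hD
          rw [← Nat.sub_sub]
          generalize (s - pos - q) / q = z at *
          omega
        · have : E = ∅ := Finset.eq_empty_of_forall_notMem fun i hi => by
            have := hfar i hi
            have := hE i hi
            omega
          subst this
          simp [show s - (pos + q) = 0 by omega]
      obtain ⟨v, hv, hp⟩ := ih (pos + q) E (fun i hi => ⟨hfar i hi, (hE i hi).2⟩) hcard
      refine ⟨q + (q + 1) * v, add_mul_lt_pow_succ (Nat.lt_succ_self q) hv, fun i => ?_⟩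
      rw [wordPattern, hmod _ _ (Nat.lt_succ_self q), if_pos rfl, hdiv _ _ (Nat.lt_succ_self q), hp]
    · push Not at hfar
      obtain ⟨i₀, hi₀, hi₀'⟩ := hfar
      have hne : E.Nonempty := ⟨i₀, hi₀⟩
      set m := E.min' hne with hm
      have hmE : m ∈ E := E.min'_mem hne
      have hmle : ∀ i ∈ E, m ≤ i := fun i hi => E.min'_le i hi
      have hmi := hmle _ hi₀
      have hpm := hE m hmE
      have hd : m - pos < q := by omega
      have hcard : (E.erase m).card + (s - (m + 1)) / q ≤ D := by
        rw [Finset.card_erase_of_mem hmE]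
        have := Finset.card_pos.2 hne
        have : (s - (m + 1)) / q ≤ (s - pos) / q := Nat.div_le_div_right (by omega)
        omega
      obtain ⟨v, hv, hp⟩ := ih (m + 1) (E.erase m) (fun i hi => by
        have h1 := Finset.mem_erase.1 hi
        have h2 := hmle i h1.2
        exact ⟨by have := h1.1; omega, (hE i h1.2).2⟩) hcard
      refine ⟨m - pos + (q + 1) * v, add_mul_lt_pow_succ (by omega) hv, fun i => ?_⟩
      rw [wordPattern, hmod _ _ (by omega), if_neg (by omega), hdiv _ _ (by omega),
        show pos + (m - pos) = m by omega, hp]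
      by_cases h : i = m
      · simp [h, hmE]
      · simp [h]

/-- Every pattern on `s` positions of weight at most `4 * s / q` is coded by a word of length
`5 * s / q`. -/
theorem exists_wordPattern_eq_of_card_le {q s : ℕ} (hq : 0 < q) (f : ℕ → ZMod 2)
    (hf : ((Finset.range s).filter fun i => f i ≠ 0).card ≤ 4 * s / q) :
    ∃ v < (q + 1) ^ (5 * s / q), ∀ i < s, wordPattern q (5 * s / q) v 0 i = f i := by
  obtain ⟨v, hv, hp⟩ := exists_wordPattern_eq (s := s) hq (5 * s / q) 0
    ((Finset.range s).filter fun i => f i ≠ 0)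
    (fun i hi => ⟨Nat.zero_le i, Finset.mem_range.1 (Finset.mem_filter.1 hi).1⟩) (by
      rw [Nat.sub_zero]
      refine (Nat.add_le_add_right hf _).trans ((Nat.div_add_div_le_add_div).trans ?_)
      exact Nat.div_le_div_right (by omega))
  refine ⟨v, hv, fun i hi => ?_⟩
  rw [hp]
  have h2 : ∀ z : ZMod 2, z ≠ 0 → z = 1 := by decide
  by_cases h : f i = 0
  · simp [h]
  · rw [if_pos (by simp [hi, h]), h2 _ h]

/-! ### Probability: independence, the test, the rounds -/

/-! ### Functions of finitely many examples and coins -/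

open scoped ENNReal NNReal

/-- The function `f` depends only on the examples with numbers in `S` and on the coins with numbers
in `T`. -/
def LocalOn {n : ℕ} {β : Type*} (f : Sample n → β) (S T : Finset ℕ) : Prop :=
  ∀ ω ω' : Sample n, (∀ i ∈ S, ω.1 i = ω'.1 i) → (∀ i ∈ S, ω.2.1 i = ω'.2.1 i) →
    (∀ i ∈ T, ω.2.2 i = ω'.2.2 i) → f ω = f ω'

theorem LocalOn.comp {n : ℕ} {β γ : Type*} {f : Sample n → β} {S T : Finset ℕ}
    (h : LocalOn f S T) (g : β → γ) : LocalOn (fun ω => g (f ω)) S T :=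
  fun ω ω' h₁ h₂ h₃ => congrArg g (h ω ω' h₁ h₂ h₃)

/-- Forget all coordinates outside a finite set. -/
def cut {α : Type*} [Zero α] (S : Finset ℕ) (p : S → α) (i : ℕ) : α :=
  if h : i ∈ S then p ⟨i, h⟩ else 0

theorem measurable_cut {α : Type*} [Zero α] [MeasurableSpace α] (S : Finset ℕ) :
    Measurable (cut S : (S → α) → ℕ → α) := by
  refine measurable_pi_lambda _ fun i => ?_
  by_cases h : i ∈ S
  · simpa [cut, h] using measurable_pi_apply _
  · simp [cut, h]

/-- Such a function factors through the restriction to finitely many coordinates, which takes values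
in a finite discrete space. This settles all measurability questions about runs of programs. -/
theorem LocalOn.measurable {n : ℕ} {β : Type*} [MeasurableSpace β] {f : Sample n → β}
    {S T : Finset ℕ} (h : LocalOn f S T) : Measurable f := by
  have hf : f = (fun z : (S → Fin n → ZMod 2) × (S → ZMod 2) × (T → ZMod 2) =>
      f (cut S z.1, cut S z.2.1, cut T z.2.2)) ∘
      fun ω => (S.restrict ω.1, S.restrict ω.2.1, T.restrict ω.2.2) := by
    funext ω
    refine h _ _ (fun i hi => ?_) (fun i hi => ?_) fun i hi => ?_ <;> simp [cut, hi]
  rw [hf]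
  refine (measurable_of_finite _).comp ?_
  fun_prop

/-- Restrictions of a product measure to disjoint sets of coordinates are independent, and `cut`
recovers `f` and `g` from these restrictions. -/
theorem lintegral_mul_infinitePi {α : Type*} [Zero α] [MeasurableSpace α] (P : Measure α)
    [IsProbabilityMeasure P] {f g : (ℕ → α) → ℝ≥0∞} (hf : Measurable f) (hg : Measurable g)
    {S T : Finset ℕ} (hfS : DependsOn f S) (hgT : DependsOn g T) (hST : Disjoint S T) :
    ∫⁻ p, f p * g p ∂(Measure.infinitePi fun _ : ℕ => P) =
      (∫⁻ p, f p ∂(Measure.infinitePi fun _ : ℕ => P)) *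
        ∫⁻ p, g p ∂(Measure.infinitePi fun _ : ℕ => P) := by
  have hind := (iIndepFun_infinitePi (P := fun _ : ℕ => P) (X := fun _ (z : α) => z)
    (by fun_prop)).indepFun_finset S T hST (by fun_prop)
  have hf' : f = fun p => f (cut S fun i => p i) := by
    funext p
    refine hfS fun i hi => ?_
    simp [cut, Finset.mem_coe.1 hi]
  have hg' : g = fun p => g (cut T fun i => p i) := by
    funext p
    refine hgT fun i hi => ?_
    simp [cut, Finset.mem_coe.1 hi]
  refine lintegral_mul_eq_lintegral_mul_lintegral_of_indepFun'' hf.aemeasurable hg.aemeasurable ?_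
  rw [hf', hg']
  exact hind.comp (hf.comp (measurable_cut S)) (hg.comp (measurable_cut T))

theorem lintegral_sampleMeasure {n : ℕ} (η : unitInterval) {f : Sample n → ℝ≥0∞}
    (hf : Measurable f) : ∫⁻ ω, f ω ∂sampleMeasure n η =
      ∫⁻ p, ∫⁻ ν, ∫⁻ c, f (p, ν, c) ∂(Measure.infinitePi fun _ : ℕ => fairCoin)
        ∂(Measure.infinitePi fun _ : ℕ => bernoulliMeasure (1 : ZMod 2) 0 η)
        ∂(Measure.infinitePi fun _ : ℕ => uniformCube n) := by
  rw [sampleMeasure, lintegral_prod _ hf.aemeasurable]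
  refine lintegral_congr fun p => ?_
  rw [lintegral_prod _ (by fun_prop)]

/-- The factorization is applied to the coins, the noise bits and the points in turn, from the
innermost integral outwards. Each inner integral again depends only on the allowed coordinates of
the next variable. -/
theorem lintegral_mul_of_local {n : ℕ} (η : unitInterval) {f g : Sample n → ℝ≥0∞}
    {S T S' T' : Finset ℕ} (hf : LocalOn f S T) (hg : LocalOn g S' T') (hS : Disjoint S S')
    (hT : Disjoint T T') : ∫⁻ ω, f ω * g ω ∂sampleMeasure n η =
      (∫⁻ ω, f ω ∂sampleMeasure n η) * ∫⁻ ω, g ω ∂sampleMeasure n η := by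
  have hfm := hf.measurable
  have hgm := hg.measurable
  rw [lintegral_sampleMeasure η hfm, lintegral_sampleMeasure η hgm,
    lintegral_sampleMeasure η (f := fun ω => f ω * g ω) (hfm.mul hgm)]
  have hc : ∀ p ν, ∫⁻ c, f (p, ν, c) * g (p, ν, c) ∂(Measure.infinitePi fun _ : ℕ => fairCoin) =
      (∫⁻ c, f (p, ν, c) ∂(Measure.infinitePi fun _ : ℕ => fairCoin)) *
        ∫⁻ c, g (p, ν, c) ∂(Measure.infinitePi fun _ : ℕ => fairCoin) := fun p ν =>
    lintegral_mul_infinitePi _ (by fun_prop) (by fun_prop)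
      (fun c c' h => hf _ _ (by simp) (by simp) h) (fun c c' h => hg _ _ (by simp) (by simp) h) hT
  simp only [hc]
  have hν : ∀ p, ∫⁻ ν, (∫⁻ c, f (p, ν, c) ∂(Measure.infinitePi fun _ : ℕ => fairCoin)) *
        (∫⁻ c, g (p, ν, c) ∂(Measure.infinitePi fun _ : ℕ => fairCoin))
        ∂(Measure.infinitePi fun _ : ℕ => bernoulliMeasure (1 : ZMod 2) 0 η) =
      (∫⁻ ν, ∫⁻ c, f (p, ν, c) ∂(Measure.infinitePi fun _ : ℕ => fairCoin)
        ∂(Measure.infinitePi fun _ : ℕ => bernoulliMeasure (1 : ZMod 2) 0 η)) *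
      ∫⁻ ν, ∫⁻ c, g (p, ν, c) ∂(Measure.infinitePi fun _ : ℕ => fairCoin)
        ∂(Measure.infinitePi fun _ : ℕ => bernoulliMeasure (1 : ZMod 2) 0 η) := fun p =>
    lintegral_mul_infinitePi _ (Measurable.lintegral_prod_right (by fun_prop))
      (Measurable.lintegral_prod_right (by fun_prop))
      (fun ν ν' h => lintegral_congr fun c => hf _ _ (by simp) h (by simp))
      (fun ν ν' h => lintegral_congr fun c => hg _ _ (by simp) h (by simp)) hS
  simp only [hν]
  exact lintegral_mul_infinitePi _
    (Measurable.lintegral_prod_right (Measurable.lintegral_prod_right (by fun_prop)))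
    (Measurable.lintegral_prod_right (Measurable.lintegral_prod_right (by fun_prop)))
    (fun p p' h => lintegral_congr fun ν => lintegral_congr fun c => hf _ _ h (by simp) (by simp))
    (fun p p' h => lintegral_congr fun ν => lintegral_congr fun c => hg _ _ h (by simp) (by simp)) hS

instance (n : ℕ) (η : unitInterval) : IsProbabilityMeasure (sampleMeasure n η) := by
  unfold sampleMeasure; infer_instance

theorem LocalOn.prod {n : ℕ} {ι : Type*} (R : Finset ι) {f : ι → Sample n → ℝ≥0∞}
    {S T : ι → Finset ℕ} (h : ∀ r ∈ R, LocalOn (f r) (S r) (T r)) :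
    LocalOn (fun ω => ∏ r ∈ R, f r ω) (R.biUnion S) (R.biUnion T) :=
  fun ω ω' h₁ h₂ h₃ => Finset.prod_congr rfl fun r hr => h r hr ω ω'
    (fun i hi => h₁ i (Finset.mem_biUnion.2 ⟨r, hr, hi⟩))
    (fun i hi => h₂ i (Finset.mem_biUnion.2 ⟨r, hr, hi⟩))
    fun i hi => h₃ i (Finset.mem_biUnion.2 ⟨r, hr, hi⟩)

theorem lintegral_prod_of_local {n : ℕ} (η : unitInterval) {ι : Type*} (R : Finset ι)
    {f : ι → Sample n → ℝ≥0∞} {S T : ι → Finset ℕ} (h : ∀ r ∈ R, LocalOn (f r) (S r) (T r))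
    (hS : (R : Set ι).PairwiseDisjoint S) (hT : (R : Set ι).PairwiseDisjoint T) :
    ∫⁻ ω, ∏ r ∈ R, f r ω ∂sampleMeasure n η = ∏ r ∈ R, ∫⁻ ω, f r ω ∂sampleMeasure n η := by
  induction R using Finset.cons_induction with
  | empty => simp
  | cons j R hj ih =>
    rw [Finset.coe_cons] at hS hT
    simp only [Finset.prod_cons]
    rw [lintegral_mul_of_local η (h j (Finset.mem_cons_self j R))
      (LocalOn.prod R fun r hr => h r (Finset.mem_cons_of_mem hr)),
      ih (fun r hr => h r (Finset.mem_cons_of_mem hr)) (hS.subset (Set.subset_insert _ _))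
        (hT.subset (Set.subset_insert _ _))]
    · exact (Finset.disjoint_biUnion_right _ _ _).2 fun r hr =>
        hS (Set.mem_insert _ _) (Set.mem_insert_of_mem _ hr) fun e => hj (e ▸ hr)
    · exact (Finset.disjoint_biUnion_right _ _ _).2 fun r hr =>
        hT (Set.mem_insert _ _) (Set.mem_insert_of_mem _ hr) fun e => hj (e ▸ hr)

/-! ### Shifting the examples and the coins, and removing the noise -/

/-- Drop the first `d` examples and the first `e` coins, and correct all labels. -/
def shiftClean {n : ℕ} (d e : ℕ) (ω : Sample n) : Sample n :=
  (fun i => ω.1 (d + i), 0, fun i => ω.2.2 (e + i))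

/-- The guarantee for the learner concerns noise rate `0` and the first examples. This map carries
it to an arbitrary round at rate `η`: shifts preserve product measures, and at rate `0` the noise is
a point mass at zero. -/
theorem measurePreserving_shiftClean {n : ℕ} (η : unitInterval) (d e : ℕ) :
    MeasurePreserving (shiftClean d e) (sampleMeasure n η) (sampleMeasure n 0) := by
  have h (α : Type) [MeasurableSpace α] (P : Measure α) [IsProbabilityMeasure P] (d : ℕ) :
      MeasurePreserving (fun (p : ℕ → α) i => p (d + i)) (Measure.infinitePi fun _ : ℕ => P)
        (Measure.infinitePi fun _ : ℕ => P) :=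
    ⟨by fun_prop, Measure.map_infinitePi_infinitePi_of_inj (P := fun _ : ℕ => P)
      (add_right_injective d)⟩
  have h0 : MeasurePreserving (fun _ : ℕ → ZMod 2 => (0 : ℕ → ZMod 2))
      (Measure.infinitePi fun _ : ℕ => bernoulliMeasure (1 : ZMod 2) 0 η)
      (Measure.infinitePi fun _ : ℕ => bernoulliMeasure (1 : ZMod 2) 0 0) := by
    refine ⟨measurable_const, ?_⟩
    simp only [bernoulliMeasure_zero, Measure.infinitePi_dirac, Measure.map_const, measure_univ,
      one_smul]
    rfl
  exact (h _ _ d).prod (h0.prod (h _ _ e))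

/-! ### One example -/

theorem lintegral_uniformCube {n : ℕ} (f : (Fin n → ZMod 2) → ℝ≥0∞) :
    ∫⁻ a, f a ∂uniformCube n =
      ∑ a, f a * (Fintype.card (Fin n → ZMod 2) : ℝ≥0∞)⁻¹ := by
  rw [lintegral_fintype]
  refine Finset.sum_congr rfl fun a _ => ?_
  rw [uniformCube, PMF.toMeasure_apply_singleton _ _ (measurableSet_singleton a),
    PMF.uniformOfFintype_apply]

theorem lintegral_uniformCube_add {n : ℕ} (f : (Fin n → ZMod 2) → ℝ≥0∞) (b : Fin n → ZMod 2) :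
    ∫⁻ a, f (a + b) ∂uniformCube n = ∫⁻ a, f a ∂uniformCube n := by
  rw [lintegral_uniformCube, lintegral_uniformCube]
  exact Equiv.sum_comp (Equiv.addRight b)
    fun a => f a * (Fintype.card (Fin n → ZMod 2) : ℝ≥0∞)⁻¹

theorem parity_add_single {n : ℕ} (x a : Fin n → ZMod 2) (j : Fin n) :
    parity x (a + Pi.single j 1) = parity x a + x j := by
  simp [parity, mul_add, Finset.sum_add_distrib, Pi.single_apply]

/-- If `y` differs from `x`, then the parity of `y` is a fair bit given that of `x`. -/
theorem two_mul_lintegral_parity_ne {n : ℕ} {x y : Fin n → ZMod 2} (hxy : y ≠ x) (b : ZMod 2)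
    (u v : ℝ≥0∞) :
    2 * ∫⁻ a, (if parity y a ≠ parity x a + b then u else v) ∂uniformCube n = u + v := by
  obtain ⟨j, hj⟩ := Function.ne_iff.1 hxy
  rw [two_mul]
  -- Flipping a coordinate in which `x` and `y` differ preserves the uniform measure and exchanges
  -- agreement and disagreement. The two copies of the integral therefore add up to `u + v`
  -- pointwise.
  conv_lhs => enter [2]; rw [← lintegral_uniformCube_add _ (Pi.single j 1)]
  rw [← lintegral_add_left (measurable_of_finite _)]
  rw [lintegral_congr (g := fun _ => u + v)]
  · simp
  · intro a
    rw [parity_add_single, parity_add_single]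
    generalize parity y a = p, parity x a = r, y j = c, x j = d at *
    have : ∀ b c d p r : ZMod 2, c ≠ d →
      ((p ≠ r + b ∧ ¬ (p + c ≠ r + d + b)) ∨ (¬ (p ≠ r + b) ∧ (p + c ≠ r + d + b))) := by decide
    rcases this b c d p r hj with ⟨h₁, h₂⟩ | ⟨h₁, h₂⟩
    · rw [if_pos h₁, if_neg h₂]
    · rw [if_neg h₁, if_pos h₂, add_comm]

/-- Distinct parities disagree on exactly half of the cube, so the approximation parameter `1 / 2`
amounts to identifying the hidden vector. -/
theorem eq_of_disagreement_lt {n : ℕ} {x y : Fin n → ZMod 2} (h : disagreement x y < 1 / 2) :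
    y = x := by
  by_contra hxy
  have h1 := two_mul_lintegral_parity_ne (Ne.symm hxy) 0 1 0
  simp only [add_zero] at h1
  have h2 : ∫⁻ a, (if parity x a ≠ parity y a then (1 : ℝ≥0∞) else 0) ∂uniformCube n =
      uniformCube n {a | parity x a ≠ parity y a} := by
    rw [← lintegral_indicator_one (Set.toFinite _).measurableSet]
    refine lintegral_congr fun a => ?_
    by_cases ha : parity x a = parity y a <;> simp [Set.indicator, ha]
  rw [h2] at h1
  have h3 := congrArg ENNReal.toReal h1
  rw [ENNReal.toReal_mul] at h3
  simp only [ENNReal.toReal_ofNat, ENNReal.toReal_one] at h3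
  rw [disagreement, measureReal_def] at h
  linarith

theorem disagreement_self {n : ℕ} (x : Fin n → ZMod 2) : disagreement x x = 0 := by
  simp [disagreement]

theorem measurePreserving_example {n : ℕ} (η : unitInterval) (i : ℕ) :
    MeasurePreserving (fun ω : Sample n => (ω.1 i, ω.2.1 i)) (sampleMeasure n η)
      ((uniformCube n).prod (bernoulliMeasure (1 : ZMod 2) 0 η)) :=
  (measurePreserving_eval_infinitePi (fun _ : ℕ => uniformCube n) i).prod
    ((measurePreserving_eval_infinitePi (fun _ : ℕ => bernoulliMeasure (1 : ZMod 2) 0 η) i).comp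
      measurePreserving_fst)

theorem lintegral_noise {n : ℕ} (η : unitInterval) (i : ℕ) (f : ZMod 2 → ℝ≥0∞) :
    ∫⁻ ω, f (ω.2.1 i) ∂sampleMeasure n η =
      ENNReal.ofReal η * f 1 + ENNReal.ofReal (1 - η) * f 0 := by
  have h := (measurePreserving_snd.comp (measurePreserving_example (n := n) η i)).lintegral_comp
    (measurable_of_finite f)
  refine h.trans ?_
  rw [bernoulliMeasure_def, lintegral_add_measure, lintegral_smul_measure, lintegral_smul_measure,
    lintegral_dirac, lintegral_dirac, ENNReal.smul_def, ENNReal.smul_def, smul_eq_mul, smul_eq_mul,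
    ENNReal.ofReal, ENNReal.ofReal, Real.toNNReal_of_nonneg η.2.1,
    Real.toNNReal_of_nonneg (sub_nonneg.2 η.2.2)]
  rfl

theorem two_mul_lintegral_label_ne {n : ℕ} (η : unitInterval) (i : ℕ) {x y : Fin n → ZMod 2}
    (hxy : y ≠ x) (u v : ℝ≥0∞) :
    2 * ∫⁻ ω, (if parity y (ω.1 i) ≠ parity x (ω.1 i) + ω.2.1 i then u else v)
      ∂sampleMeasure n η = u + v := by
  have h := (measurePreserving_example (n := n) η i).lintegral_comp
    (measurable_of_finite fun z : (Fin n → ZMod 2) × ZMod 2 =>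
      if parity y z.1 ≠ parity x z.1 + z.2 then u else v)
  rw [h, lintegral_prod_symm _ (measurable_of_finite _).aemeasurable,
    ← lintegral_const_mul _ (measurable_of_finite _)]
  simp only [two_mul_lintegral_parity_ne hxy]
  simp

/-! ### Testing vectors -/

theorem score_source {n : ℕ} (x y : Fin n → ZMod 2) (ω : Sample n) (M : ℕ) :
    score (source x ω).point (source x ω).lab M y =
      ((Finset.range M).filter fun i => parity y (ω.1 i) ≠ parity x (ω.1 i) + ω.2.1 i).card := rfl

theorem prod_ite_score {n : ℕ} (x y : Fin n → ZMod 2) (ω : Sample n) (M : ℕ) (u : ℝ≥0∞) :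
    ∏ i ∈ Finset.range M, (if parity y (ω.1 i) ≠ parity x (ω.1 i) + ω.2.1 i then u else 1) =
      u ^ score (source x ω).point (source x ω).lab M y := by
  rw [score_source, Finset.prod_ite, Finset.prod_const, Finset.prod_const_one, mul_one]

theorem localOn_example {n : ℕ} {β : Type*} (f : (Fin n → ZMod 2) → ZMod 2 → β) (i : ℕ) :
    LocalOn (fun ω : Sample n => f (ω.1 i) (ω.2.1 i)) {i} ∅ := by
  intro ω ω' h₁ h₂ _
  simp only [h₁ i (Finset.mem_singleton_self i), h₂ i (Finset.mem_singleton_self i)]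

theorem pairwiseDisjoint_singleton (R : Set ℕ) :
    R.PairwiseDisjoint fun i => ({i} : Finset ℕ) :=
  fun _ _ _ _ hij => Finset.disjoint_singleton.2 hij

/-- The hidden vector passes the test with high probability. -/
theorem measure_lt_score_le {n : ℕ} (η : unitInterval) (hη : (η : ℝ) < 1 / 3)
    (x : Fin n → ZMod 2) (h : ℕ) :
    sampleMeasure n η {ω | 2 * h < score (source x ω).point (source x ω).lab (5 * h) x} ≤
      (((9 / 16 * (10 / 9) ^ 5 : ℝ≥0) ^ h : ℝ≥0) : ℝ≥0∞) := by
  have hloc : ∀ i ∈ Finset.range (5 * h), LocalOn (fun ω : Sample n =>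
      if parity x (ω.1 i) ≠ parity x (ω.1 i) + ω.2.1 i then ((4 / 3 : ℝ≥0) : ℝ≥0∞) else 1)
      {i} ∅ := fun i _ => localOn_example (fun a b =>
        if parity x a ≠ parity x a + b then ((4 / 3 : ℝ≥0) : ℝ≥0∞) else 1) i
  -- Exponential moment: the hidden vector disagrees exactly with the wrong labels, and each example
  -- contributes `1 + η / 3 ≤ 10 / 9`.
  have hI : ∫⁻ ω, ((4 / 3 : ℝ≥0) : ℝ≥0∞) ^ score (source x ω).point (source x ω).lab (5 * h) x
      ∂sampleMeasure n η ≤ (((10 / 9 : ℝ≥0) ^ (5 * h) : ℝ≥0) : ℝ≥0∞) := by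
    simp only [← prod_ite_score]
    rw [lintegral_prod_of_local η _ hloc (pairwiseDisjoint_singleton _)
      (fun i _ j _ _ => by simp), ENNReal.coe_pow]
    refine (Finset.prod_le_pow_card _ _ _ fun i _ => ?_).trans_eq (by rw [Finset.card_range])
    have hg := lintegral_noise (n := n) η i fun b =>
      if b ≠ 0 then ((4 / 3 : ℝ≥0) : ℝ≥0∞) else 1
    rw [lintegral_congr fun ω => ?_, hg]
    · rw [if_pos one_ne_zero, if_neg (not_not.2 rfl), mul_one, ← ENNReal.ofReal_coe_nnreal,
        ← ENNReal.ofReal_coe_nnreal, ← ENNReal.ofReal_mul η.2.1,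
        ← ENNReal.ofReal_add (mul_nonneg η.2.1 (NNReal.coe_nonneg _)) (sub_nonneg.2 η.2.2)]
      refine ENNReal.ofReal_le_ofReal ?_
      push_cast
      linarith
    · simp
  -- Markov's inequality at threshold `(4/3)^(2h)` gives `((10/9)^5 / (4/3)^2)^h`, whose base is
  -- less than `1`.
  have hmk := mul_meas_ge_le_lintegral (μ := sampleMeasure n η) (f := fun ω =>
    ((4 / 3 : ℝ≥0) : ℝ≥0∞) ^ score (source x ω).point (source x ω).lab (5 * h) x)
    (by simp only [← prod_ite_score]; exact (LocalOn.prod _ hloc).measurable)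
    (((4 / 3 : ℝ≥0) : ℝ≥0∞) ^ (2 * h))
  have h1 : (1 : ℝ≥0) ≤ 4 / 3 := by
    rw [← NNReal.coe_le_coe]
    push_cast
    norm_num
  have h2 : ((3 / 4 : ℝ≥0) : ℝ≥0∞) ^ (2 * h) * ((4 / 3 : ℝ≥0) : ℝ≥0∞) ^ (2 * h) = 1 := by
    rw [← mul_pow, ← ENNReal.coe_mul, show (3 / 4 * (4 / 3) : ℝ≥0) = 1 by
      rw [← NNReal.coe_inj]; push_cast; norm_num, ENNReal.coe_one, one_pow]
  calc _ ≤ sampleMeasure n η {ω | ((4 / 3 : ℝ≥0) : ℝ≥0∞) ^ (2 * h) ≤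
        ((4 / 3 : ℝ≥0) : ℝ≥0∞) ^ score (source x ω).point (source x ω).lab (5 * h) x} :=
        measure_mono fun ω hω => by
          rw [Set.mem_ofPred_eq] at hω ⊢
          exact pow_le_pow_right₀ (by exact_mod_cast h1) hω.le
    _ = ((3 / 4 : ℝ≥0) : ℝ≥0∞) ^ (2 * h) * (((4 / 3 : ℝ≥0) : ℝ≥0∞) ^ (2 * h) *
        sampleMeasure n η {ω | ((4 / 3 : ℝ≥0) : ℝ≥0∞) ^ (2 * h) ≤
          ((4 / 3 : ℝ≥0) : ℝ≥0∞) ^ score (source x ω).point (source x ω).lab (5 * h) x}) := by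
        rw [← mul_assoc, h2, one_mul]
    _ ≤ ((3 / 4 : ℝ≥0) : ℝ≥0∞) ^ (2 * h) * (((10 / 9 : ℝ≥0) ^ (5 * h) : ℝ≥0) : ℝ≥0∞) :=
        mul_le_mul_right (hmk.trans hI) _
    _ = _ := by
        rw [← ENNReal.coe_pow, ← ENNReal.coe_mul, pow_mul, pow_mul, ← mul_pow]
        congr 3
        rw [← NNReal.coe_inj]
        push_cast
        norm_num

/-- A wrong candidate that does not depend on the test examples passes the test with small
probability. -/
theorem measure_exists_score_le {n : ℕ} (η : unitInterval) (x : Fin n → ZMod 2) (h : ℕ)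
    {out : Sample n → List (ZMod 2)} {S T : Finset ℕ} (hout : LocalOn out S T)
    (hS : Disjoint (Finset.range (5 * h)) S) :
    sampleMeasure n η {ω | ∃ y : Fin n → ZMod 2, y ≠ x ∧ out ω = List.ofFn y ∧
      score (source x ω).point (source x ω).lab (5 * h) y ≤ 2 * h} ≤
      (((9 / 4 * (5 / 6) ^ 5 : ℝ≥0) ^ h : ℝ≥0) : ℝ≥0∞) := by
  classical
  have hlocI (y : Fin n → ZMod 2) :
      LocalOn (fun ω => if out ω = List.ofFn y then (1 : ℝ≥0∞) else 0) S T :=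
    hout.comp fun o => if o = List.ofFn y then (1 : ℝ≥0∞) else 0
  have hloc (y : Fin n → ZMod 2) : ∀ i ∈ Finset.range (5 * h), LocalOn (fun ω : Sample n =>
      if parity y (ω.1 i) ≠ parity x (ω.1 i) + ω.2.1 i then ((2 / 3 : ℝ≥0) : ℝ≥0∞) else 1)
      {i} ∅ := fun i _ => localOn_example (fun a b =>
        if parity y a ≠ parity x a + b then ((2 / 3 : ℝ≥0) : ℝ≥0∞) else 1) i
  -- The event that `y` is the candidate does not involve the test examples, so its probability
  -- splits off. For `y ≠ x` every label is a fair bit relative to `y`, so each test example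
  -- contributes `(2/3 + 1) / 2 = 5/6`.
  have hI (y : Fin n → ZMod 2) (hy : y ≠ x) :
      ∫⁻ ω, (if out ω = List.ofFn y then (1 : ℝ≥0∞) else 0) *
        ((2 / 3 : ℝ≥0) : ℝ≥0∞) ^ score (source x ω).point (source x ω).lab (5 * h) y
        ∂sampleMeasure n η =
      (∫⁻ ω, (if out ω = List.ofFn y then (1 : ℝ≥0∞) else 0) ∂sampleMeasure n η) *
        ((5 / 6 : ℝ≥0) : ℝ≥0∞) ^ (5 * h) := by
    simp only [← prod_ite_score]
    rw [lintegral_mul_of_local η (hlocI y) (LocalOn.prod _ (hloc y)),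
      lintegral_prod_of_local η _ (hloc y) (pairwiseDisjoint_singleton _)
      (fun i _ j _ _ => by simp)]
    · congr 1
      rw [Finset.prod_congr rfl (g := fun _ => ((5 / 6 : ℝ≥0) : ℝ≥0∞)), Finset.prod_const,
        Finset.card_range]
      intro i _
      have h2 := two_mul_lintegral_label_ne η i hy ((2 / 3 : ℝ≥0) : ℝ≥0∞) 1
      have h3 : ((2 / 3 : ℝ≥0) : ℝ≥0∞) + 1 = 2 * ((5 / 6 : ℝ≥0) : ℝ≥0∞) := by
        have : (2 / 3 + 1 : ℝ≥0) = 2 * (5 / 6) := by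
          rw [← NNReal.coe_inj]
          push_cast
          norm_num
        exact_mod_cast congrArg (fun z : ℝ≥0 => (z : ℝ≥0∞)) this
      rw [h3] at h2
      exact (ENNReal.mul_right_inj (by norm_num) (by norm_num)).1 h2
    · refine (Finset.disjoint_biUnion_right _ _ _).2 fun i hi => ?_
      exact (Finset.disjoint_left.2 fun j hj hj' =>
        Finset.disjoint_left.1 hS (Finset.mem_singleton.1 hj' ▸ hi) hj)
    · exact (Finset.disjoint_biUnion_right _ _ _).2 fun _ _ => Finset.disjoint_empty_right _
  have h2 : ((9 / 4 : ℝ≥0) : ℝ≥0∞) ^ h * ((2 / 3 : ℝ≥0) : ℝ≥0∞) ^ (2 * h) = 1 := by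
    rw [pow_mul, ← mul_pow, ← ENNReal.coe_pow, ← ENNReal.coe_mul,
      show (9 / 4 * (2 / 3) ^ 2 : ℝ≥0) = 1 by
        rw [← NNReal.coe_inj]; push_cast; norm_num, ENNReal.coe_one, one_pow]
  have h1 : (2 / 3 : ℝ≥0) ≤ 1 := by
    rw [← NNReal.coe_le_coe]
    push_cast
    norm_num
  -- When a wrong `y` is output and has score at most `2h`, its summand is at least `(9/4)^h
  -- (2/3)^(2h) = 1`.
  calc _ ≤ ∫⁻ ω, ∑ y ∈ Finset.univ.erase x, ((9 / 4 : ℝ≥0) : ℝ≥0∞) ^ h *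
        ((if out ω = List.ofFn y then (1 : ℝ≥0∞) else 0) *
          ((2 / 3 : ℝ≥0) : ℝ≥0∞) ^ score (source x ω).point (source x ω).lab (5 * h) y)
        ∂sampleMeasure n η := by
        refine (measure_mono fun ω hω => ?_).trans
          ((one_mul _).symm.le.trans (mul_meas_ge_le_lintegral ?_ 1))
        · obtain ⟨y, hy, ho, hs⟩ := hω
          rw [Set.mem_ofPred_eq]
          refine le_trans ?_ (Finset.single_le_sum (fun _ _ => zero_le)
            (Finset.mem_erase.2 ⟨hy, Finset.mem_univ y⟩))
          rw [if_pos ho, one_mul, ← h2]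
          exact mul_le_mul_right (pow_le_pow_of_le_one (zero_le) (by exact_mod_cast h1) hs) _
        · refine Finset.measurable_sum _ fun y _ => Measurable.const_mul ((hlocI y).measurable.mul ?_) _
          simp only [← prod_ite_score]
          exact (LocalOn.prod _ (hloc y)).measurable
    _ = ∑ y ∈ Finset.univ.erase x, ((9 / 4 : ℝ≥0) : ℝ≥0∞) ^ h *
        ((∫⁻ ω, (if out ω = List.ofFn y then (1 : ℝ≥0∞) else 0) ∂sampleMeasure n η) *
          ((5 / 6 : ℝ≥0) : ℝ≥0∞) ^ (5 * h)) := by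
        have hm (y : Fin n → ZMod 2) : Measurable fun ω : Sample n =>
            (if out ω = List.ofFn y then (1 : ℝ≥0∞) else 0) *
            ((2 / 3 : ℝ≥0) : ℝ≥0∞) ^ score (source x ω).point (source x ω).lab (5 * h) y := by
          simp only [← prod_ite_score]
          exact (hlocI y).measurable.mul (LocalOn.prod _ (hloc y)).measurable
        rw [lintegral_finsetSum _ fun y _ => (hm y).const_mul _]
        refine Finset.sum_congr rfl fun y hy => ?_
        rw [lintegral_const_mul _ (hm y), hI y (Finset.ne_of_mem_erase hy)]
    _ = (∫⁻ ω, ∑ y ∈ Finset.univ.erase x, (if out ω = List.ofFn y then (1 : ℝ≥0∞) else 0)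
          ∂sampleMeasure n η) * (((9 / 4 : ℝ≥0) : ℝ≥0∞) ^ h * ((5 / 6 : ℝ≥0) : ℝ≥0∞) ^ (5 * h)) := by
        rw [lintegral_finsetSum _ fun y _ => (hlocI y).measurable, Finset.sum_mul]
        exact Finset.sum_congr rfl fun y _ => by ring
    _ ≤ 1 * (((9 / 4 : ℝ≥0) : ℝ≥0∞) ^ h * ((5 / 6 : ℝ≥0) : ℝ≥0∞) ^ (5 * h)) := by
        refine mul_le_mul_left ?_ _
        refine (lintegral_mono (g := fun _ => 1) fun ω => ?_).trans_eq (by simp)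
        -- At most one vector is the candidate, so the sum of the indicators over all `y` costs a
        -- factor `1` instead of `2ⁿ`.
        by_cases he : ∃ y : Fin n → ZMod 2, out ω = List.ofFn y
        · obtain ⟨y, hy⟩ := he
          simp only [hy, List.ofFn_inj]
          rw [Finset.sum_ite_eq]
          split_ifs <;> simp
        · push Not at he
          simp [he]
    _ = _ := by
        rw [one_mul, ← ENNReal.coe_pow, ← ENNReal.coe_pow, ← ENNReal.coe_mul, pow_mul, ← mul_pow]

/-! ### Successful runs of the noise-free learner -/

/-- The runs of the learner on at most `s` examples and for at most `t` steps that output the hidden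
vector. -/
def Succeeds {n : ℕ} (A : Prog) (par : List ℕ) (s t : ℕ) (x : Fin n → ZMod 2) (ω : Source n) :
    Prop :=
  ∃ c τ, Exec ω A (State.init par) c τ ∧ c ≤ t ∧ τ.draws ≤ s ∧ τ.out = List.ofFn x

theorem Succeeds.congr {n : ℕ} {A : Prog} {par : List ℕ} {s t : ℕ} {x : Fin n → ZMod 2}
    {ω ω' : Source n} (h : Succeeds A par s t x ω) (hp : ∀ i < s, ω'.point i = ω.point i)
    (hl : ∀ i < s, ω'.lab i = ω.lab i) (hc : ∀ i < t, ω'.coin i = ω.coin i) :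
    Succeeds A par s t x ω' := by
  obtain ⟨c, τ, he, hct, hd, ho⟩ := h
  exact ⟨c, τ, he.congr_source hp hl hc hd (by simpa [State.init] using hct), hct, hd, ho⟩

/-- A run of at most `t` steps uses at most `t` coins. After cleaning, the labels are functions of
the points, so the event does not involve the noise either. -/
theorem localOn_succeeds {n : ℕ} (A : Prog) (par : List ℕ) (s t : ℕ) (x : Fin n → ZMod 2)
    (d e : ℕ) : LocalOn (fun ω : Sample n => Succeeds A par s t x (source x (shiftClean d e ω)))
      (Finset.Ico d (d + s)) (Finset.Ico e (e + t)) := by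
  have key : ∀ ω ω' : Sample n, (∀ i ∈ Finset.Ico d (d + s), ω.1 i = ω'.1 i) →
      (∀ i ∈ Finset.Ico e (e + t), ω.2.2 i = ω'.2.2 i) →
      Succeeds A par s t x (source x (shiftClean d e ω)) →
      Succeeds A par s t x (source x (shiftClean d e ω')) := by
    intro ω ω' h₁ h₃ h
    refine h.congr (fun i hi => ?_) (fun i hi => ?_) fun i hi => ?_
    · exact (h₁ (d + i) (Finset.mem_Ico.2 (by omega))).symm
    · simp [source, shiftClean, h₁ (d + i) (Finset.mem_Ico.2 (by omega))]
    · exact (h₃ (e + i) (Finset.mem_Ico.2 (by omega))).symm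
  exact fun ω ω' h₁ _ h₃ => propext ⟨key ω ω' h₁ h₃, key ω' ω (fun i hi => (h₁ i hi).symm)
    fun i hi => (h₃ i hi).symm⟩

/-- Almost surely there is a run within the bounds; by determinism it is the run that outputs a good
vector, and a good vector is `x`. Replacing the noise by zero changes nothing at rate `0` but puts
the event in a form that makes sense at every rate. -/
theorem Learns.measure_not_succeeds_le {n k : ℕ} {A : Prog} {par : List ℕ} {s t : ℕ} {δ : ℝ}
    (h : LearnsPAR A par n k δ s t) {x : Fin n → ZMod 2} (hx : hammingNorm x = k) :
    sampleMeasure n 0 {ω | ¬ Succeeds A par s t x (source x (shiftClean 0 0 ω))} ≤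
      ENNReal.ofReal δ := by
  have hm : MeasurableSet {ω : Sample n | Succeeds A par s t x (source x (shiftClean 0 0 ω))} :=
    measurableSet_setOfPred.2 (localOn_succeeds A par s t x 0 0).measurable
  have hms : MeasurableSet {ω : Sample n | Succeeds A par s t x (source x ω)} := by
    refine measurableSet_setOfPred.2 (LocalOn.measurable (S := Finset.range s) (T := Finset.range t)
      fun ω ω' h₁ h₂ h₃ => propext ⟨fun h => ?_, fun h => ?_⟩)
    · refine h.congr (fun i hi => ?_) (fun i hi => ?_) fun i hi => ?_
      · exact (h₁ i (Finset.mem_range.2 hi)).symm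
      · simp [source, h₁ i (Finset.mem_range.2 hi), h₂ i (Finset.mem_range.2 hi)]
      · exact (h₃ i (Finset.mem_range.2 hi)).symm
    · refine h.congr (fun i hi => ?_) (fun i hi => ?_) fun i hi => ?_
      · exact h₁ i (Finset.mem_range.2 hi)
      · simp [source, h₁ i (Finset.mem_range.2 hi), h₂ i (Finset.mem_range.2 hi)]
      · exact h₃ i (Finset.mem_range.2 hi)
  obtain ⟨hae, hpr⟩ := h x hx
  have hle : sampleMeasure n 0 {ω | ∃ c τ, Exec (source x ω) A (State.init par) c τ ∧
      ∃ y : Fin n → ZMod 2, τ.out = List.ofFn y ∧ disagreement x y < 1 / 2} ≤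
      sampleMeasure n 0 {ω | Succeeds A par s t x (source x ω)} := by
    refine measure_mono_ae ?_
    filter_upwards [hae] with ω hω hω'
    obtain ⟨c, τ, he, hc, hd⟩ := hω
    obtain ⟨c', τ', he', y, ho, hy⟩ := hω'
    obtain ⟨rfl, rfl⟩ := he.deterministic he'
    rw [eq_of_disagreement_lt hy] at ho
    exact ⟨c, τ, he, by exact_mod_cast hc, by exact_mod_cast hd, ho⟩
  have hpre := (measurePreserving_shiftClean (n := n) 0 0 0).measure_preimage
    hms.nullMeasurableSet
  have hcompl := prob_compl_eq_one_sub (μ := sampleMeasure n 0) hm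
  have h1 : ENNReal.ofReal (1 - δ) ≤ sampleMeasure n 0
      {ω | Succeeds A par s t x (source x (shiftClean 0 0 ω))} := by
    refine le_trans ?_ (hle.trans_eq hpre.symm)
    exact ENNReal.ofReal_le_of_le_toReal hpr
  change sampleMeasure n 0 {ω | Succeeds A par s t x (source x (shiftClean 0 0 ω))}ᶜ ≤ _
  rw [hcompl]
  refine tsub_le_iff_left.2 ?_
  calc (1 : ℝ≥0∞) = ENNReal.ofReal (1 - δ + δ) := by simp
    _ ≤ ENNReal.ofReal (1 - δ) + ENNReal.ofReal δ := ENNReal.ofReal_add_le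
    _ ≤ _ := add_le_add_left h1 _

theorem measure_not_succeeds_shift_le {n : ℕ} {A : Prog} {par : List ℕ} {s t : ℕ}
    {x : Fin n → ZMod 2} (η : unitInterval) (d e : ℕ) :
    sampleMeasure n η {ω | ¬ Succeeds A par s t x (source x (shiftClean d e ω))} ≤
      sampleMeasure n 0 {ω | ¬ Succeeds A par s t x (source x (shiftClean 0 0 ω))} := by
  have hm : MeasurableSet {ω : Sample n | ¬ Succeeds A par s t x (source x (shiftClean 0 0 ω))} :=
    measurableSet_setOfPred.2 ((localOn_succeeds A par s t x 0 0).comp Not).measurable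
  rw [← (measurePreserving_shiftClean η d e).measure_preimage hm.nullMeasurableSet]
  refine measure_mono fun ω hω => ?_
  have e : shiftClean 0 0 (shiftClean d e ω) = shiftClean d e ω := by
    simp [shiftClean]
  simp only [Set.mem_preimage, Set.mem_ofPred_eq] at hω ⊢
  rwa [e]

/-! ### The number of noise bits -/

/-- The number of noise bits among `s` examples from the one with number `d` on. -/
def noiseCount {n : ℕ} (d s : ℕ) (ω : Sample n) : ℕ :=
  ((Finset.range s).filter fun i => ω.2.1 (d + i) ≠ 0).card

theorem localOn_noiseCount {n : ℕ} (d s : ℕ) :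
    LocalOn (noiseCount d s : Sample n → ℕ) (Finset.Ico d (d + s)) ∅ := by
  intro ω ω' _ h₂ _
  refine congrArg Finset.card (Finset.filter_congr fun i hi => ?_)
  rw [h₂ _ (Finset.mem_Ico.2 (by have := Finset.mem_range.1 hi; omega))]

/-- Markov's inequality suffices: a round has to be good only with constant probability. -/
theorem mul_measure_le_noiseCount {n : ℕ} (η : unitInterval) (d s m : ℕ) :
    m * sampleMeasure n η {ω | m ≤ noiseCount d s ω} ≤ ENNReal.ofReal (s * η) := by
  have h := mul_meas_ge_le_lintegral (μ := sampleMeasure n η)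
    (((localOn_noiseCount d s).comp fun z : ℕ => (z : ℝ≥0∞)).measurable) m
  simp only [Nat.cast_le] at h
  refine h.trans_eq ?_
  have e (ω : Sample n) : (noiseCount d s ω : ℝ≥0∞) =
      ∑ i ∈ Finset.range s, if ω.2.1 (d + i) ≠ 0 then 1 else 0 := by
    rw [noiseCount, Finset.card_filter]
    push_cast
    rfl
  simp only [e]
  have hm (i : ℕ) : Measurable fun ω : Sample n =>
      if ω.2.1 (d + i) ≠ 0 then (1 : ℝ≥0∞) else 0 :=
    (localOn_example (fun _ b => if b ≠ 0 then (1 : ℝ≥0∞) else 0) (d + i)).measurable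
  rw [lintegral_finsetSum _ fun i _ => hm i]
  have hi (i : ℕ) := lintegral_noise (n := n) η (d + i) fun b => if b ≠ 0 then 1 else 0
  simp only [hi]
  simp [ENNReal.ofReal_mul]

/-! ### Rounds -/

/-- In the round with points from `d` on and coins from `e` on there is little noise, and the learner
succeeds on the correct labels. -/
def RoundGood {n : ℕ} (A : Prog) (par : List ℕ) (s t q : ℕ) (x : Fin n → ZMod 2) (d e : ℕ)
    (ω : Sample n) : Prop :=
  noiseCount d s ω ≤ 4 * s / q ∧ Succeeds A (n :: par) s t x (source x (shiftClean d e ω))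

theorem localOn_roundGood {n : ℕ} (A : Prog) (par : List ℕ) (s t q : ℕ) (x : Fin n → ZMod 2)
    (d e : ℕ) : LocalOn (RoundGood A par s t q x d e) (Finset.Ico d (d + s))
      (Finset.Ico e (e + t)) := by
  intro ω ω' h₁ h₂ h₃
  have h := localOn_succeeds A (n :: par) s t x d e ω ω' h₁ h₂ h₃
  simp only at h
  rw [RoundGood, RoundGood, localOn_noiseCount d s ω ω' h₁ h₂ (by simp), h]

/-- The word sought codes the actual noise of the round. Adding this noise once more cancels it in
characteristic two, so the learner sees the correct labels. -/
theorem RoundGood.exists_candidate {n : ℕ} {A : Prog} {par : List ℕ} {s t q : ℕ} (hq : 0 < q)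
    {x : Fin n → ZMod 2} {d e : ℕ} {ω : Sample n} (h : RoundGood A par s t q x d e ω) :
    ∃ v < (q + 1) ^ (5 * s / q),
      candidate A par (source x ω) s t q (5 * s / q) d e v = List.ofFn x := by
  obtain ⟨v, hv, hp⟩ := exists_wordPattern_eq_of_card_le hq (fun i => ω.2.1 (d + i)) h.1
  have hs : Succeeds A (n :: par) s t x (roundSource (source x ω) s t q (5 * s / q) d e v) := by
    refine h.2.congr (fun i hi => ?_) (fun i hi => ?_) fun i hi => ?_
    · simp [roundSource, source, shiftClean, hi]
    · simp only [roundSource, source, shiftClean, if_pos hi, hp i hi, Pi.zero_apply, add_zero]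
      rw [add_assoc, CharTwo.add_self_eq_zero, add_zero]
    · simp [roundSource, source, shiftClean, hi]
  obtain ⟨c, τ, he, hc, hd, ho⟩ := hs
  refine ⟨v, hv, ?_⟩
  have := he.crun_eq (S := s) (st := fun i σ => i.step
    (roundSource (source x ω) s t q (5 * s / q) d e v) σ) (fun _ _ _ => rfl) (t - c) hd
  rw [Nat.add_sub_cancel' hc] at this
  rw [candidate, this, ho]

/-- Since `roundSource` is zero beyond `s` examples and `t` coins, this holds for any behaviour of
the learner, and the candidates of a round are independent of the test examples. -/
theorem localOn_candidate {n : ℕ} (A : Prog) (par : List ℕ) (s t q D d e v : ℕ)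
    (x : Fin n → ZMod 2) : LocalOn (fun ω => candidate A par (source x ω) s t q D d e v)
      (Finset.Ico d (d + s)) (Finset.Ico e (e + t)) := by
  intro ω ω' h₁ h₂ h₃
  have h : roundSource (source x ω) s t q D d e v = roundSource (source x ω') s t q D d e v := by
    simp only [roundSource, Source.mk.injEq]
    refine ⟨funext fun i => ?_, funext fun i => ?_, funext fun i => ?_⟩
    · split_ifs with hi
      · exact h₁ _ (Finset.mem_Ico.2 (by omega))
      · rfl
    · split_ifs with hi
      · simp only [source, h₁ (d + i) (Finset.mem_Ico.2 (by omega)),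
          h₂ (d + i) (Finset.mem_Ico.2 (by omega))]
      · rfl
    · split_ifs with hi
      · exact h₃ _ (Finset.mem_Ico.2 (by omega))
      · rfl
  simp only [candidate, h]

/-- Failure probability `1/4` for the noise plus `1/2` for the learner. -/
theorem measure_not_roundGood_le {n : ℕ} {A : Prog} {par : List ℕ} {s t q : ℕ} (hq : 0 < q)
    {x : Fin n → ZMod 2} {η : unitInterval} (hη : (η : ℝ) * q ≤ 1)
    (hA : sampleMeasure n 0 {ω | ¬ Succeeds A (n :: par) s t x (source x (shiftClean 0 0 ω))} ≤
      ENNReal.ofReal (1 / 2)) (d e : ℕ) :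
    sampleMeasure n η {ω | ¬ RoundGood A par s t q x d e ω} ≤ ENNReal.ofReal (3 / 4) := by
  have hnoise : sampleMeasure n η {ω | 4 * s / q + 1 ≤ noiseCount d s ω} ≤
      ENNReal.ofReal (1 / 4) := by
    have h := mul_measure_le_noiseCount (n := n) η d s (4 * s / q + 1)
    rw [← ENNReal.ofReal_toReal (measure_ne_top (sampleMeasure n η) _), ← ENNReal.ofReal_natCast,
      ← ENNReal.ofReal_mul (Nat.cast_nonneg _), ENNReal.ofReal_le_ofReal_iff
        (mul_nonneg (Nat.cast_nonneg _) η.2.1)] at h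
    rw [← ENNReal.ofReal_toReal (measure_ne_top (sampleMeasure n η) _)]
    refine ENNReal.ofReal_le_ofReal ?_
    set p := (sampleMeasure n η {ω | 4 * s / q + 1 ≤ noiseCount d s ω}).toReal
    set m := 4 * s / q + 1 with hm
    -- With `ηq ≤ 1` this gives `sη ≤ m / 4`, so Markov's bound for at least `m = ⌊4s/q⌋ + 1` errors
    -- is `1/4`.
    have h4 : 4 * s < m * q := by
      rw [hm, mul_comm (4 * s / q + 1) q]
      exact Nat.lt_mul_div_succ _ hq
    have h4' : (4 * s : ℝ) ≤ m * q := by exact_mod_cast h4.le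
    have hm0 : (0 : ℝ) < m := by exact_mod_cast Nat.succ_pos _
    have h5 : (s * η : ℝ) ≤ m * (1 / 4) := by
      have := mul_le_mul_of_nonneg_right h4' η.2.1
      nlinarith
    exact le_of_mul_le_mul_left (h.trans h5) hm0
  have hsub : {ω : Sample n | ¬ RoundGood A par s t q x d e ω} ⊆
      {ω | 4 * s / q + 1 ≤ noiseCount d s ω} ∪
        {ω | ¬ Succeeds A (n :: par) s t x (source x (shiftClean d e ω))} := by
    intro ω hω
    simp only [Set.mem_ofPred_eq, RoundGood, not_and_or, not_le, Set.mem_union] at hω ⊢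
    exact hω
  refine (measure_mono hsub).trans ((measure_union_le _ _).trans ?_)
  refine (add_le_add hnoise ((measure_not_succeeds_shift_le η d e).trans hA)).trans_eq ?_
  rw [← ENNReal.ofReal_add (by norm_num) (by norm_num)]
  norm_num

theorem pairwiseDisjoint_Ico_add_mul (b s : ℕ) (R : Set ℕ) :
    R.PairwiseDisjoint fun r => Finset.Ico (b + r * s) (b + r * s + s) := by
  have key : ∀ i j z, i < j → z ∈ Finset.Ico (b + i * s) (b + i * s + s) →
      z ∉ Finset.Ico (b + j * s) (b + j * s + s) := by
    intro i j z hij hz hz'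
    rw [Finset.mem_Ico] at hz hz'
    have : (i + 1) * s ≤ j * s := Nat.mul_le_mul_right s hij
    rw [Nat.succ_mul] at this
    omega
  intro i _ j _ hij
  refine Finset.disjoint_left.2 fun z hz hz' => ?_
  rcases Nat.lt_or_gt_of_ne hij with h | h
  · exact key i j z h hz hz'
  · exact key j i z h hz' hz

/-- The rounds use disjoint blocks of examples and of coins, so the failure probabilities multiply.
-/
theorem measure_forall_not_roundGood_le {n : ℕ} {A : Prog} {par : List ℕ} {s t q : ℕ} (hq : 0 < q)
    {x : Fin n → ZMod 2} {η : unitInterval} (hη : (η : ℝ) * q ≤ 1)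
    (hA : sampleMeasure n 0 {ω | ¬ Succeeds A (n :: par) s t x (source x (shiftClean 0 0 ω))} ≤
      ENNReal.ofReal (1 / 2)) (M R : ℕ) :
    sampleMeasure n η {ω | ∀ r < R, ¬ RoundGood A par s t q x (M + r * s) (r * t) ω} ≤
      ENNReal.ofReal ((3 / 4) ^ R) := by
  classical
  have hloc : ∀ r ∈ Finset.range R, LocalOn (fun ω : Sample n =>
      if ¬ RoundGood A par s t q x (M + r * s) (r * t) ω then (1 : ℝ≥0∞) else 0)
      (Finset.Ico (M + r * s) (M + r * s + s)) (Finset.Ico (0 + r * t) (0 + r * t + t)) :=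
    fun r _ => by
      rw [zero_add]
      exact (localOn_roundGood A par s t q x (M + r * s) (r * t)).comp fun p : Prop =>
        if ¬ p then (1 : ℝ≥0∞) else 0
  have h := lintegral_prod_of_local η (Finset.range R) hloc (pairwiseDisjoint_Ico_add_mul M s _)
    (pairwiseDisjoint_Ico_add_mul 0 t _)
  have hmeas := (LocalOn.prod _ hloc).measurable
  calc _ ≤ ∫⁻ ω, ∏ r ∈ Finset.range R,
        (if ¬ RoundGood A par s t q x (M + r * s) (r * t) ω then (1 : ℝ≥0∞) else 0)
        ∂sampleMeasure n η := by
        refine (measure_mono fun ω hω => ?_).trans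
          ((one_mul _).symm.le.trans (mul_meas_ge_le_lintegral hmeas 1))
        rw [Set.mem_ofPred_eq] at hω ⊢
        rw [Finset.prod_congr rfl fun r hr => if_pos (hω r (Finset.mem_range.1 hr))]
        simp
    _ ≤ ∏ r ∈ Finset.range R, ENNReal.ofReal (3 / 4) := by
        rw [h]
        refine Finset.prod_le_prod' fun r hr => ?_
        refine le_trans (le_of_eq ?_) (measure_not_roundGood_le hq hη hA (M + r * s) (r * t))
        rw [← lintegral_indicator_one (measurableSet_setOfPred.2
          ((localOn_roundGood A par s t q x (M + r * s) (r * t)).comp Not).measurable)]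
        refine lintegral_congr fun ω => ?_
        by_cases hg : RoundGood A par s t q x (M + r * s) (r * t) ω <;> simp [Set.indicator, hg]
    _ = _ := by
        rw [Finset.prod_const, Finset.card_range, ENNReal.ofReal_pow (by norm_num)]

/-! ### The probability of failure -/

/-- The crude bound `q + 1 ≤ 2 ^ q` makes the count independent of `η`. It is enough for the union
bound, since the test size is a large multiple of `s * l`; the running time needs the sharper
`words_mul_sq_le`. -/
theorem candidates_le_two_pow {s l q : ℕ} (hs : 1 ≤ s) (hl : 1 ≤ l) :
    8 * l * (q + 1) ^ (5 * s / q) ≤ 2 ^ (9 * (s * l)) := by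
  have h1 : (q + 1) ^ (5 * s / q) ≤ 2 ^ (5 * s) := by
    calc (q + 1) ^ (5 * s / q) ≤ (2 ^ q) ^ (5 * s / q) :=
          Nat.pow_le_pow_left (Nat.lt_two_pow_self) _
      _ = 2 ^ (q * (5 * s / q)) := (pow_mul _ _ _).symm
      _ ≤ 2 ^ (5 * s) := Nat.pow_le_pow_right (by norm_num) (Nat.mul_div_le _ _)
  have h2 : l ≤ s * l := Nat.le_mul_of_pos_left l hs
  have h3 : s ≤ s * l := Nat.le_mul_of_pos_right s hl
  calc 8 * l * (q + 1) ^ (5 * s / q) ≤ 2 ^ 3 * 2 ^ l * 2 ^ (5 * s) :=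
        Nat.mul_le_mul (Nat.mul_le_mul (by norm_num) Nat.lt_two_pow_self.le) h1
    _ = 2 ^ (3 + l + 5 * s) := by rw [pow_add, pow_add]
    _ ≤ 2 ^ (9 * (s * l)) := Nat.pow_le_pow_right (by norm_num) (by omega)

theorem eighth_pow_le {l m : ℕ} (hl : 1 ≤ l) (hm : l ≤ m) :
    (1 / 8 : ℝ) ^ m ≤ 1 / 4 * (1 / 2) ^ l := by
  calc (1 / 8 : ℝ) ^ m ≤ (1 / 8) ^ l := pow_le_pow_of_le_one (by norm_num) (by norm_num) hm
    _ = (1 / 4) ^ l * (1 / 2) ^ l := by rw [← mul_pow]; norm_num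
    _ ≤ 1 / 4 * (1 / 2) ^ l := by
        refine mul_le_mul_of_nonneg_right ?_ (by positivity)
        exact (pow_le_pow_of_le_one (by norm_num) (by norm_num) hl).trans_eq (pow_one _)

/-- Three events cover all failures: `x` fails the test, some wrong candidate passes it, or no round
is good. Each has probability at most `(1/4)(1/2)^l`. -/
theorem measure_search_fails_le {n : ℕ} {A : Prog} {par : List ℕ} {s t l q : ℕ} (hs : 1 ≤ s)
    (hl : 1 ≤ l) (hq : 0 < q) {x : Fin n → ZMod 2} {η : unitInterval} (hη : (η : ℝ) * q ≤ 1)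
    (hη' : (η : ℝ) < 1 / 3)
    (hA : sampleMeasure n 0 {ω | ¬ Succeeds A (n :: par) s t x (source x (shiftClean 0 0 ω))} ≤
      ENNReal.ofReal (1 / 2)) :
    sampleMeasure n η {ω | ¬ (OnlyPasses A par (source x ω) s t q (5 * s / q) (testSize s l)
      (200 * (s * l)) (8 * l) x ∧
        Found A par (source x ω) s t q (5 * s / q) (testSize s l) (8 * l) x)} ≤
      ENNReal.ofReal ((1 / 2) ^ l) := by
  set D := 5 * s / q
  set h := 100 * (s * l) with hh
  have hM : testSize s l = 5 * h := by rw [testSize, hh]; ring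
  have hΘ : 200 * (s * l) = 2 * h := by rw [hh]; ring
  rw [hM, hΘ]
  let E : ℕ → ℕ → Set (Sample n) := fun r v => {ω | ∃ y : Fin n → ZMod 2, y ≠ x ∧
    candidate A par (source x ω) s t q D (5 * h + r * s) (r * t) v = List.ofFn y ∧
      score (source x ω).point (source x ω).lab (5 * h) y ≤ 2 * h}
  have hsub : {ω : Sample n | ¬ (OnlyPasses A par (source x ω) s t q D (5 * h) (2 * h) (8 * l) x ∧
        Found A par (source x ω) s t q D (5 * h) (8 * l) x)} ⊆
      {ω | 2 * h < score (source x ω).point (source x ω).lab (5 * h) x} ∪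
        (⋃ r ∈ Finset.range (8 * l), ⋃ v ∈ Finset.range ((q + 1) ^ D), E r v) ∪
        {ω | ∀ r < 8 * l, ¬ RoundGood A par s t q x (5 * h + r * s) (r * t) ω} := by
    intro ω hω
    rw [Set.mem_ofPred_eq] at hω
    by_contra hcon
    simp only [Set.mem_union, Set.mem_ofPred_eq, Set.mem_iUnion, not_or, not_exists, not_lt,
      not_forall, not_not, Finset.mem_range, E, not_and] at hcon
    obtain ⟨⟨h1, h2⟩, r, hr, hg⟩ := hcon
    refine hω ⟨⟨h1, ?_⟩, ?_⟩
    · rintro y ⟨r', hr', v, hv, hc⟩ hy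
      by_contra hxy
      exact absurd hy (h2 r' hr' v hv y hxy hc)
    · obtain ⟨v, hv, hc⟩ := hg.exists_candidate hq
      exact ⟨r, hr, v, hv, hc⟩
  have hE : ∀ r v, sampleMeasure n η (E r v) ≤
      (((9 / 4 * (5 / 6) ^ 5 : ℝ≥0) ^ h : ℝ≥0) : ℝ≥0∞) := by
    intro r v
    refine measure_exists_score_le η x h (localOn_candidate A par s t q D _ _ v x) ?_
    refine Finset.disjoint_left.2 fun z hz hz' => ?_
    rw [Finset.mem_range] at hz
    rw [Finset.mem_Ico] at hz'
    omega
  have hU : sampleMeasure n η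
      (⋃ r ∈ Finset.range (8 * l), ⋃ v ∈ Finset.range ((q + 1) ^ D), E r v) ≤
      ((8 * l * (q + 1) ^ D : ℕ) : ℝ≥0∞) * (((9 / 4 * (5 / 6) ^ 5 : ℝ≥0) ^ h : ℝ≥0) : ℝ≥0∞) := by
    refine (measure_biUnion_finset_le _ _).trans ?_
    refine (Finset.sum_le_sum fun r _ => (measure_biUnion_finset_le _ _).trans
      (Finset.sum_le_sum fun v _ => hE r v)).trans_eq ?_
    simp only [Finset.sum_const, Finset.card_range, nsmul_eq_mul]
    push_cast
    ring
  have hm : l ≤ s * l := Nat.le_mul_of_pos_left l hs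
  -- The factor `100` in `h` makes the hundredth power of the base less than `1/8`.
  have b1 : (((9 / 16 * (10 / 9) ^ 5 : ℝ≥0) ^ h : ℝ≥0) : ℝ≥0∞) ≤
      ENNReal.ofReal (1 / 4 * (1 / 2) ^ l) := by
    rw [← ENNReal.ofReal_coe_nnreal]
    refine ENNReal.ofReal_le_ofReal (le_trans ?_ (eighth_pow_le hl hm))
    push_cast
    rw [hh, pow_mul]
    exact pow_le_pow_left₀ (by positivity) (by norm_num) _
  have b2 : ((8 * l * (q + 1) ^ D : ℕ) : ℝ≥0∞) *
      (((9 / 4 * (5 / 6) ^ 5 : ℝ≥0) ^ h : ℝ≥0) : ℝ≥0∞) ≤ ENNReal.ofReal (1 / 4 * (1 / 2) ^ l) := by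
    rw [← ENNReal.ofReal_coe_nnreal, ← ENNReal.ofReal_natCast, ← ENNReal.ofReal_mul (by positivity)]
    refine ENNReal.ofReal_le_ofReal (le_trans ?_ (eighth_pow_le hl hm))
    have hN : ((8 * l * (q + 1) ^ D : ℕ) : ℝ) ≤ (2 ^ 9) ^ (s * l) := by
      rw [← pow_mul]
      exact_mod_cast candidates_le_two_pow hs hl
    -- Against `2^(9sl)` candidates, `2^(-12sl)` leaves `(1/8)^(sl)`.
    have hb : (((9 / 4 * (5 / 6) ^ 5 : ℝ≥0) ^ h : ℝ≥0) : ℝ) ≤ (1 / 2 ^ 12) ^ (s * l) := by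
      push_cast
      rw [hh, pow_mul]
      exact pow_le_pow_left₀ (by positivity) (by norm_num) _
    refine (mul_le_mul hN hb (by positivity) (by positivity)).trans_eq ?_
    rw [← mul_pow]
    norm_num
  have b3 : ENNReal.ofReal ((3 / 4) ^ (8 * l)) ≤ ENNReal.ofReal (1 / 4 * (1 / 2) ^ l) := by
    refine ENNReal.ofReal_le_ofReal (le_trans ?_ (eighth_pow_le hl le_rfl))
    rw [pow_mul]
    exact pow_le_pow_left₀ (by positivity) (by norm_num) _
  refine (measure_mono hsub).trans ((measure_union_le _ _).trans ?_)
  refine (add_le_add ((measure_union_le _ _).trans (add_le_add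
    ((measure_lt_score_le η hη' x h).trans b1) (hU.trans b2)))
    ((measure_forall_not_roundGood_le hq hη hA (5 * h) (8 * l)).trans b3)).trans ?_
  rw [← ENNReal.ofReal_add (by positivity) (by positivity),
    ← ENNReal.ofReal_add (by positivity) (by positivity)]
  refine ENNReal.ofReal_le_ofReal ?_
  have : (0 : ℝ) ≤ (1 / 2) ^ l := by positivity
  linarith

/-- If none of the first `s` labels is wrong, the noisy run is the noise-free run. The two failures,
a wrong label and an unsuccessful learner, cost `δ` each. -/
theorem measure_not_succeeds_noisy_le {n : ℕ} {A : Prog} {par : List ℕ} {s t : ℕ}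
    {x : Fin n → ZMod 2} {η : unitInterval} {δ : ℝ} (hδ : 0 ≤ δ) (hη : (η : ℝ) * s ≤ δ)
    (hA : sampleMeasure n 0 {ω | ¬ Succeeds A par s t x (source x (shiftClean 0 0 ω))} ≤
      ENNReal.ofReal δ) :
    sampleMeasure n η {ω | ¬ Succeeds A par s t x (source x ω)} ≤ ENNReal.ofReal (2 * δ) := by
  have hsub : {ω : Sample n | ¬ Succeeds A par s t x (source x ω)} ⊆
      {ω | 1 ≤ noiseCount 0 s ω} ∪
        {ω | ¬ Succeeds A par s t x (source x (shiftClean 0 0 ω))} := by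
    intro ω hω
    by_contra hcon
    simp only [Set.mem_union, Set.mem_ofPred_eq, not_or, not_le, not_not, Nat.lt_one_iff,
      noiseCount, Finset.card_eq_zero, Finset.filter_eq_empty_iff, Finset.mem_range,
      zero_add] at hcon
    refine hω (hcon.2.congr (fun i _ => ?_) (fun i hi => ?_) fun i _ => ?_)
    · simp [source, shiftClean]
    · simp [source, shiftClean, hcon.1 hi]
    · simp [source, shiftClean]
  have h1 := mul_measure_le_noiseCount (n := n) η 0 s 1
  rw [Nat.cast_one, one_mul] at h1
  refine (measure_mono hsub).trans ((measure_union_le _ _).trans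
    ((add_le_add (h1.trans (ENNReal.ofReal_le_ofReal ((mul_comm _ _).trans_le hη)))
      ((measure_not_succeeds_shift_le η 0 0).trans hA)).trans_eq ?_))
  rw [← ENNReal.ofReal_add hδ hδ, two_mul]

/-- A program that always halts in time and outputs the hidden vector except on an event of small
probability learns. -/
theorem learns_of_runs {n k : ℕ} {P : Prog} {par : List ℕ} {η : unitInterval} {δ S T : ℝ}
    (h : ∀ x : Fin n → ZMod 2, hammingNorm x = k → ∃ G : Set (Sample n),
      sampleMeasure n η Gᶜ ≤ ENNReal.ofReal δ ∧
      ∀ ω, ∃ B : ℕ, (B : ℝ) ≤ T ∧ Runs (source x ω) P (State.init par) B fun τ =>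
        (τ.draws : ℝ) ≤ S ∧ (ω ∈ G → τ.out = List.ofFn x)) (hδ : 0 ≤ δ) :
    SolvesLPN P par n k η δ S T := by
  intro x hx
  obtain ⟨G, hG, hr⟩ := h x hx
  refine ⟨Filter.Eventually.of_forall fun ω => ?_, ?_⟩
  · obtain ⟨B, hB, c, τ, he, hc, hd, -⟩ := hr ω
    exact ⟨c, τ, he, le_trans (by exact_mod_cast hc) hB, hd⟩
  · have hsub : G ⊆ {ω | ∃ c τ, Exec (source x ω) P (State.init par) c τ ∧
        ∃ y : Fin n → ZMod 2, τ.out = List.ofFn y ∧ disagreement x y < 1 / 2} := by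
      intro ω hω
      obtain ⟨B, -, c, τ, he, -, -, ho⟩ := hr ω
      exact ⟨c, τ, he, x, ho hω, by rw [disagreement_self]; norm_num⟩
    refine le_trans ?_ (measureReal_mono hsub)
    have h1 : (1 : ℝ≥0∞) ≤ sampleMeasure n η G + ENNReal.ofReal δ := by
      refine le_trans ?_ (add_le_add_right hG _)
      rw [← measure_univ (μ := sampleMeasure n η), ← Set.union_compl_self G]
      exact measure_union_le _ _
    have h2 := ENNReal.toReal_mono
      (ENNReal.add_ne_top.2 ⟨measure_ne_top _ _, ENNReal.ofReal_ne_top⟩) h1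
    rw [ENNReal.toReal_add (measure_ne_top _ _) ENNReal.ofReal_ne_top, ENNReal.toReal_ofReal hδ,
      ENNReal.toReal_one] at h2
    rw [measureReal_def]
    linarith

/-! ### Running time, entropy and the final choice of constants -/

/-! ### Bounds on the costs -/

theorem wordCost_le (A : Prog) {n s t D m : ℕ} {l : ℕ} (hs : s ≤ m) (hn : n ≤ t) (hD : D ≤ 5 * m)
    (hm : 1 ≤ m) (ht : 1 ≤ t) (hl : s * l = m) :
    wordCost A n s t D (testSize s l) ≤ (A.bound + 2 * simCost 5 A + 8700) * (m * t) := by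
  rw [wordCost, testSize, hl]
  have h1 : m ≤ m * t := Nat.le_mul_of_pos_right m ht
  have h2 : t ≤ m * t := Nat.le_mul_of_pos_left t hm
  have h3 : m * n ≤ m * t := Nat.mul_le_mul_left m hn
  have h4 : simCost 5 A * t ≤ simCost 5 A * (m * t) := Nat.mul_le_mul_left _ h2
  have h5 : simCost 5 A * 1 ≤ simCost 5 A * (m * t) := Nat.mul_le_mul_left _ (hm.trans h1)
  have h6 : A.bound * 1 ≤ A.bound * (m * t) := Nat.mul_le_mul_left _ (hm.trans h1)
  have e1 : 500 * m * (n * 9 + 7 + 1) = 4500 * (m * n) + 4000 * m := by ring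
  have e2 : (A.bound + 2 * simCost 5 A + 8700) * (m * t) =
      A.bound * (m * t) + 2 * (simCost 5 A * (m * t)) + 8700 * (m * t) := by ring
  have e3 : simCost 5 A * (t + 1) = simCost 5 A * t + simCost 5 A * 1 := by ring
  rw [e1, e2, e3]
  omega

/-- Each of the `8l` rounds processes every word, and a word costs `O(m t)`: the test reads `500 m
n` bits with `n ≤ t`. With `l ≤ m` this gives the factor `m²`. -/
theorem searchCost_le (A : Prog) {n s t l q : ℕ} (hn : n ≤ t) (hs : 1 ≤ s) (hl : 1 ≤ l)
    (ht : 1 ≤ t) : searchCost A n s t l q ≤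
      8 * (A.bound + 2 * simCost 5 A + 10000) * ((q + 1) ^ (5 * s / q) * (s * l) ^ 2 * t) := by
  set N := (q + 1) ^ (5 * s / q) with hN
  set m := s * l with hm
  have hN1 : 1 ≤ N := Nat.one_le_pow _ _ (Nat.succ_pos q)
  have hsm : s ≤ m := Nat.le_mul_of_pos_right s hl
  have hlm : l ≤ m := Nat.le_mul_of_pos_left l hs
  have hm1 : 1 ≤ m := hs.trans hsm
  have hD : 5 * s / q ≤ 5 * m := (Nat.div_le_self _ _).trans (by omega)
  have hw := wordCost_le A hsm hn hD hm1 ht hm.symm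
  set W := A.bound + 2 * simCost 5 A + 8700 with hW
  have h1 : m ≤ m * t := Nat.le_mul_of_pos_right m ht
  have h2 : t ≤ m * t := Nat.le_mul_of_pos_left t hm1
  have h3 : s * n ≤ m * t := Nat.mul_le_mul hsm hn
  have h4 : m * t ≤ N * (m * t) := Nat.le_mul_of_pos_left _ hN1
  have h5 : N * 1 ≤ N * (m * t) := Nat.mul_le_mul_left _ (hm1.trans h1)
  have hr : roundCost A n s t q (5 * s / q) (testSize s l) ≤ (W + 60) * (N * (m * t)) := by
    rw [roundCost, ← hN]
    have e1 : s * (n * 6 + 8 + 1) = 6 * (s * n) + 9 * s := by ring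
    have e2 : N * (wordCost A n s t (5 * s / q) (testSize s l) + 1) ≤
        W * (N * (m * t)) + N * 1 := by
      calc _ ≤ N * (W * (m * t) + 1) := Nat.mul_le_mul_left _ (Nat.add_le_add_right hw 1)
        _ = _ := by ring
    have e3 : (W + 60) * (N * (m * t)) = W * (N * (m * t)) + 60 * (N * (m * t)) := by ring
    rw [e1, e3]
    omega
  have h6 : m * n ≤ m * t := Nat.mul_le_mul_left m hn
  have h7 : N * (m * t) ≤ N * m ^ 2 * t := by
    calc N * (m * t) = N * m * t * 1 := by ring
      _ ≤ N * m * t * m := Nat.mul_le_mul_left _ hm1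
      _ = _ := by ring
  have h8 : 8 * l * (roundCost A n s t q (5 * s / q) (testSize s l) + 1) ≤
      8 * (W + 61) * (N * m ^ 2 * t) := by
    calc _ ≤ 8 * m * ((W + 60) * (N * (m * t)) + N * (m * t)) :=
          Nat.mul_le_mul (by omega) (Nat.add_le_add hr (by omega))
      _ = _ := by ring
  have e4 : testSize s l * (n * 6 + 8 + 1) = 3000 * (m * n) + 4500 * m := by
    rw [testSize, ← hm]
    ring
  have e5 : 8 * (A.bound + 2 * simCost 5 A + 10000) * (N * m ^ 2 * t) =
      8 * (W + 61) * (N * m ^ 2 * t) + 9912 * (N * m ^ 2 * t) := by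
    rw [hW]
    ring
  rw [searchCost, e4, e5]
  omega

/-! ### Real estimates -/

theorem le_two_rpow {z : ℝ} (hz : 0 ≤ z) : z ≤ 2 ^ z := by
  have h1 : (⌊z⌋₊ : ℝ) + 1 ≤ 2 ^ ⌊z⌋₊ := by exact_mod_cast (Nat.lt_two_pow_self : ⌊z⌋₊ < _)
  calc z ≤ ⌊z⌋₊ + 1 := (Nat.lt_floor_add_one z).le
    _ ≤ 2 ^ ⌊z⌋₊ := h1
    _ = (2 : ℝ) ^ (⌊z⌋₊ : ℝ) := (Real.rpow_natCast 2 _).symm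
    _ ≤ 2 ^ z := Real.rpow_le_rpow_of_exponent_le (by norm_num) (Nat.floor_le hz)

theorem logb_one_div_eq {η : ℝ} (hη : 0 < η) : (2 : ℝ) ^ Real.logb 2 (1 / η) = 1 / η :=
  Real.rpow_logb (by norm_num) (by norm_num) (by positivity)

/-- For `η ≤ 4/9` one has `1/η ≤ (2/(3η))²`, so passing from `η` to `3η/2` at most halves the
logarithm; the second term of the entropy is nonnegative. -/
theorem le_entropy {η : ℝ} (hη : 0 < η) (hη' : η < 1 / 3) :
    η * Real.logb 2 (1 / η) ≤ 2 * entropy (3 * η / 2) := by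
  have h1 : 0 ≤ (1 - 3 * η / 2) * Real.logb 2 (1 / (1 - 3 * η / 2)) := by
    refine mul_nonneg (by linarith) (Real.logb_nonneg (by norm_num) ?_)
    rw [le_div_iff₀ (by linarith)]
    linarith
  have h2 : Real.logb 2 (1 / η) ≤ 2 * Real.logb 2 (1 / (3 * η / 2)) := by
    rw [← Real.logb_rpow_eq_mul_logb_of_pos (by positivity)]
    refine Real.logb_le_logb_of_le (by norm_num) (by positivity) ?_
    rw [show (2 : ℝ) = ((2 : ℕ) : ℝ) by norm_num, Real.rpow_natCast, div_pow, div_le_div_iff₀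
      (by positivity) (by positivity)]
    push_cast
    nlinarith
  have h3 : 0 ≤ Real.logb 2 (1 / (3 * η / 2)) := by
    refine Real.logb_nonneg (by norm_num) ?_
    rw [le_div_iff₀ (by linarith)]
    linarith
  rw [entropy]
  nlinarith

theorem one_le_logb_inv {η : ℝ} (hη : 0 < η) (hη' : η < 1 / 3) : 1 ≤ Real.logb 2 (1 / η) := by
  rw [Real.le_logb_iff_rpow_le (by norm_num) (by positivity), Real.rpow_one,
    le_div_iff₀ hη]
  linarith

/-- The number of words and the test size are bounded by the exponential of the entropy. -/
theorem words_mul_sq_le {η : ℝ} (hη : 0 < η) (hη' : η < 1 / 3) {s m c q : ℕ}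
    (hq : q = ⌊1 / η⌋₊) (hqm : q ≤ c * m) :
    ((q + 1 : ℕ) : ℝ) ^ (5 * s / q) * (m : ℝ) ^ 2 ≤
      2 ^ (40 * (entropy (3 * η / 2) * s) + (4 + 8 * c) * (entropy (3 * η / 2) * m)) := by
  set lam := Real.logb 2 (1 / η) with hlam
  have hl1 : 1 ≤ lam := one_le_logb_inv hη hη'
  have hH : η * lam ≤ 2 * entropy (3 * η / 2) := le_entropy hη hη'
  have hpow : (2 : ℝ) ^ lam = 1 / η := logb_one_div_eq hη
  set H := entropy (3 * η / 2)
  have h3 : (3 : ℝ) ≤ 1 / η := by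
    rw [le_div_iff₀ hη]
    linarith
  have hq3 : 3 ≤ q := by
    rw [hq]
    exact Nat.le_floor (by exact_mod_cast h3)
  have hq3' : (3 : ℝ) ≤ q := by exact_mod_cast hq3
  have hqlt : 1 / η < q + 1 := by
    rw [hq]
    exact Nat.lt_floor_add_one _
  have hqle : (q : ℝ) ≤ 1 / η := by
    rw [hq]
    exact Nat.floor_le (by positivity)
  -- From `1/η < q + 1 ≤ 2q`: rounding `1/η` down loses at most a factor `2`.
  have hηq : 1 ≤ 2 * (η * q) := by
    rw [div_lt_iff₀ hη] at hqlt
    nlinarith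
  -- Here `q + 1 ≤ (1/η)²` and there are at most `10 s η` digits, so the exponent is at most `20 s η
  -- log₂(1/η)`, hence at most `40 H s`.
  have hN : ((q + 1 : ℕ) : ℝ) ^ (5 * s / q) ≤ 2 ^ (40 * (H * s)) := by
    have hb : ((q + 1 : ℕ) : ℝ) ≤ 2 ^ (2 * lam) := by
      rw [mul_comm, Real.rpow_mul (by norm_num), hpow]
      push_cast
      rw [show (2 : ℝ) = ((2 : ℕ) : ℝ) by norm_num, Real.rpow_natCast]
      nlinarith
    have hD : ((5 * s / q : ℕ) : ℝ) ≤ 10 * (s * η) := by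
      refine Nat.cast_div_le.trans ?_
      rw [div_le_iff₀ (by linarith)]
      push_cast
      have : (0 : ℝ) ≤ s := Nat.cast_nonneg s
      nlinarith
    calc _ ≤ ((2 : ℝ) ^ (2 * lam)) ^ (5 * s / q) := pow_le_pow_left₀ (Nat.cast_nonneg _) hb _
      _ = 2 ^ (2 * lam * ((5 * s / q : ℕ) : ℝ)) := by
          rw [Real.rpow_mul_natCast (by norm_num)]
      _ ≤ _ := by
          refine Real.rpow_le_rpow_of_exponent_le (by norm_num) ?_
          have hs0 : (0 : ℝ) ≤ s := Nat.cast_nonneg s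
          have h1 := mul_le_mul_of_nonneg_left hD (by linarith : (0 : ℝ) ≤ 2 * lam)
          have h2 := mul_le_mul_of_nonneg_left hH hs0
          linarith
  -- Write `m = (ηm)(1/η) ≤ 2^(ηm + lam)`. Since `q ≤ c m` gives `1 ≤ 2c·ηm`, both summands are at
  -- most a multiple of `ηm·lam`. Without this lower bound on `ηm` the polynomial factor could not
  -- be absorbed.
  have hm : (m : ℝ) ≤ 2 ^ ((2 + 4 * c) * (H * m)) := by
    have hm0 : (0 : ℝ) ≤ m := Nat.cast_nonneg m
    have hqm' : (q : ℝ) ≤ c * m := by exact_mod_cast hqm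
    have h1 : (m : ℝ) = η * m * (1 / η) := by field_simp
    have h2 : lam ≤ 2 * c * (η * m * lam) := by
      have h4 : 1 ≤ 2 * (η * (c * m)) := hηq.trans (by gcongr)
      nlinarith
    calc (m : ℝ) = η * m * (1 / η) := h1
      _ ≤ 2 ^ (η * m) * 2 ^ lam := by
          rw [hpow]
          exact mul_le_mul_of_nonneg_right (le_two_rpow (by positivity)) (by positivity)
      _ = 2 ^ (η * m + lam) := (Real.rpow_add (by norm_num) _ _).symm
      _ ≤ _ := by
          refine Real.rpow_le_rpow_of_exponent_le (by norm_num) ?_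
          have h5 : η * m ≤ η * m * lam := le_mul_of_one_le_right (by positivity) hl1
          have h6 : (1 + 2 * (c : ℝ)) * (m * (η * lam)) ≤ (1 + 2 * c) * (m * (2 * H)) := by gcongr
          linarith
  calc _ ≤ (2 : ℝ) ^ (40 * (H * s)) * (2 ^ ((2 + 4 * c) * (H * m))) ^ 2 :=
        mul_le_mul hN (pow_le_pow_left₀ (Nat.cast_nonneg _) hm 2) (by positivity) (by positivity)
    _ = _ := by
        rw [← Real.rpow_mul_natCast (by norm_num), ← Real.rpow_add (by norm_num)]
        congr 1
        push_cast
        ring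

/-! ### The noisy problem -/

/-- With positive probability the learner writes `n` bits within `t` steps. This bounds the cost of
handling points in terms of `t`. -/
theorem Learns.length_le {n k : ℕ} {A : Prog} {par : List ℕ} {s t : ℕ} {δ : ℝ} (hδ : δ < 1)
    (h : LearnsPAR A par n k δ s t) {x : Fin n → ZMod 2} (hx : hammingNorm x = k) :
    n ≤ t ∧ 1 ≤ t := by
  have hlt : sampleMeasure n 0 {ω | ¬ Succeeds A par s t x (source x (shiftClean 0 0 ω))} < 1 :=
    (Learns.measure_not_succeeds_le h hx).trans_lt (by
      rw [← ENNReal.ofReal_one]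
      exact (ENNReal.ofReal_lt_ofReal_iff one_pos).2 hδ)
  have hne : {ω : Sample n | ¬ Succeeds A par s t x (source x (shiftClean 0 0 ω))} ≠ Set.univ := by
    intro he
    rw [he, measure_univ] at hlt
    exact lt_irrefl _ hlt
  obtain ⟨ω, hω⟩ := (Set.ne_univ_iff_exists_notMem _).1 hne
  rw [Set.mem_ofPred_eq, not_not] at hω
  obtain ⟨c, τ, he, hc, -, ho⟩ := hω
  have h1 := he.out_length_le
  rw [ho, List.length_ofFn] at h1
  simp only [State.init, List.length_nil, zero_add] at h1
  exact ⟨h1.trans hc, he.cost_pos.trans hc⟩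

theorem entropy_nonneg {p : ℝ} (hp : 0 < p) (hp' : p < 1) : 0 ≤ entropy p := by
  have h1 : 0 ≤ Real.logb 2 (1 / p) := Real.logb_nonneg (by norm_num) (by
    rw [le_div_iff₀ hp]
    linarith)
  have h2 : 0 ≤ Real.logb 2 (1 / (1 - p)) := Real.logb_nonneg (by norm_num) (by
    rw [le_div_iff₀ (by linarith)]
    linarith)
  exact add_nonneg (mul_nonneg hp.le h1) (mul_nonneg (by linarith) h2)

/-- Few noise bits are expected: the learner is run once. -/
theorem solvesLPN_of_lt {A : Prog} {n k s t c l q : ℕ} {par : List ℕ} {δ T S : ℝ}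
    {η : unitInterval} (hA : LearnsPAR A (n :: par) n k (δ / 2) s t) (hδ : 0 < δ) (hδ1 : δ < 1)
    (hq : c * (s * l) < q) (hη : (η : ℝ) * s ≤ δ / 2) (hS : (s : ℝ) ≤ S)
    (hT : 1 ≤ t → ((2 * A.bound + c + 16 + 2 * simCost 4 A : ℕ) : ℝ) * t + 3 * s ≤ T) :
    SolvesLPN (noisyProg c A) (n :: s :: t :: l :: q :: par) n k η δ S T := by
  refine learns_of_runs (fun x hx => ⟨{ω | Succeeds A (n :: par) s t x (source x ω)}, ?_,
    fun ω => ⟨_, ?_, (noisyProg_runs_once c A (source x ω) s t l q par hq).mono le_rfl ?_⟩⟩) hδ.le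
  · have := measure_not_succeeds_noisy_le (by linarith) hη (Learns.measure_not_succeeds_le hA hx)
    rwa [mul_div_cancel₀ δ two_ne_zero] at this
  · have ht := (Learns.length_le (by linarith) hA hx).2
    refine le_trans ?_ (hT ht)
    have h1 : A.bound * 1 ≤ A.bound * t := Nat.mul_le_mul_left _ ht
    have h2 : c * 1 ≤ c * t := Nat.mul_le_mul_left _ ht
    have h3 : simCost 4 A * 1 ≤ simCost 4 A * t := Nat.mul_le_mul_left _ ht
    have h4 : startCost c A s + (A.bound + 5 + simCost 4 A * (t + 1) + 1) ≤
        (2 * A.bound + c + 16 + 2 * simCost 4 A) * t + 3 * s := by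
      have e : (2 * A.bound + c + 16 + 2 * simCost 4 A) * t =
        2 * (A.bound * t) + c * t + 16 * t + 2 * (simCost 4 A * t) := by ring
      have e' : simCost 4 A * (t + 1) = simCost 4 A * t + simCost 4 A * 1 := by ring
      rw [startCost, e, e']
      omega
    exact_mod_cast h4
  · rintro τ ⟨hd, ho⟩
    refine ⟨le_trans (by exact_mod_cast hd) hS, fun hω => ?_⟩
    obtain ⟨c', τ', he, hc, hd', ho'⟩ := hω
    rw [ho c' τ' he hc hd', ho']

/-- Many noise bits are expected: the program searches for the errors. -/
theorem solvesLPN_of_le {A : Prog} {n k s t c l q : ℕ} {par : List ℕ} {δ T S : ℝ}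
    {η : unitInterval} (hA : LearnsPAR A (n :: par) n k (δ / 2) s t) (hδ : 0 < δ) (hδ1 : δ < 1)
    (hq0 : 0 < q) (hq : q ≤ c * (s * l)) (hηq : (η : ℝ) * q ≤ 1) (hη : (η : ℝ) < 1 / 3)
    (hl : (1 / 2 : ℝ) ^ l ≤ δ) (hS : 508 * ((s * l : ℕ) : ℝ) ≤ S)
    (hT : ((8 * (A.bound + 2 * simCost 5 A + 10000) + A.bound + c + 14 : ℕ) : ℝ) *
      (((q + 1 : ℕ) : ℝ) ^ (5 * s / q) * ((s * l : ℕ) : ℝ) ^ 2 * t) ≤ T) :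
    SolvesLPN (noisyProg c A) (n :: s :: t :: l :: q :: par) n k η δ S T := by
  have hpos : 0 < c * (s * l) := hq0.trans_le hq
  have hs1 : 1 ≤ s := Nat.pos_of_ne_zero fun h => by simp [h] at hpos
  have hl1 : 1 ≤ l := Nat.pos_of_ne_zero fun h => by simp [h] at hpos
  refine learns_of_runs (fun x hx => ⟨{ω | OnlyPasses A par (source x ω) s t q (5 * s / q)
    (testSize s l) (200 * (s * l)) (8 * l) x ∧
      Found A par (source x ω) s t q (5 * s / q) (testSize s l) (8 * l) x}, ?_,
    fun ω => ⟨_, ?_, (noisyProg_runs_search c A (source x ω) s t l q par hq hq0).mono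
      le_rfl ?_⟩⟩) hδ.le
  -- The search uses only that the learner fails with probability at most `1/2`; the confidence `δ`
  -- comes from the repetition.
  · refine (measure_search_fails_le hs1 hl1 hq0 hηq hη
      ((Learns.measure_not_succeeds_le hA hx).trans ?_)).trans (ENNReal.ofReal_le_ofReal hl)
    exact ENNReal.ofReal_le_ofReal (by linarith)
  · obtain ⟨hn, ht⟩ := Learns.length_le (by linarith) hA hx
    refine le_trans ?_ hT
    have h1 := searchCost_le A (q := q) hn hs1 hl1 ht
    set X := (q + 1) ^ (5 * s / q) * (s * l) ^ 2 * t with hX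
    have hsX : s ≤ X := by
      calc s ≤ s * l := Nat.le_mul_of_pos_right s hl1
        _ = 1 * (s * l) ^ 1 * 1 := by ring
        _ ≤ X := Nat.mul_le_mul (Nat.mul_le_mul (Nat.one_le_pow _ _ (Nat.succ_pos q))
          (Nat.pow_le_pow_right (Nat.mul_pos hs1 hl1) (by norm_num))) ht
    have h2 : A.bound * 1 ≤ A.bound * X := Nat.mul_le_mul_left _ (hs1.trans hsX)
    have h3 : c * 1 ≤ c * X := Nat.mul_le_mul_left _ (hs1.trans hsX)
    have h4 : startCost c A s + (searchCost A n s t l q + 1) ≤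
        (8 * (A.bound + 2 * simCost 5 A + 10000) + A.bound + c + 14) * X := by
      have e : (8 * (A.bound + 2 * simCost 5 A + 10000) + A.bound + c + 14) * X =
        8 * (A.bound + 2 * simCost 5 A + 10000) * X + A.bound * X + c * X + 14 * X := by ring
      rw [startCost, e]
      omega
    exact_mod_cast h4
  · rintro τ ⟨hd, ho⟩
    refine ⟨le_trans (le_of_eq ?_) hS, fun hω => ho x hω.1 hω.2⟩
    rw [hd, testSize]
    push_cast
    ring

/-- With `c = ⌈1/ρ⌉` the program's own comparison decides correctly: running once is chosen only if
`ηs ≤ δ/2` is guaranteed, and the search only if `ηm` is bounded below in terms of `ρ`. -/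
theorem exists_solvesLPN {ρ : ℝ} (hρ : 0 < ρ) (hρ1 : ρ < 1) :
    ∃ C : ℝ, 0 < C ∧ ∀ A : Prog, ∃ (A' : Prog) (K : ℝ), 0 < K ∧
      ∀ (n k s t : ℕ) (par : List ℕ) (δ : ℝ) (η : unitInterval),
        LearnsPAR A (n :: par) n k (δ / 2) s t → 0 < δ → δ ≤ 1 - ρ → 0 < (η : ℝ) →
        (η : ℝ) < 1 / 3 → (ρ ≤ (η : ℝ) * s * Real.logb 2 (1 / δ) ∨ (η : ℝ) * s ≤ δ / 2) →
        SolvesLPN A' (n :: s :: t :: ⌈Real.logb 2 (1 / δ)⌉₊ :: ⌊1 / (η : ℝ)⌋₊ :: par) n k η δ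
          (C * (s * Real.logb 2 (1 / δ)))
          (K * (2 : ℝ) ^ (C * (entropy (3 * η / 2) * s * Real.logb 2 (1 / δ))) *
            (t + s * Real.logb 2 (1 / δ))) := by
  -- The assumption `δ ≤ 1 - ρ` keeps `log₂(1/δ)` above the positive constant `L₀`. So rounding it
  -- up, or dropping it as a factor, costs only the constant `1 + u` or `u`.
  set L₀ := Real.logb 2 (1 / (1 - ρ)) with hL₀
  have hL₀pos : 0 < L₀ := Real.logb_pos (by norm_num) (by
    rw [lt_div_iff₀ (by linarith)]
    linarith)
  set u := 1 / L₀ with hu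
  have hupos : 0 < u := by positivity
  set c := ⌈1 / ρ⌉₊ with hc
  have hcρ : 1 / ρ ≤ c := Nat.le_ceil _
  -- The first term covers the `500m + 8ls = 508m` examples; the others cover the exponent in
  -- `words_mul_sq_le`, with `s` and `m` replaced by multiples of `s * L`.
  set C : ℝ := 508 * (1 + u) + 40 * u + (4 + 8 * c) * (1 + u) with hC
  have hcnn : (0 : ℝ) ≤ c := Nat.cast_nonneg c
  refine ⟨C, by positivity, fun A => ⟨noisyProg c A,
    ((2 * A.bound + c + 16 + 2 * simCost 4 A : ℕ) : ℝ) + 3 * u +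
    ((8 * (A.bound + 2 * simCost 5 A + 10000) + A.bound + c + 14 : ℕ) : ℝ), by positivity, ?_⟩⟩
  intro n k s t par δ η hA hδ hδρ hη hη' hcase
  set L := Real.logb 2 (1 / δ) with hL
  have hLL₀ : L₀ ≤ L := Real.logb_le_logb_of_le (by norm_num)
    (one_div_pos.2 (by linarith)) (one_div_le_one_div_of_le hδ hδρ)
  have hLpos : 0 < L := hL₀pos.trans_le hLL₀
  have huL : 1 ≤ u * L := by
    rw [hu, one_div, ← div_eq_inv_mul, le_div_iff₀ hL₀pos, one_mul]
    exact hLL₀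
  set l := ⌈L⌉₊ with hl
  set q := ⌊1 / (η : ℝ)⌋₊ with hq
  have hLl : L ≤ l := Nat.le_ceil L
  have hlL : (l : ℝ) ≤ (1 + u) * L := by
    have := Nat.ceil_lt_add_one hLpos.le
    rw [← hl] at this
    linarith
  have hs0 : (0 : ℝ) ≤ s := Nat.cast_nonneg s
  have ht0 : (0 : ℝ) ≤ t := Nat.cast_nonneg t
  have hsL : (s : ℝ) ≤ u * (s * L) := by nlinarith
  have hsL0 : 0 ≤ s * L := by positivity
  have hsl : ((s * l : ℕ) : ℝ) ≤ (1 + u) * (s * L) := by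
    push_cast
    nlinarith
  have hH : 0 ≤ entropy (3 * η / 2) := entropy_nonneg (by linarith) (by linarith)
  set H := entropy (3 * η / 2)
  have hqη : (η : ℝ) * q ≤ 1 := by
    have h := Nat.floor_le (one_div_nonneg.2 hη.le)
    rwa [le_div_iff₀ hη, mul_comm, ← hq] at h
  have hq1 : 0 < q := Nat.floor_pos.2 (by
    rw [le_div_iff₀ hη]
    linarith)
  have hpow1 : 1 ≤ (2 : ℝ) ^ (C * (H * s * L)) :=
    Real.one_le_rpow (by norm_num) (by positivity)
  by_cases hX : c * (s * l) < q
  · have hηs : (η : ℝ) * s ≤ δ / 2 := by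
      -- If `ρ ≤ ηsL`, then `1 ≤ cρ ≤ η·c·s·l < ηq ≤ 1`, a contradiction.
      refine hcase.resolve_left fun h => ?_
      have h1 : ρ ≤ η * s * l := h.trans (mul_le_mul_of_nonneg_left hLl (by positivity))
      have h2 : ((c * (s * l) : ℕ) : ℝ) < q := by exact_mod_cast hX
      rw [div_le_iff₀ hρ] at hcρ
      push_cast at h2
      have h3 : (c : ℝ) * ρ ≤ c * (η * s * l) := mul_le_mul_of_nonneg_left h1 hcnn
      have h4 : (η : ℝ) * (c * (s * l)) < η * q := mul_lt_mul_of_pos_left h2 hη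
      linarith
    refine solvesLPN_of_lt hA hδ (by linarith) hX hηs ?_ fun _ => ?_
    · refine hsL.trans (mul_le_mul_of_nonneg_right ?_ hsL0)
      rw [hC]
      nlinarith
    · set a : ℝ := ((2 * A.bound + c + 16 + 2 * simCost 4 A : ℕ) : ℝ)
      have ha : 0 ≤ a := Nat.cast_nonneg _
      set b : ℝ := ((8 * (A.bound + 2 * simCost 5 A + 10000) + A.bound + c + 14 : ℕ) : ℝ)
      have hb : 0 ≤ b := Nat.cast_nonneg _
      calc a * t + 3 * s ≤ (a + 3 * u + b) * 1 * (t + s * L) := by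
            have h1 := mul_nonneg ha hsL0
            have h2 := mul_nonneg hupos.le ht0
            have h3 := mul_nonneg hb hsL0
            have h4 := mul_nonneg hb ht0
            linarith
        _ ≤ _ := by gcongr
  · push Not at hX
    have hw := words_mul_sq_le hη hη' (s := s) (m := s * l) (c := c) hq hX
    refine solvesLPN_of_le hA hδ (by linarith) hq1 hX hqη hη' ?_ ?_ ?_
    · have h1 : (2 : ℝ) ^ L = 1 / δ := logb_one_div_eq hδ
      have h2 : (2 : ℝ) ^ L ≤ 2 ^ l := by
        rw [← Real.rpow_natCast]
        exact Real.rpow_le_rpow_of_exponent_le (by norm_num) hLl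
      rw [h1, div_le_iff₀ hδ] at h2
      rw [one_div, inv_pow, inv_le_iff_one_le_mul₀ (by positivity)]
      linarith
    · refine (mul_le_mul_of_nonneg_left hsl (by norm_num)).trans ?_
      rw [← mul_assoc]
      refine mul_le_mul_of_nonneg_right ?_ hsL0
      rw [hC]
      nlinarith
    · set a : ℝ := ((2 * A.bound + c + 16 + 2 * simCost 4 A : ℕ) : ℝ)
      have ha : 0 ≤ a := Nat.cast_nonneg _
      set b : ℝ := ((8 * (A.bound + 2 * simCost 5 A + 10000) + A.bound + c + 14 : ℕ) : ℝ)
      have hb : 0 ≤ b := Nat.cast_nonneg _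
      have hexp : 40 * (H * s) + (4 + 8 * c) * (H * ((s * l : ℕ) : ℝ)) ≤ C * (H * s * L) := by
        have h1 : H * s ≤ H * (u * (s * L)) := mul_le_mul_of_nonneg_left hsL hH
        have h2 : H * ((s * l : ℕ) : ℝ) ≤ H * ((1 + u) * (s * L)) :=
          mul_le_mul_of_nonneg_left hsl hH
        have h3 := mul_le_mul_of_nonneg_left h2 (by positivity : (0 : ℝ) ≤ 4 + 8 * c)
        have h4 : 0 ≤ 508 * (1 + u) * (H * (s * L)) := by positivity
        rw [hC]
        linarith
      calc _ ≤ b * (2 ^ (C * (H * s * L)) * t) := by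
            refine mul_le_mul_of_nonneg_left (mul_le_mul_of_nonneg_right (hw.trans ?_) ht0) hb
            exact Real.rpow_le_rpow_of_exponent_le (by norm_num) hexp
        _ = b * 2 ^ (C * (H * s * L)) * t := by ring
        _ ≤ _ := by
            gcongr
            · have : 0 ≤ a + 3 * u := by positivity
              linarith
            · linarith

end ParityLearning

theorem mainTheorem3 (ρ : ℝ) (hρ : 0 < ρ) :
    ∃ C : ℝ, 0 < C ∧ ∀ A : ParityLearning.Prog, ∃ (A' : ParityLearning.Prog) (K : ℝ), 0 < K ∧
      ∀ (n k : ℕ) (s t : ℝ → ℕ) (par : ℝ → List ℕ),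
        (∀ δ : ℝ, 0 < δ → δ < 1 →
          ParityLearning.LearnsPAR A (n :: par δ) n k δ (s δ) (t δ)) →
        ∀ (δ : ℝ) (η : unitInterval), 0 < δ → δ ≤ 1 - ρ → 0 < (η : ℝ) → (η : ℝ) < 1 / 3 →
          (ρ ≤ (η : ℝ) * s (δ / 2) * Real.logb 2 (1 / δ) ∨ (η : ℝ) * s (δ / 2) ≤ δ / 2) →
          ParityLearning.SolvesLPN A'
            (n :: s (δ / 2) :: t (δ / 2) :: ⌈Real.logb 2 (1 / δ)⌉₊ :: ⌊1 / (η : ℝ)⌋₊ ::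
              par (δ / 2))
            n k η δ
            (C * (s (δ / 2) * Real.logb 2 (1 / δ)))
            (K * (2 : ℝ) ^ (C * (ParityLearning.entropy (3 * η / 2) * s (δ / 2) *
                Real.logb 2 (1 / δ))) *
              (t (δ / 2) + s (δ / 2) * Real.logb 2 (1 / δ))) := by
  rcases lt_or_ge ρ 1 with hρ1 | hρ1
  · obtain ⟨C, hC, h⟩ := ParityLearning.exists_solvesLPN hρ hρ1
    refine ⟨C, hC, fun A => ?_⟩
    obtain ⟨A', K, hK, h'⟩ := h A
    exact ⟨A', K, hK, fun n k s t par hA δ η hδ hδρ => h' n k _ _ _ δ η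
      (hA (δ / 2) (by linarith) (by linarith)) hδ hδρ⟩
  -- For `ρ ≥ 1` there is no `δ` with `0 < δ ≤ 1 - ρ`.
  · exact ⟨1, one_pos, fun A => ⟨A, 1, one_pos, fun n k s t par _ δ η hδ hδρ =>
      absurd (hδ.trans_le hδρ) (by linarith)⟩⟩
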